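/- For an integer $N\ge 2$ and real numbers $0<\varepsilon<1/2$, $r_0>0$, an $(\varepsilon,r_0)$-Reifenberg-flat domain is an open, bounded, connected, non-empty set $\Omega\subset\mathbb R^N$ such that (i) for every $x\in\partial\Omega$ and every $0<r\le r_0$ there is a hyperplane $P(x,r)$ containing $x$ with $\frac1r\, d_H\big(\partial\Omega\cap B(x,r),\,P(x,r)\cap B(x,r)\big)\le\varepsilon$, where $d_H$ is the Hausdorff distance and $B(x,r)$ the open ball; and (ii) for every $x\in\partial\Omega$, one of the two connected components of $B(x,r_0)\cap\{y:\ d(y,P(x,r_0))\ge 2\varepsilon r_0\}$ is contained in $\Omega$ and the other one in $\mathbb R^N\setminus\Omega$. **Corollary.** Let $2\le N\le 5$, and let $I_N=[2,+\infty)$ if $N=2$ and $I_N=\big(\frac{2N}{6-N},+\infty\big)$ if $3\le N\le 5$. For every $\alpha>0$ there is $\varepsilon=\varepsilon(N,\alpha)\in(0,1/2)$ such that the following holds. Let $q\in I_N$ satisfy $$\alpha<1-\frac N2\left(\frac{N-2}{2N}+\frac1q\right),$$ let $r_0>0$, let $\Omega\subset\mathbb R^N$ be an $(\varepsilon,r_0)$-Reifenberg-flat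 domain and let $f\in L^q(\Omega)$. Then the problem $$-\Delta u=f\ \text{ in }\Omega,\qquad u=0\ \text{ on }\partial\Omega,$$ has a unique weak solution $u\in W^{1,2}_0(\Omega)$, that is, $\int_\Omega\nabla u\cdot\nabla v\,dx=\int_\Omega vf\,dx$ for all $v\in W^{1,2}_0(\Omega)$. This $u$ has a representative, defined on $\overline\Omega$, such that $$u\in C^{0,\alpha}\big(B(x,r_0/12)\cap\overline\Omega\big)\qquad\text{for all }x\in\overline\Omega,$$ and moreover $$\|u\|_{C^{0,\alpha}(B(x,r_0/12)\cap\overline\Omega)}\le C\qquad\text{for all }x\in\overline\Omega,$$ where $\|u\|_{C^{0,\alpha}(S)}=\sup_{S}|u|+\sup_{y\ne z\in S}\frac{|u(y)-u(z)|}{|y-z|^\alpha}$. Here $C=C(N,r_0,\alpha,q,\|\nabla u\|_{L^2(\Omega)},\|f\|_{L^q(\Omega)})$ if $3\le N\le5$, and $C=C(r_0,\alpha,q,\|\nabla u\|_{L^2(\Omega)},\|f\|_{L^q(\Omega)},|\Omega|)$ if $N=2$. -/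

import Mathlib

open MeasureTheory Filter Topology
open scoped ContDiff ENNReal

noncomputable section

/-- The hyperplane of `ℝ^N` through `x` with normal vector `ν`. -/
def hyperplaneThrough {N : ℕ} (x ν : EuclideanSpace ℝ (Fin N)) :
    Set (EuclideanSpace ℝ (Fin N)) :=
  {y | inner ℝ ν (y - x) = 0}

/-- `Ω ⊆ ℝ^N` is an `(ε, r₀)`-Reifenberg-flat domain. The hyperplane `P(x, r)` is given by a unit
normal vector `n x r`, so that `|inner ℝ (n x r) (y - x)|` is the distance of `y` to `P(x, r)`. As
`2 * ε < 1`, the set of the points of `B(x, r₀)` at distance at least `2 * ε * r₀` from `P(x, r₀)`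
has exactly two connected components, which are the two (convex) caps in `caps`; the sign of
`n x r₀` is chosen so that it points to the cap that lies in `Ω`. -/
structure IsReifenbergFlat {N : ℕ} (ε r₀ : ℝ) (Ω : Set (EuclideanSpace ℝ (Fin N))) : Prop where
  eps_pos : 0 < ε
  eps_lt : ε < 1 / 2
  r_pos : 0 < r₀
  isOpen : IsOpen Ω
  isBounded : Bornology.IsBounded Ω
  isConnected : IsConnected Ω
  flat : ∃ n : EuclideanSpace ℝ (Fin N) → ℝ → EuclideanSpace ℝ (Fin N),
    (∀ x ∈ frontier Ω, ∀ r : ℝ, 0 < r → r ≤ r₀ →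
      ‖n x r‖ = 1 ∧
      Metric.hausdorffDist (frontier Ω ∩ Metric.ball x r)
        (hyperplaneThrough x (n x r) ∩ Metric.ball x r) / r ≤ ε) ∧
    (∀ x ∈ frontier Ω,
      (Metric.ball x r₀ ∩ {y | 2 * ε * r₀ ≤ inner ℝ (n x r₀) (y - x)} ⊆ Ω) ∧
      (Metric.ball x r₀ ∩ {y | inner ℝ (n x r₀) (y - x) ≤ -(2 * ε * r₀)} ⊆ Ωᶜ))

/-- Test functions: the elements of `C_c^∞(Ω)`. -/
structure IsTestFunction {N : ℕ} (Ω : Set (EuclideanSpace ℝ (Fin N)))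
    (φ : EuclideanSpace ℝ (Fin N) → ℝ) : Prop where
  contDiff : ContDiff ℝ ∞ φ
  hasCompactSupport : HasCompactSupport φ
  tsupport_subset : tsupport φ ⊆ Ω

/-- `u ∈ W^{1,2}(Ω)`, with weak gradient `G`. Only the values of `u` and `G` on `Ω`, up to a null
set, matter. -/
structure MemW12 {N : ℕ} (Ω : Set (EuclideanSpace ℝ (Fin N)))
    (u : EuclideanSpace ℝ (Fin N) → ℝ)
    (G : EuclideanSpace ℝ (Fin N) → EuclideanSpace ℝ (Fin N)) : Prop where
  memLp : MemLp u 2 (volume.restrict Ω)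
  memLp_grad : MemLp G 2 (volume.restrict Ω)
  isWeakGradient : ∀ φ : EuclideanSpace ℝ (Fin N) → ℝ, IsTestFunction Ω φ →
    ∫ x in Ω, u x • gradient φ x = -∫ x in Ω, φ x • G x

/-- `u ∈ W^{1,2}_0(Ω)`, with weak gradient `G`: `u` belongs to the closure of `C_c^∞(Ω)` in
`W^{1,2}(Ω)`. -/
structure MemW120 {N : ℕ} (Ω : Set (EuclideanSpace ℝ (Fin N)))
    (u : EuclideanSpace ℝ (Fin N) → ℝ)
    (G : EuclideanSpace ℝ (Fin N) → EuclideanSpace ℝ (Fin N)) : Prop where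
  memW12 : MemW12 Ω u G
  approx : ∃ φ : ℕ → EuclideanSpace ℝ (Fin N) → ℝ, (∀ k, IsTestFunction Ω (φ k)) ∧
    Tendsto (fun k => eLpNorm (fun x => u x - φ k x) 2 (volume.restrict Ω)) atTop (𝓝 0) ∧
    Tendsto (fun k => eLpNorm (fun x => G x - gradient (φ k) x) 2 (volume.restrict Ω))
      atTop (𝓝 0)

/-- `u`, with weak gradient `G`, is a weak solution in `W^{1,2}_0(Ω)` of `-Δ u = f` in `Ω`,
`u = 0` on `∂Ω`. -/
structure IsWeakSolution {N : ℕ} (Ω : Set (EuclideanSpace ℝ (Fin N)))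
    (f u : EuclideanSpace ℝ (Fin N) → ℝ)
    (G : EuclideanSpace ℝ (Fin N) → EuclideanSpace ℝ (Fin N)) : Prop where
  memW120 : MemW120 Ω u G
  weak_eq : ∀ (v : EuclideanSpace ℝ (Fin N) → ℝ)
    (H : EuclideanSpace ℝ (Fin N) → EuclideanSpace ℝ (Fin N)), MemW120 Ω v H →
      ∫ x in Ω, inner ℝ (G x) (H x) = ∫ x in Ω, v x * f x

/-- The norm of `C^{0,α}(S)`: the supremum of `|v|` on `S` plus the optimal `α`-Hölder constant of
`v` on `S` (infinite if `v` is unbounded or not `α`-Hölder on `S`). -/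
def holderSpaceNorm {N : ℕ} (α : ℝ) (S : Set (EuclideanSpace ℝ (Fin N)))
    (v : EuclideanSpace ℝ (Fin N) → ℝ) : ℝ≥0∞ :=
  (⨆ y ∈ S, ‖v y‖ₑ) + eHolderNorm α.toNNReal (S.domRestrict v)

/-- `v ∈ C^{0,α}(S)`. -/
def MemHolderSpace {N : ℕ} (α : ℝ) (S : Set (EuclideanSpace ℝ (Fin N)))
    (v : EuclideanSpace ℝ (Fin N) → ℝ) : Prop :=
  holderSpaceNorm α S v < ⊤

/-- The range `I_N` of the exponent `q`. -/
def exponentRange (N : ℕ) : Set ℝ :=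
  if N = 2 then Set.Ici 2 else Set.Ioi (2 * (N : ℝ) / (6 - (N : ℝ)))

end

/-!
The weak solution `u` and the datum `f` are extended by zero to `ℝ^N`. Two facts about the
extensions are used (`IsExtendedSolution`): `-Δ u = f` holds in `Ω`, and `-Δ |u| ≤ |f|` holds in all
of `ℝ^N` in the sense of distributions. The second is an inequality of Kato, obtained by testing
the equation with a smoothed sign of `u` (`IsWeakSolution.integral_abs_mul_laplacian_ge`). Besides,
`∫_{B(z,t)} |f| ≤ A t^{N-2+β}` with `β = 2 - N/q`, by Hölder's inequality.

*Averages.* There are radial kernels `K_t`, `J_t`, supported in the closed ball of radius `t`, with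
`∫ K_t = 1` and `∂_t K_t = Δ J_t` (`RadialProfile.hasDerivAt_mean`,
`RadialProfile.laplacian_potential_sub`). Hence the derivative in `t` of the average
`∫ K_t(y - z) u(y) dy` is controlled by `∫ J_t(y - z) |f(y)| dy`, that is, by a multiple of
`t^{β-1}`: from below for `|u|`, everywhere, and from both sides for `u`, as long as the ball lies
in `Ω`. So the averages of `u` converge as `t → 0`, at every point of `Ω`, to a representative `v`
(`IsPreciseRepresentative`), and `|v(z)|` is bounded by any average of `|u|` around `z` plus a
multiple of `t^β`.

*Decay at the boundary.* Suppose that, within `B(x, r)`, the set `Ω` lies above a hyperplane close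
to the boundary point `x`. If `z*` is the reflection of `z` across a parallel hyperplane, the
difference of the averages of `|u|` at `z` and `z*` is again monotone in the scale up to a multiple
of `r^β`: the difference of the kernels vanishes on the hyperplane, and `|u|` vanishes below it. At
small scales the average at `z*` is zero, while at the scale `r` the two averages differ by at most
a multiple of `|z - z*| / r` times the supremum of `|v|`. Hence passing from `r` to `θ r` reduces
the supremum by a factor of order `θ` (`IsExtendedSolution.decay_step`). As `α < 1`, a small `θ`
makes this factor less than `θ^α / 2`, and iteration gives `|v(y)| ≤ D |y - x|^α`
(`IsExtendedSolution.abs_le_rpow_of_flat`). With `ε = θ / 5`, Reifenberg flatness provides the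
hyperplanes at all scales `θ^k r₀`: the caps at consecutive scales meet and do not meet `∂Ω`, so by
connectedness the property of lying outside `Ω` passes from one scale to the next
(`IsReifenbergFlat.exists_exterior_cap`).

*Conclusion.* The averages also give an interior Hölder estimate, which combines with the decay at
the boundary to a global one (`IsExtendedSolution.abs_sub_le_of_decay`). The constants involve the
supremum of `|v|`, which is bounded by the integrals of `|u|` over balls of radius `r₀`, and these
by the Gagliardo–Nirenberg–Sobolev inequality (`exists_setIntegral_abs_le`); it is used from `L¹`
if `N = 2`, and there the measure of `Ω` enters. Existence and uniqueness are the theorem of Lax and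
Milgram in the closure of the pairs `(φ, ∇φ)` in `L² × L²` (`exists_isWeakSolution`).
-/

/-! ### Smooth functions and Green's formula -/

open InnerProductSpace in
open scoped Laplacian in
/-- The Laplacian in Cartesian coordinates. -/
lemma laplacian_eq_sum_fderiv {N : ℕ} {η : EuclideanSpace ℝ (Fin N) → ℝ} (hη : ContDiff ℝ ∞ η)
    (x : EuclideanSpace ℝ (Fin N)) :
    Laplacian.laplacian η x = ∑ i,
      fderiv ℝ (fun z => fderiv ℝ η z (EuclideanSpace.basisFun (Fin N) ℝ i)) x
      (EuclideanSpace.basisFun (Fin N) ℝ i) := by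
  rw [laplacian_eq_iteratedFDeriv_orthonormalBasis η (EuclideanSpace.basisFun (Fin N) ℝ)]
  refine Finset.sum_congr rfl fun i _ => ?_
  rw [iteratedFDeriv_two_apply]
  have h : DifferentiableAt ℝ (fderiv ℝ η) x :=
    ((hη.fderiv_right (m := ∞) (by simp)).differentiable (by simp)) x
  rw [fderiv_clm_apply h (by fun_prop)]
  simp

lemma contDiff_fderiv_apply {N : ℕ} {η : EuclideanSpace ℝ (Fin N) → ℝ} (hη : ContDiff ℝ ∞ η)
    (v : EuclideanSpace ℝ (Fin N)) : ContDiff ℝ ∞ (fun z => fderiv ℝ η z v) :=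
  (hη.fderiv_right (m := ∞) (by simp)).clm_apply contDiff_const

lemma contDiff_laplacian {N : ℕ} {η : EuclideanSpace ℝ (Fin N) → ℝ} (hη : ContDiff ℝ ∞ η) :
    ContDiff ℝ ∞ (Laplacian.laplacian η) := by
  have : Laplacian.laplacian η = fun x => _ := funext (laplacian_eq_sum_fderiv hη)
  rw [this]
  exact ContDiff.sum fun i _ => contDiff_fderiv_apply (contDiff_fderiv_apply hη _) _

lemma laplacian_eq_zero_of_notMem_tsupport {N : ℕ} {η : EuclideanSpace ℝ (Fin N) → ℝ}
    {x : EuclideanSpace ℝ (Fin N)} (hx : x ∉ tsupport η) : Laplacian.laplacian η x = 0 := by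
  have h : η =ᶠ[𝓝 x] fun _ => (0 : ℝ) := notMem_tsupport_iff_eventuallyEq.1 hx
  rw [(InnerProductSpace.laplacian_congr_nhds h).self_of_nhds]
  simp

lemma hasCompactSupport_laplacian {N : ℕ} {η : EuclideanSpace ℝ (Fin N) → ℝ}
    (hc : HasCompactSupport η) : HasCompactSupport (Laplacian.laplacian η) :=
  hc.of_isClosed_subset (isClosed_tsupport _) (closure_minimal (fun x hx => by
    by_contra h
    exact hx (laplacian_eq_zero_of_notMem_tsupport h)) (isClosed_tsupport _))

lemma inner_gradient {N : ℕ} (a : EuclideanSpace ℝ (Fin N) → ℝ) (x v : EuclideanSpace ℝ (Fin N)) :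
    inner ℝ (gradient a x) v = fderiv ℝ a x v := by
  simp [gradient]

lemma norm_gradient {N : ℕ} (a : EuclideanSpace ℝ (Fin N) → ℝ) (x : EuclideanSpace ℝ (Fin N)) :
    ‖gradient a x‖ = ‖fderiv ℝ a x‖ := by
  simp [gradient]

lemma continuous_gradient {N : ℕ} {a : EuclideanSpace ℝ (Fin N) → ℝ} (ha : ContDiff ℝ 1 a) :
    Continuous (gradient a) :=
  (InnerProductSpace.toDual ℝ _).symm.continuous.comp (ha.continuous_fderiv (by simp))

lemma hasCompactSupport_gradient {N : ℕ} {a : EuclideanSpace ℝ (Fin N) → ℝ}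
    (hc : HasCompactSupport a) : HasCompactSupport (gradient a) := by
  refine (hc.fderiv (𝕜 := ℝ)).mono fun x hx => ?_
  rw [Function.mem_support] at hx ⊢
  rwa [← norm_ne_zero_iff, ← norm_gradient, norm_ne_zero_iff]

/-- Green's formula; only one of the two functions has compact support. -/
lemma integral_mul_laplacian {N : ℕ} {a η : EuclideanSpace ℝ (Fin N) → ℝ} (ha : ContDiff ℝ 1 a)
    (hη : ContDiff ℝ ∞ η) (hc : HasCompactSupport η) :
    ∫ x, a x * Laplacian.laplacian η x = -∫ x, inner ℝ (gradient a x) (gradient η x) := by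
  set b := EuclideanSpace.basisFun (Fin N) ℝ
  have hd (i) : HasCompactSupport (fun z => fderiv ℝ η z (b i)) := hc.fderiv_apply (𝕜 := ℝ) (b i)
  have hs (i) : ContDiff ℝ ∞ (fun z => fderiv ℝ η z (b i)) := contDiff_fderiv_apply hη (b i)
  have ha' (i) : Continuous (fun x => fderiv ℝ a x (b i)) :=
    (ha.continuous_fderiv (by simp)).clm_apply continuous_const
  have i1 (i) : Integrable (fun x => fderiv ℝ a x (b i) * fderiv ℝ η x (b i)) :=
    ((ha' i).mul (hs i).continuous).integrable_of_hasCompactSupport ((hd i).mul_left)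
  have i2 (i) : Integrable
      (fun x => a x * fderiv ℝ (fun z => fderiv ℝ η z (b i)) x (b i)) :=
    (ha.continuous.mul (contDiff_fderiv_apply (hs i) _).continuous).integrable_of_hasCompactSupport
      (((hd i).fderiv_apply (𝕜 := ℝ) (b i)).mul_left)
  have i3 (i) : Integrable (fun x => a x * fderiv ℝ η x (b i)) :=
    (ha.continuous.mul (hs i).continuous).integrable_of_hasCompactSupport ((hd i).mul_left)
  have e1 : ∀ x, inner ℝ (gradient a x) (gradient η x) =
      ∑ i, fderiv ℝ a x (b i) * fderiv ℝ η x (b i) := fun x => by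
    rw [← b.sum_inner_mul_inner]
    refine Finset.sum_congr rfl fun i _ => ?_
    rw [inner_gradient, real_inner_comm, inner_gradient]
  simp_rw [e1, laplacian_eq_sum_fderiv hη, Finset.mul_sum]
  rw [integral_finsetSum _ fun i _ => i2 i, integral_finsetSum _ fun i _ => i1 i,
    ← Finset.sum_neg_distrib]
  refine Finset.sum_congr rfl fun i _ => ?_
  exact integral_mul_fderiv_eq_neg_fderiv_mul_of_integrable (i1 i) (i2 i) (i3 i)
    (fun x _ => ha.differentiable (by simp) x) (fun x _ => (hs i).differentiable (by simp) x)

/-! ### Test functions as elements of the Sobolev space -/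

namespace IsTestFunction

variable {N : ℕ} {Ω : Set (EuclideanSpace ℝ (Fin N))} {φ : EuclideanSpace ℝ (Fin N) → ℝ}

lemma memLp (h : IsTestFunction Ω φ) (p : ℝ≥0∞) (μ : Measure (EuclideanSpace ℝ (Fin N)))
    [IsFiniteMeasureOnCompacts μ] : MemLp φ p μ :=
  h.contDiff.continuous.memLp_of_hasCompactSupport h.hasCompactSupport

lemma memLp_gradient (h : IsTestFunction Ω φ) (p : ℝ≥0∞) (μ : Measure (EuclideanSpace ℝ (Fin N)))
    [IsFiniteMeasureOnCompacts μ] : MemLp (gradient φ) p μ :=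
  (continuous_gradient (h.contDiff.of_le (by exact_mod_cast le_top))).memLp_of_hasCompactSupport
    (hasCompactSupport_gradient h.hasCompactSupport)

lemma eq_zero (h : IsTestFunction Ω φ) {x : EuclideanSpace ℝ (Fin N)} (hx : x ∉ Ω) : φ x = 0 :=
  image_eq_zero_of_notMem_tsupport fun h' => hx (h.tsupport_subset h')

lemma gradient_eq_zero (h : IsTestFunction Ω φ) {x : EuclideanSpace ℝ (Fin N)} (hx : x ∉ Ω) :
    gradient φ x = 0 := by
  rw [← norm_eq_zero, norm_gradient, norm_eq_zero]
  have h' : φ =ᶠ[𝓝 x] fun _ => (0 : ℝ) :=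
    notMem_tsupport_iff_eventuallyEq.1 fun h' => hx (h.tsupport_subset h')
  simp [h'.fderiv_eq]

lemma isWeakGradient (h : IsTestFunction Ω φ)
    {ξ : EuclideanSpace ℝ (Fin N) → ℝ} (hξ : IsTestFunction Ω ξ) :
    ∫ x in Ω, φ x • gradient ξ x = -∫ x in Ω, ξ x • gradient φ x := by
  have z1 : ∀ x, x ∉ Ω → φ x • gradient ξ x = 0 := fun x hx => by simp [h.eq_zero hx]
  have z2 : ∀ x, x ∉ Ω → ξ x • gradient φ x = 0 := fun x hx => by simp [hξ.eq_zero hx]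
  rw [setIntegral_eq_integral_of_forall_compl_eq_zero z1,
    setIntegral_eq_integral_of_forall_compl_eq_zero z2]
  have hh := h.contDiff.continuous
  have hh' := hξ.contDiff.continuous
  have g1 := continuous_gradient (h.contDiff.of_le (by exact_mod_cast le_top))
  have g2 := continuous_gradient (hξ.contDiff.of_le (by exact_mod_cast le_top))
  have i1 : Integrable (fun x => φ x • gradient ξ x) :=
    (hh.smul g2).integrable_of_hasCompactSupport h.hasCompactSupport.smul_right
  have i2 : Integrable (fun x => ξ x • gradient φ x) :=
    (hh'.smul g1).integrable_of_hasCompactSupport hξ.hasCompactSupport.smul_right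
  refine ext_inner_right ℝ fun v => ?_
  rw [inner_neg_left, real_inner_comm, ← integral_inner i1, real_inner_comm, ← integral_inner i2]
  simp_rw [inner_smul_right, real_inner_comm _ v, inner_gradient]
  have := integral_mul_fderiv_eq_neg_fderiv_mul_of_integrable (μ := volume) (f := φ) (g := ξ)
    (v := v) ?_ ?_ ?_ (fun x _ => h.contDiff.differentiable (by simp) x)
    (fun x _ => hξ.contDiff.differentiable (by simp) x)
  · simpa only [mul_comm] using this
  · exact ((contDiff_fderiv_apply h.contDiff v).continuous.mul
      hh').integrable_of_hasCompactSupport hξ.hasCompactSupport.mul_left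
  · exact (hh.mul (contDiff_fderiv_apply hξ.contDiff v).continuous).integrable_of_hasCompactSupport
      h.hasCompactSupport.mul_right
  · exact (hh.mul hh').integrable_of_hasCompactSupport h.hasCompactSupport.mul_right

lemma memW120 (h : IsTestFunction Ω φ) : MemW120 Ω φ (gradient φ) where
  memW12 := ⟨h.memLp _ _, h.memLp_gradient _ _, fun _ hξ => h.isWeakGradient hξ⟩
  approx := ⟨fun _ => φ, fun _ => h, by simp, by simp⟩

lemma add {ψ : EuclideanSpace ℝ (Fin N) → ℝ} (h : IsTestFunction Ω φ) (h' : IsTestFunction Ω ψ) :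
    IsTestFunction Ω (φ + ψ) where
  contDiff := h.contDiff.add h'.contDiff
  hasCompactSupport := h.hasCompactSupport.add h'.hasCompactSupport
  tsupport_subset := (tsupport_add φ ψ).trans
    (Set.union_subset h.tsupport_subset h'.tsupport_subset)

lemma const_smul (h : IsTestFunction Ω φ) (c : ℝ) : IsTestFunction Ω (c • φ) where
  contDiff := contDiff_const.smul h.contDiff
  hasCompactSupport := h.hasCompactSupport.smul_left (f := fun _ => c)
  tsupport_subset := (tsupport_smul_subset_right (fun _ => c) φ).trans h.tsupport_subset

end IsTestFunction

/-- The Cauchy–Schwarz inequality in `L²`. -/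
lemma abs_integral_mul_le {N : ℕ} {μ : Measure (EuclideanSpace ℝ (Fin N))}
    {a b : EuclideanSpace ℝ (Fin N) → ℝ} (ha : MemLp a 2 μ) (hb : MemLp b 2 μ) :
    |∫ x, a x * b x ∂μ| ≤ (eLpNorm a 2 μ).toReal * (eLpNorm b 2 μ).toReal := by
  have := abs_real_inner_le_norm (ha.toLp a) (hb.toLp b)
  rw [L2.inner_def, Lp.norm_toLp, Lp.norm_toLp] at this
  refine le_of_eq_of_le ?_ this
  congr 1
  refine integral_congr_ae ?_
  filter_upwards [ha.coeFn_toLp, hb.coeFn_toLp] with x h1 h2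
  simp [h1, h2, mul_comm]

lemma abs_integral_inner_le {N : ℕ} {μ : Measure (EuclideanSpace ℝ (Fin N))}
    {a b : EuclideanSpace ℝ (Fin N) → EuclideanSpace ℝ (Fin N)} (ha : MemLp a 2 μ)
    (hb : MemLp b 2 μ) :
    |∫ x, inner ℝ (a x) (b x) ∂μ| ≤ (eLpNorm a 2 μ).toReal * (eLpNorm b 2 μ).toReal := by
  have := abs_real_inner_le_norm (ha.toLp a) (hb.toLp b)
  rw [L2.inner_def, Lp.norm_toLp, Lp.norm_toLp] at this
  refine le_of_eq_of_le ?_ this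
  congr 1
  refine integral_congr_ae ?_
  filter_upwards [ha.coeFn_toLp, hb.coeFn_toLp] with x h1 h2
  simp [h1, h2]

lemma integrable_inner_of_memLp {N : ℕ} {μ : Measure (EuclideanSpace ℝ (Fin N))}
    {a b : EuclideanSpace ℝ (Fin N) → EuclideanSpace ℝ (Fin N)} (ha : MemLp a 2 μ)
    (hb : MemLp b 2 μ) : Integrable (fun x => inner ℝ (a x) (b x)) μ := by
  refine (L2.integrable_inner (𝕜 := ℝ) (ha.toLp a) (hb.toLp b)).congr ?_
  filter_upwards [ha.coeFn_toLp, hb.coeFn_toLp] with x h1 h2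
  simp [h1, h2]

lemma integrable_mul_of_memLp {N : ℕ} {μ : Measure (EuclideanSpace ℝ (Fin N))}
    {a b : EuclideanSpace ℝ (Fin N) → ℝ} (ha : MemLp a 2 μ) (hb : MemLp b 2 μ) :
    Integrable (fun x => a x * b x) μ :=
  ha.integrable_mul hb

/-! ### The modulus of a weak solution is a subsolution in the whole space -/

/-- A smooth convex approximation of the modulus. -/
noncomputable def smoothAbs (δ t : ℝ) : ℝ := √(t ^ 2 + δ ^ 2) - δ

/-- The derivative of `smoothAbs δ`. -/
noncomputable def smoothSign (δ t : ℝ) : ℝ := t / √(t ^ 2 + δ ^ 2)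

lemma hasDerivAt_sqrt_sq_add {δ : ℝ} (hδ : 0 < δ) (t : ℝ) :
    HasDerivAt (fun t => √(t ^ 2 + δ ^ 2)) (smoothSign δ t) t := by
  have h : HasDerivAt (fun t : ℝ => t ^ 2 + δ ^ 2) (2 * t) t := by
    simpa using (hasDerivAt_pow 2 t).add_const (δ ^ 2)
  convert h.sqrt (by positivity) using 1
  rw [smoothSign, mul_div_mul_left _ _ two_ne_zero]

lemma hasDerivAt_smoothAbs {δ : ℝ} (hδ : 0 < δ) (t : ℝ) :
    HasDerivAt (smoothAbs δ) (smoothSign δ t) t :=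
  (hasDerivAt_sqrt_sq_add hδ t).sub_const δ

lemma contDiff_sqrt_sq_add {δ : ℝ} (hδ : 0 < δ) : ContDiff ℝ ∞ (fun t => √(t ^ 2 + δ ^ 2)) :=
  ContDiff.sqrt (by fun_prop) fun x => by positivity

lemma contDiff_smoothAbs {δ : ℝ} (hδ : 0 < δ) : ContDiff ℝ ∞ (smoothAbs δ) :=
  (contDiff_sqrt_sq_add hδ).sub contDiff_const

lemma contDiff_smoothSign {δ : ℝ} (hδ : 0 < δ) : ContDiff ℝ ∞ (smoothSign δ) :=
  contDiff_id.div (contDiff_sqrt_sq_add hδ) fun x => by positivity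

lemma abs_smoothSign_le {δ : ℝ} (hδ : 0 < δ) (t : ℝ) : |smoothSign δ t| ≤ 1 := by
  rw [smoothSign, abs_div, abs_of_pos (by positivity : 0 < √(t ^ 2 + δ ^ 2)),
    div_le_one (by positivity)]
  exact Real.abs_le_sqrt (by nlinarith)

lemma deriv_smoothSign {δ : ℝ} (hδ : 0 < δ) (t : ℝ) :
    deriv (smoothSign δ) t = δ ^ 2 / √(t ^ 2 + δ ^ 2) ^ 3 := by
  have h : 0 < √(t ^ 2 + δ ^ 2) := by positivity
  have := ((hasDerivAt_id t).div (hasDerivAt_sqrt_sq_add hδ t) h.ne').deriv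
  refine this.trans ?_
  have h2 : √(t ^ 2 + δ ^ 2) ^ 2 = t ^ 2 + δ ^ 2 := Real.sq_sqrt (by positivity)
  rw [smoothSign]
  simp only [id]
  field_simp
  linear_combination h2

lemma deriv_smoothSign_nonneg {δ : ℝ} (hδ : 0 < δ) (t : ℝ) : 0 ≤ deriv (smoothSign δ) t := by
  rw [deriv_smoothSign hδ]; positivity

lemma deriv_smoothSign_le {δ : ℝ} (hδ : 0 < δ) (t : ℝ) : deriv (smoothSign δ) t ≤ δ⁻¹ := by
  have h : δ ≤ √(t ^ 2 + δ ^ 2) := Real.le_sqrt_of_sq_le (by nlinarith)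
  rw [deriv_smoothSign hδ]
  calc δ ^ 2 / √(t ^ 2 + δ ^ 2) ^ 3 ≤ δ ^ 2 / δ ^ 3 := by gcongr
    _ = δ⁻¹ := by field_simp

lemma abs_smoothAbs_sub_le {δ : ℝ} (hδ : 0 < δ) (s t : ℝ) :
    |smoothAbs δ s - smoothAbs δ t| ≤ |s - t| := by
  have := Convex.norm_image_sub_le_of_norm_deriv_le (f := smoothAbs δ) (C := 1) (s := Set.univ)
    (x := t) (y := s) (fun x _ => (hasDerivAt_smoothAbs hδ x).differentiableAt)
    (fun x _ => by rw [(hasDerivAt_smoothAbs hδ x).deriv]; exact abs_smoothSign_le hδ x)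
    convex_univ trivial trivial
  simpa using this

lemma abs_abs_sub_smoothAbs_le {δ : ℝ} (hδ : 0 < δ) (t : ℝ) : |(|t| - smoothAbs δ t)| ≤ δ := by
  have h1 : |t| ≤ √(t ^ 2 + δ ^ 2) := Real.abs_le_sqrt (by nlinarith)
  have h2 : √(t ^ 2 + δ ^ 2) ≤ |t| + δ := by
    rw [Real.sqrt_le_iff]
    exact ⟨by positivity, by nlinarith [abs_nonneg t, sq_abs t]⟩
  rw [smoothAbs, abs_le]
  constructor <;> linarith

lemma gradient_comp {N : ℕ} {ψ : ℝ → ℝ} {ψ' : ℝ} {φ : EuclideanSpace ℝ (Fin N) → ℝ}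
    {x : EuclideanSpace ℝ (Fin N)} (hψ : HasDerivAt ψ ψ' (φ x)) (hφ : DifferentiableAt ℝ φ x) :
    gradient (fun y => ψ (φ y)) x = ψ' • gradient φ x := by
  refine ext_inner_right ℝ fun v => ?_
  rw [inner_gradient, inner_smul_left, inner_gradient,
    show fderiv ℝ (fun y => ψ (φ y)) x = _ from (hψ.comp_hasFDerivAt x hφ.hasFDerivAt).fderiv]
  simp

lemma gradient_mul {N : ℕ} {a b : EuclideanSpace ℝ (Fin N) → ℝ} {x : EuclideanSpace ℝ (Fin N)}
    (ha : DifferentiableAt ℝ a x) (hb : DifferentiableAt ℝ b x) :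
    gradient (fun y => a y * b y) x = b x • gradient a x + a x • gradient b x := by
  refine ext_inner_right ℝ fun v => ?_
  rw [inner_gradient, inner_add_left, inner_smul_left, inner_smul_left, inner_gradient,
    inner_gradient, fderiv_fun_mul ha hb]
  simp [add_comm]

lemma IsTestFunction.smoothSign_mul {N : ℕ} {Ω : Set (EuclideanSpace ℝ (Fin N))}
    {φ η : EuclideanSpace ℝ (Fin N) → ℝ} (hφ : IsTestFunction Ω φ) (hη : ContDiff ℝ ∞ η)
    {δ : ℝ} (hδ : 0 < δ) : IsTestFunction Ω (fun x => smoothSign δ (φ x) * η x) := by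
  have hs : tsupport (fun x => smoothSign δ (φ x) * η x) ⊆ tsupport φ :=
    closure_mono fun x hx h => hx (by simp [h, smoothSign])
  exact ⟨((contDiff_smoothSign hδ).comp hφ.contDiff).mul hη,
    hφ.hasCompactSupport.of_isClosed_subset (isClosed_tsupport _) hs, hs.trans hφ.tsupport_subset⟩

/-- Testing the equation with `smoothSign δ φ * η`, for a test function `φ` close to the solution:
the convexity of `smoothAbs δ` gives the term with `|∇φ|²` a sign. -/
lemma IsWeakSolution.integral_smoothAbs_mul_laplacian_ge {N : ℕ}
    {Ω : Set (EuclideanSpace ℝ (Fin N))} {f u : EuclideanSpace ℝ (Fin N) → ℝ}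
    {G : EuclideanSpace ℝ (Fin N) → EuclideanSpace ℝ (Fin N)} (h : IsWeakSolution Ω f u G)
    (hf : MemLp f 2 (volume.restrict Ω))
    {φ η : EuclideanSpace ℝ (Fin N) → ℝ} (hφ : IsTestFunction Ω φ) (hη : ContDiff ℝ ∞ η)
    (hc : HasCompactSupport η) (h0 : ∀ x, 0 ≤ η x) {B : ℝ} (hB : ∀ x, η x ≤ B)
    {δ : ℝ} (hδ : 0 < δ) :
    -(∫ x in Ω, |f x| * η x) -
      (eLpNorm (fun x => G x - gradient φ x) 2 (volume.restrict Ω)).toReal *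
      (B * δ⁻¹ * (eLpNorm (gradient φ) 2 (volume.restrict Ω)).toReal +
        (eLpNorm (gradient η) 2 (volume.restrict Ω)).toReal) ≤
      ∫ x in Ω, smoothAbs δ (φ x) * Laplacian.laplacian η x := by
  set μ := volume.restrict Ω
  have hB0 : 0 ≤ B := (h0 0).trans (hB 0)
  have hζ := hφ.smoothSign_mul hη hδ
  set ζ := fun x => smoothSign δ (φ x) * η x with hζdef
  have dφ : Differentiable ℝ φ := hφ.contDiff.differentiable (by simp)
  have dη : Differentiable ℝ η := hη.differentiable (by simp)
  have dS : Differentiable ℝ (smoothSign δ) := (contDiff_smoothSign hδ).differentiable (by simp)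
  have hGφ := hφ.memLp_gradient 2 μ
  have hGη : MemLp (gradient η) 2 μ :=
    (continuous_gradient (hη.of_le (by exact_mod_cast le_top))).memLp_of_hasCompactSupport
      (hasCompactSupport_gradient hc)
  have hG := h.memW120.memW12.memLp_grad
  have gζ : ∀ x, gradient ζ x =
      (deriv (smoothSign δ) (φ x) * η x) • gradient φ x + smoothSign δ (φ x) • gradient η x := by
    intro x
    rw [hζdef, gradient_mul (a := fun x => smoothSign δ (φ x)) ((dS _).comp x (dφ x)) (dη x),
      gradient_comp (dS _).hasDerivAt (dφ x), smul_smul, mul_comm (η x)]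
  -- Green's formula, after extension of the integral to the whole space
  have e1 : ∫ x in Ω, smoothAbs δ (φ x) * Laplacian.laplacian η x =
      -∫ x in Ω, inner ℝ (smoothSign δ (φ x) • gradient φ x) (gradient η x) := by
    rw [setIntegral_eq_integral_of_forall_compl_eq_zero,
      setIntegral_eq_integral_of_forall_compl_eq_zero,
      integral_mul_laplacian (a := fun x => smoothAbs δ (φ x)) _ hη hc]
    · simp_rw [fun x => gradient_comp (hasDerivAt_smoothAbs hδ (φ x)) (dφ x)]
    · exact ((contDiff_smoothAbs hδ).comp hφ.contDiff).of_le (by exact_mod_cast le_top)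
    · intro x hx; simp [hφ.gradient_eq_zero hx]
    · intro x hx; simp [hφ.eq_zero hx, smoothAbs, Real.sqrt_sq hδ.le]
  have i1 := integrable_inner_of_memLp hG (hζ.memLp_gradient 2 μ)
  have i2 := integrable_inner_of_memLp hGφ (hζ.memLp_gradient 2 μ)
  have i3 : Integrable (fun x => inner ℝ (G x - gradient φ x) (gradient ζ x)) μ :=
    integrable_inner_of_memLp (hG.sub hGφ) (hζ.memLp_gradient 2 μ)
  have e2 : ∫ x in Ω, inner ℝ (smoothSign δ (φ x) • gradient φ x) (gradient η x) ≤
      ∫ x in Ω, inner ℝ (gradient φ x) (gradient ζ x) := by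
    have hm : MemLp (fun x => smoothSign δ (φ x) • gradient φ x) 2 μ :=
      hGφ.of_le (((contDiff_smoothSign hδ).continuous.comp
        hφ.contDiff.continuous).aestronglyMeasurable.smul hGφ.1) (ae_of_all _ fun x => by
        rw [norm_smul]
        exact mul_le_of_le_one_left (norm_nonneg _) (abs_smoothSign_le hδ _))
    refine integral_mono (integrable_inner_of_memLp hm hGη) i2 fun x => ?_
    simp only [gζ, inner_add_right, inner_smul_left, inner_smul_right, real_inner_self_eq_norm_sq]
    have := mul_nonneg (mul_nonneg (deriv_smoothSign_nonneg hδ (φ x)) (h0 x))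
      (sq_nonneg ‖gradient φ x‖)
    simpa using this
  have e3 : ∫ x in Ω, inner ℝ (gradient φ x) (gradient ζ x) = (∫ x in Ω, ζ x * f x) -
      ∫ x in Ω, inner ℝ (G x - gradient φ x) (gradient ζ x) := by
    rw [← h.weak_eq ζ _ hζ.memW120, ← integral_sub i1 i3]
    simp
  have e4 : ∫ x in Ω, ζ x * f x ≤ ∫ x in Ω, |f x| * η x := by
    have hη2 : MemLp η 2 μ := hη.continuous.memLp_of_hasCompactSupport hc
    refine integral_mono ((hζ.memLp 2 μ).integrable_mul hf) (hf.abs.integrable_mul hη2) fun x => ?_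
    have := mul_le_mul (abs_smoothSign_le hδ (φ x)) le_rfl (abs_nonneg (f x)) zero_le_one
    rw [← abs_mul, one_mul] at this
    calc smoothSign δ (φ x) * η x * f x = (smoothSign δ (φ x) * f x) * η x := by ring
      _ ≤ |f x| * η x := mul_le_mul_of_nonneg_right ((le_abs_self _).trans this) (h0 x)
  have e5 := abs_integral_inner_le (hG.sub hGφ) (hζ.memLp_gradient 2 μ)
  have e6 : (eLpNorm (gradient ζ) 2 μ).toReal ≤ B * δ⁻¹ * (eLpNorm (gradient φ) 2 μ).toReal +
      (eLpNorm (gradient η) 2 μ).toReal := by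
    have hm : MemLp (fun x => (B * δ⁻¹) • gradient φ x) 2 μ := hGφ.const_smul (B * δ⁻¹)
    have hle : eLpNorm (gradient ζ) 2 μ ≤
        eLpNorm (fun x => ‖(B * δ⁻¹) • gradient φ x‖ + ‖gradient η x‖) 2 μ := by
      refine eLpNorm_mono_real fun x => ?_
      rw [gζ]
      refine (norm_add_le _ _).trans (add_le_add ?_ ?_)
      · rw [norm_smul, norm_smul,
          Real.norm_of_nonneg (mul_nonneg (deriv_smoothSign_nonneg hδ _) (h0 x)),
          Real.norm_of_nonneg (by positivity : 0 ≤ B * δ⁻¹), mul_comm B]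
        exact mul_le_mul_of_nonneg_right (mul_le_mul (deriv_smoothSign_le hδ _) (hB x) (h0 x)
          (by positivity)) (norm_nonneg _)
      · rw [norm_smul]
        exact mul_le_of_le_one_left (norm_nonneg _) (abs_smoothSign_le hδ _)
    have hadd := hle.trans (eLpNorm_add_le hm.norm.1 hGη.norm.1 one_le_two)
    rw [eLpNorm_norm, eLpNorm_norm] at hadd
    have := ENNReal.toReal_mono (ENNReal.add_lt_top.2 ⟨hm.2, hGη.2⟩).ne hadd
    rw [ENNReal.toReal_add hm.2.ne hGη.2.ne] at this
    refine this.trans_eq ?_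
    congr 1
    have := eLpNorm_const_smul (B * δ⁻¹) (gradient φ) 2 μ
    rw [Pi.smul_def] at this
    rw [this, ENNReal.toReal_mul, toReal_enorm, Real.norm_of_nonneg (by positivity : 0 ≤ B * δ⁻¹)]
  rw [e1]
  have e7 := mul_le_mul_of_nonneg_left e6
    (ENNReal.toReal_nonneg (a := eLpNorm (fun x => G x - gradient φ x) 2 μ))
  have e8 := neg_abs_le (∫ x in Ω, inner ℝ (G x - gradient φ x) (gradient ζ x))
  have e9 : |∫ x in Ω, inner ℝ (G x - gradient φ x) (gradient ζ x)| ≤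
    (eLpNorm (fun x => G x - gradient φ x) 2 μ).toReal * (eLpNorm (gradient ζ) 2 μ).toReal := e5
  linarith

lemma abs_toReal_eLpNorm_sub_le {N : ℕ} {F : Type*} [NormedAddCommGroup F]
    {μ : Measure (EuclideanSpace ℝ (Fin N))} {a b : EuclideanSpace ℝ (Fin N) → F}
    (ha : MemLp a 2 μ) (hb : MemLp b 2 μ) :
    |(eLpNorm b 2 μ).toReal - (eLpNorm a 2 μ).toReal| ≤
      (eLpNorm (fun x => a x - b x) 2 μ).toReal := by
  have := abs_norm_sub_norm_le (hb.toLp b) (ha.toLp a)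
  rwa [norm_sub_rev, ← MemLp.toLp_sub, Lp.norm_toLp, Lp.norm_toLp, Lp.norm_toLp] at this

lemma MemW120.exists_approx {N : ℕ} {Ω : Set (EuclideanSpace ℝ (Fin N))}
    {u : EuclideanSpace ℝ (Fin N) → ℝ} {G : EuclideanSpace ℝ (Fin N) → EuclideanSpace ℝ (Fin N)}
    (h : MemW120 Ω u G) : ∃ φ : ℕ → EuclideanSpace ℝ (Fin N) → ℝ, (∀ k, IsTestFunction Ω (φ k)) ∧
    Tendsto (fun k => (eLpNorm (fun x => u x - φ k x) 2 (volume.restrict Ω)).toReal) atTop (𝓝 0) ∧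
    Tendsto (fun k => (eLpNorm (fun x => G x - gradient (φ k) x) 2 (volume.restrict Ω)).toReal)
      atTop (𝓝 0) ∧
    Tendsto (fun k => (eLpNorm (gradient (φ k)) 2 (volume.restrict Ω)).toReal)
      atTop (𝓝 (eLpNorm G 2 (volume.restrict Ω)).toReal) := by
  obtain ⟨φ, h1, h2, h3⟩ := h.approx
  have h3' := (ENNReal.tendsto_toReal ENNReal.zero_ne_top).comp h3
  refine ⟨φ, h1, (ENNReal.tendsto_toReal ENNReal.zero_ne_top).comp h2, h3', ?_⟩
  rw [tendsto_iff_norm_sub_tendsto_zero]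
  exact squeeze_zero (fun _ => norm_nonneg _)
    (fun k => abs_toReal_eLpNorm_sub_le h.memW12.memLp_grad ((h1 k).memLp_gradient 2 _)) h3'

/-- Kato's inequality `-Δ|u| ≤ |f|` for the extension of a weak solution by zero. It holds in the
whole space: `η` need not vanish on the boundary of `Ω`. -/
lemma IsWeakSolution.integral_abs_mul_laplacian_ge {N : ℕ}
    {Ω : Set (EuclideanSpace ℝ (Fin N))} {f u : EuclideanSpace ℝ (Fin N) → ℝ}
    {G : EuclideanSpace ℝ (Fin N) → EuclideanSpace ℝ (Fin N)} (h : IsWeakSolution Ω f u G)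
    (hf : MemLp f 2 (volume.restrict Ω)) {η : EuclideanSpace ℝ (Fin N) → ℝ}
    (hη : ContDiff ℝ ∞ η) (hc : HasCompactSupport η) (h0 : ∀ x, 0 ≤ η x) :
    -(∫ x in Ω, |f x| * η x) ≤ ∫ x in Ω, |u x| * Laplacian.laplacian η x := by
  set μ := volume.restrict Ω
  obtain ⟨φ, h1, h2, h3, h4⟩ := h.memW120.exists_approx
  obtain ⟨B, hB⟩ := hc.exists_bound_of_continuous hη.continuous
  have hB' : ∀ x, η x ≤ B := fun x => (le_abs_self _).trans (hB x)
  have hu := h.memW120.memW12.memLp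
  have hL : MemLp (Laplacian.laplacian η) 2 μ :=
    (contDiff_laplacian hη).continuous.memLp_of_hasCompactSupport (hasCompactSupport_laplacian hc)
  have hL1 : Integrable (fun x => |Laplacian.laplacian η x|) μ :=
    ((contDiff_laplacian hη).continuous.integrable_of_hasCompactSupport
      (hasCompactSupport_laplacian hc)).abs.restrict
  have hS (δ : ℝ) (hδ : 0 < δ) {a : EuclideanSpace ℝ (Fin N) → ℝ} (ha : MemLp a 2 μ) :
      MemLp (fun x => smoothAbs δ (a x)) 2 μ :=
    ha.of_le ((contDiff_smoothAbs hδ).continuous.comp_aestronglyMeasurable ha.1)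
      (ae_of_all _ fun x => by
        simpa [smoothAbs, Real.sqrt_sq hδ.le] using abs_smoothAbs_sub_le hδ (a x) 0)
  -- passage to the limit along the approximating test functions
  have key (δ : ℝ) (hδ : 0 < δ) : -(∫ x in Ω, |f x| * η x) ≤
      ∫ x in Ω, smoothAbs δ (u x) * Laplacian.laplacian η x := by
    have hlim : Tendsto (fun k => -(∫ x in Ω, |f x| * η x) -
        (eLpNorm (fun x => G x - gradient (φ k) x) 2 μ).toReal *
        (B * δ⁻¹ * (eLpNorm (gradient (φ k)) 2 μ).toReal + (eLpNorm (gradient η) 2 μ).toReal) -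
        (eLpNorm (fun x => u x - φ k x) 2 μ).toReal *
          (eLpNorm (Laplacian.laplacian η) 2 μ).toReal) atTop
        (𝓝 (-(∫ x in Ω, |f x| * η x) - 0 *
        (B * δ⁻¹ * (eLpNorm G 2 μ).toReal + (eLpNorm (gradient η) 2 μ).toReal) -
        0 * (eLpNorm (Laplacian.laplacian η) 2 μ).toReal)) :=
      (tendsto_const_nhds.sub (h3.mul ((h4.const_mul _).add_const _))).sub (h2.mul_const _)
    rw [zero_mul, zero_mul, sub_zero, sub_zero] at hlim
    refine le_of_tendsto hlim (Eventually.of_forall fun k => ?_)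
    have e1 := h.integral_smoothAbs_mul_laplacian_ge hf (h1 k) hη hc h0 hB' hδ
    have hφ := (h1 k).memLp 2 μ
    have e2 := abs_integral_mul_le ((hS δ hδ hu).sub (hS δ hδ hφ)) hL
    have e3 : (eLpNorm ((fun x => smoothAbs δ (u x)) - fun x => smoothAbs δ (φ k x)) 2 μ).toReal ≤
        (eLpNorm (fun x => u x - φ k x) 2 μ).toReal :=
      ENNReal.toReal_mono (hu.sub hφ).2.ne
        (eLpNorm_mono fun x => abs_smoothAbs_sub_le hδ (u x) (φ k x))
    have e4 := mul_le_mul_of_nonneg_right e3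
      (ENNReal.toReal_nonneg (a := eLpNorm (Laplacian.laplacian η) 2 μ))
    have e5 : ∫ x in Ω, ((fun x => smoothAbs δ (u x)) - fun x => smoothAbs δ (φ k x)) x *
        Laplacian.laplacian η x = (∫ x in Ω, smoothAbs δ (u x) * Laplacian.laplacian η x) -
        ∫ x in Ω, smoothAbs δ (φ k x) * Laplacian.laplacian η x := by
      rw [← integral_sub (integrable_mul_of_memLp (hS δ hδ hu) hL)
        (integrable_mul_of_memLp (hS δ hδ hφ) hL)]
      refine integral_congr_ae (ae_of_all _ fun x => ?_)
      simp only [Pi.sub_apply, sub_mul]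
    rw [e5] at e2
    have e6 := neg_le_of_abs_le e2
    linarith
  have iu : Integrable (fun x => |u x| * Laplacian.laplacian η x) μ :=
    integrable_mul_of_memLp hu.abs hL
  refine le_of_forall_pos_le_add fun ε hε => ?_
  set A := ∫ x in Ω, |Laplacian.laplacian η x|
  have hA : 0 ≤ A := integral_nonneg fun _ => abs_nonneg _
  have hδ : 0 < ε / (A + 1) := by positivity
  have e1 := key _ hδ
  have e2 : (∫ x in Ω, smoothAbs (ε / (A + 1)) (u x) * Laplacian.laplacian η x) -
      (∫ x in Ω, |u x| * Laplacian.laplacian η x) ≤ ε / (A + 1) * A := by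
    rw [← integral_sub (integrable_mul_of_memLp (hS _ hδ hu) hL) iu,
      ← integral_const_mul]
    refine integral_mono ((integrable_mul_of_memLp (hS _ hδ hu) hL).sub iu)
      (hL1.const_mul _) fun x => ?_
    simp only [← sub_mul]
    refine (le_abs_self _).trans ?_
    rw [abs_mul, abs_sub_comm]
    exact mul_le_mul_of_nonneg_right (abs_abs_sub_smoothAbs_le hδ _) (abs_nonneg _)
  have e3 : ε / (A + 1) * A ≤ ε := by
    rw [div_mul_eq_mul_div, div_le_iff₀ (by positivity)]
    nlinarith
  linarith

/-- A weak solution solves the equation in the sense of distributions. -/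
lemma IsWeakSolution.integral_mul_laplacian {N : ℕ}
    {Ω : Set (EuclideanSpace ℝ (Fin N))} {f u : EuclideanSpace ℝ (Fin N) → ℝ}
    {G : EuclideanSpace ℝ (Fin N) → EuclideanSpace ℝ (Fin N)} (h : IsWeakSolution Ω f u G)
    {η : EuclideanSpace ℝ (Fin N) → ℝ} (hη : IsTestFunction Ω η) :
    ∫ x in Ω, u x * Laplacian.laplacian η x = -∫ x in Ω, f x * η x := by
  set μ := volume.restrict Ω
  obtain ⟨φ, h1, h2, h3, h4⟩ := h.memW120.exists_approx
  have hu := h.memW120.memW12.memLp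
  have hG := h.memW120.memW12.memLp_grad
  have hη2 := hη.memLp_gradient 2 μ
  have hL : MemLp (Laplacian.laplacian η) 2 μ :=
    (contDiff_laplacian hη.contDiff).continuous.memLp_of_hasCompactSupport
      (hasCompactSupport_laplacian hη.hasCompactSupport)
  have e0 (k) : ∫ x in Ω, φ k x * Laplacian.laplacian η x =
      -∫ x in Ω, inner ℝ (gradient (φ k) x) (gradient η x) := by
    rw [setIntegral_eq_integral_of_forall_compl_eq_zero,
      setIntegral_eq_integral_of_forall_compl_eq_zero,
      _root_.integral_mul_laplacian ((h1 k).contDiff.of_le (by exact_mod_cast le_top)) hη.contDiff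
        hη.hasCompactSupport]
    · intro x hx; simp [(h1 k).gradient_eq_zero hx]
    · intro x hx; simp [(h1 k).eq_zero hx]
  have l1 : Tendsto (fun k => ∫ x in Ω, φ k x * Laplacian.laplacian η x) atTop
      (𝓝 (∫ x in Ω, u x * Laplacian.laplacian η x)) := by
    rw [tendsto_iff_norm_sub_tendsto_zero]
    refine squeeze_zero (fun _ => norm_nonneg _) (fun k => ?_)
      (by simpa using h2.mul_const (eLpNorm (Laplacian.laplacian η) 2 μ).toReal)
    rw [norm_sub_rev, ← integral_sub (integrable_mul_of_memLp hu hL)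
      (integrable_mul_of_memLp ((h1 k).memLp 2 μ) hL)]
    simp_rw [← sub_mul]
    exact abs_integral_mul_le (hu.sub ((h1 k).memLp 2 μ)) hL
  have l2 : Tendsto (fun k => ∫ x in Ω, inner ℝ (gradient (φ k) x) (gradient η x)) atTop
      (𝓝 (∫ x in Ω, inner ℝ (G x) (gradient η x))) := by
    rw [tendsto_iff_norm_sub_tendsto_zero]
    refine squeeze_zero (fun _ => norm_nonneg _) (fun k => ?_)
      (by simpa using h3.mul_const (eLpNorm (gradient η) 2 μ).toReal)
    rw [norm_sub_rev, ← integral_sub (integrable_inner_of_memLp hG hη2)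
      (integrable_inner_of_memLp ((h1 k).memLp_gradient 2 μ) hη2)]
    simp_rw [← inner_sub_left]
    exact abs_integral_inner_le (hG.sub ((h1 k).memLp_gradient 2 μ)) hη2
  simp_rw [e0] at l1
  rw [tendsto_nhds_unique l1 l2.neg, h.weak_eq _ _ hη.memW120]
  simp_rw [mul_comm (η _)]
  rfl

/-! ### A one-parameter family of averaging kernels -/

/-- A smooth nonincreasing function `χ` on the line, zero on `[1, ∞)`, such that
`x ↦ -2 χ'(‖x‖²)` has integral `1` on `ℝ^N`. -/
structure RadialProfile (N : ℕ) where
  /-- The underlying function. -/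
  χ : ℝ → ℝ
  contDiff : ContDiff ℝ ∞ χ
  antitone : Antitone χ
  eq_zero : ∀ s, 1 ≤ s → χ s = 0
  integral_eq_one : ∫ x : EuclideanSpace ℝ (Fin N), -2 * deriv χ (‖x‖ ^ 2) = 1

lemma hasCompactSupport_comp_norm_sq {N : ℕ} {g : ℝ → ℝ} (hg : ∀ s, 1 < s → g s = 0) :
    HasCompactSupport (fun x : EuclideanSpace ℝ (Fin N) => g (‖x‖ ^ 2)) := by
  refine HasCompactSupport.intro (isCompact_closedBall 0 1) fun x hx => hg _ ?_
  rw [mem_closedBall_zero_iff, not_le] at hx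
  nlinarith

lemma deriv_eq_zero_of_eq_zero {g : ℝ → ℝ} {a : ℝ} (h : ∀ s, a < s → g s = 0) {s : ℝ}
    (hs : a < s) : deriv g s = 0 := by
  have : g =ᶠ[𝓝 s] fun _ => (0 : ℝ) := by
    filter_upwards [lt_mem_nhds hs] with x hx using h x hx
  rw [this.deriv_eq]
  simp

/-- A profile is a multiple of `s ↦ exp (-1 / (1 - s))`, extended by zero to `s ≥ 1`. -/
lemma nonempty_radialProfile {N : ℕ} (hN : 0 < N) : Nonempty (RadialProfile N) := by
  set g : ℝ → ℝ := fun s => expNegInvGlue (1 - s) with hg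
  have hs : ContDiff ℝ ∞ g := expNegInvGlue.contDiff.comp (contDiff_const.sub contDiff_id)
  have ha : Antitone g := fun a b hab => expNegInvGlue.monotone (by linarith)
  have h0 : ∀ s, 1 ≤ s → g s = 0 := fun s h => expNegInvGlue.zero_of_nonpos (by linarith)
  have hd : Continuous (deriv g) := hs.continuous_deriv (by simp)
  set k : EuclideanSpace ℝ (Fin N) → ℝ := fun x => -2 * deriv g (‖x‖ ^ 2) with hk
  have kc : Continuous k := by fun_prop
  have ks : HasCompactSupport k := hasCompactSupport_comp_norm_sq (g := fun s => -2 * deriv g s)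
    fun s h => by rw [deriv_eq_zero_of_eq_zero (fun s hs => h0 s hs.le) h, mul_zero]
  have k0 : 0 ≤ k := fun x => by
    have := ha.deriv_nonpos (x := ‖x‖ ^ 2)
    simp only [hk, Pi.zero_apply]; linarith
  -- `g` is not constant on `[0, 1]`, so that its derivative is not identically zero there
  obtain ⟨s, ⟨hs0, hs1⟩, hs2⟩ := exists_deriv_eq_slope g zero_lt_one hs.continuous.continuousOn
    (hs.differentiable (by simp)).differentiableOn
  obtain ⟨x, hx⟩ : ∃ x : EuclideanSpace ℝ (Fin N), ‖x‖ = √s :=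
    ⟨EuclideanSpace.single ⟨0, hN⟩ √s, by simp⟩
  have kx : k x ≠ 0 := by
    have h1 : g 1 = 0 := h0 1 le_rfl
    have h2 : 0 < g 0 := by
      simp only [hg]
      exact expNegInvGlue.pos_of_pos (by norm_num)
    have h3 : k x = 2 * g 0 := by
      simp only [hk]
      rw [hx, Real.sq_sqrt hs0.le, hs2, h1]
      ring
    rw [h3]
    positivity
  have hc : 0 < ∫ x, k x :=
    Continuous.integral_pos_of_hasCompactSupport_nonneg_nonzero (f := k) (x := x) kc ks k0 kx
  clear_value k
  obtain ⟨c, hcd⟩ : ∃ c, c = ∫ x, k x := ⟨_, rfl⟩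
  rw [← hcd] at hc
  refine ⟨⟨fun s => c⁻¹ * g s, contDiff_const.mul hs, fun a b hab =>
    mul_le_mul_of_nonneg_left (ha hab) (by positivity), fun s h => by rw [h0 s h, mul_zero], ?_⟩⟩
  have : ∀ s, deriv (fun s => c⁻¹ * g s) s = c⁻¹ * deriv g s := fun s =>
    deriv_const_mul _ (hs.differentiable (by simp) s)
  simp_rw [this]
  have e : ∀ x : EuclideanSpace ℝ (Fin N), -2 * (c⁻¹ * deriv g (‖x‖ ^ 2)) = c⁻¹ * k x := fun x => by
    rw [hk]; ring
  simp_rw [e]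
  rw [integral_const_mul, ← hcd, inv_mul_cancel₀ hc.ne']

namespace RadialProfile

variable {N : ℕ} (P : RadialProfile N)

/-- The radial density `-2 χ'` of the averaging kernel, as a function of the squared norm. -/
noncomputable def κ (s : ℝ) : ℝ := -2 * deriv P.χ s

/-- The averaging kernel at scale `t`. -/
noncomputable def meanKernel (t : ℝ) (w : EuclideanSpace ℝ (Fin N)) : ℝ :=
  P.κ (‖w‖ ^ 2 / t ^ 2) / t ^ N

/-- The kernel whose Laplacian is the derivative of `meanKernel` in the scale `t`. -/
noncomputable def potential (t : ℝ) (w : EuclideanSpace ℝ (Fin N)) : ℝ :=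
  t / t ^ N * P.χ (‖w‖ ^ 2 / t ^ 2)

/-- The derivative of `meanKernel` in the scale. -/
noncomputable def meanKernelDeriv (t : ℝ) (w : EuclideanSpace ℝ (Fin N)) : ℝ :=
  -(N * P.κ (‖w‖ ^ 2 / t ^ 2) + 2 * (‖w‖ ^ 2 / t ^ 2) * deriv P.κ (‖w‖ ^ 2 / t ^ 2)) / t ^ (N + 1)

/-- The average of `u` around `z` at scale `t`. -/
noncomputable def mean (u : EuclideanSpace ℝ (Fin N) → ℝ) (t : ℝ) (z : EuclideanSpace ℝ (Fin N)) :
    ℝ := ∫ y, P.meanKernel t (y - z) * u y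

lemma contDiff_κ : ContDiff ℝ ∞ P.κ :=
  contDiff_const.mul (contDiff_infty_iff_deriv.1 P.contDiff).2

lemma χ_nonneg (s : ℝ) : 0 ≤ P.χ s := by
  rw [← P.eq_zero (max s 1) (le_max_right _ _)]
  exact P.antitone (le_max_left _ _)

lemma κ_nonneg (s : ℝ) : 0 ≤ P.κ s := by
  have := P.antitone.deriv_nonpos (x := s)
  rw [κ]; linarith

lemma κ_eq_zero {s : ℝ} (hs : 1 < s) : P.κ s = 0 := by
  rw [κ, deriv_eq_zero_of_eq_zero (fun s hs => P.eq_zero s hs.le) hs, mul_zero]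

lemma one_lt_div {t : ℝ} (ht : 0 < t) {w : EuclideanSpace ℝ (Fin N)} (hw : t < ‖w‖) :
    1 < ‖w‖ ^ 2 / t ^ 2 := by
  rw [one_lt_div₀ (by positivity)]
  exact pow_lt_pow_left₀ hw ht.le two_ne_zero

lemma meanKernel_eq_zero {t : ℝ} (ht : 0 < t) {w : EuclideanSpace ℝ (Fin N)} (hw : t < ‖w‖) :
    P.meanKernel t w = 0 := by
  rw [meanKernel, P.κ_eq_zero (one_lt_div ht hw), zero_div]

lemma potential_eq_zero {t : ℝ} (ht : 0 < t) {w : EuclideanSpace ℝ (Fin N)} (hw : t < ‖w‖) :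
    P.potential t w = 0 := by
  rw [potential, P.eq_zero _ (one_lt_div ht hw).le, mul_zero]

lemma meanKernel_nonneg {t : ℝ} (ht : 0 < t) (w : EuclideanSpace ℝ (Fin N)) :
    0 ≤ P.meanKernel t w :=
  div_nonneg (P.κ_nonneg _) (by positivity)

lemma potential_nonneg {t : ℝ} (ht : 0 < t) (w : EuclideanSpace ℝ (Fin N)) :
    0 ≤ P.potential t w :=
  mul_nonneg (by positivity) (P.χ_nonneg _)

lemma potential_anti {t : ℝ} (ht : 0 < t) {w w' : EuclideanSpace ℝ (Fin N)} (h : ‖w‖ ≤ ‖w'‖) :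
    P.potential t w' ≤ P.potential t w :=
  mul_le_mul_of_nonneg_left (P.antitone (by gcongr)) (by positivity)

lemma contDiff_potential (t : ℝ) : ContDiff ℝ ∞ (P.potential t) :=
  contDiff_const.mul (P.contDiff.comp ((contDiff_norm_sq ℝ).div_const _))

lemma contDiff_meanKernel (t : ℝ) : ContDiff ℝ ∞ (P.meanKernel t) :=
  (P.contDiff_κ.comp ((contDiff_norm_sq ℝ).div_const _)).div_const _

lemma tsupport_potential_sub_subset {t : ℝ} (ht : 0 < t) (z : EuclideanSpace ℝ (Fin N)) :
    tsupport (fun y => P.potential t (y - z)) ⊆ Metric.closedBall z t := by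
  refine closure_minimal (fun y hy => ?_) Metric.isClosed_closedBall
  rw [Metric.mem_closedBall, dist_eq_norm]
  by_contra h
  exact hy (P.potential_eq_zero ht (not_le.1 h))

lemma contDiff_potential_sub (t : ℝ) (z : EuclideanSpace ℝ (Fin N)) :
    ContDiff ℝ ∞ (fun y => P.potential t (y - z)) :=
  (P.contDiff_potential t).comp (contDiff_id.sub contDiff_const)

lemma hasCompactSupport_potential_sub {t : ℝ} (ht : 0 < t) (z : EuclideanSpace ℝ (Fin N)) :
    HasCompactSupport (fun y => P.potential t (y - z)) :=
  (isCompact_closedBall z t).of_isClosed_subset (isClosed_tsupport _)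
    (P.tsupport_potential_sub_subset ht z)

lemma hasDerivAt_meanKernel {t : ℝ} (ht : 0 < t) (w : EuclideanSpace ℝ (Fin N)) :
    HasDerivAt (fun t => P.meanKernel t w) (P.meanKernelDeriv t w) t := by
  have h1 : HasDerivAt (fun t : ℝ => ‖w‖ ^ 2 / t ^ 2) (-2 * ‖w‖ ^ 2 / t ^ 3) t := by
    refine ((hasDerivAt_const t (‖w‖ ^ 2)).div (hasDerivAt_pow 2 t)
      (by positivity)).congr_deriv ?_
    field_simp
    simp
    ring
  have h2 := ((P.contDiff_κ.differentiable (by simp) (‖w‖ ^ 2 / t ^ 2)).hasDerivAt.comp t h1).div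
    (hasDerivAt_pow N t) (by positivity)
  refine h2.congr_deriv ?_
  rw [meanKernelDeriv]
  rcases N with _ | n
  · simp; field_simp
  · simp only [Function.comp, Nat.add_sub_cancel]
    field_simp
    ring

lemma hasFDerivAt_norm_sq_div (t : ℝ) (z y : EuclideanSpace ℝ (Fin N)) :
    HasFDerivAt (fun y => ‖y - z‖ ^ 2 / t ^ 2) ((2 / t ^ 2) • innerSL ℝ (y - z)) y := by
  have h := (((hasFDerivAt_id y).sub_const z).norm_sq).mul_const (1 / t ^ 2)
  simp only [id, ← div_eq_mul_one_div] at h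
  refine h.congr_fderiv ?_
  ext v
  simp
  ring

lemma laplacian_potential_sub {t : ℝ} (ht : 0 < t) (z y : EuclideanSpace ℝ (Fin N)) :
    Laplacian.laplacian (fun y => P.potential t (y - z)) y = P.meanKernelDeriv t (y - z) := by
  rw [laplacian_eq_sum_fderiv (P.contDiff_potential_sub t z)]
  set b := EuclideanSpace.basisFun (Fin N) ℝ
  have h1 (y v) : fderiv ℝ (fun y => P.potential t (y - z)) y v =
      -(1 / t) * (P.meanKernel t (y - z) * inner ℝ (y - z) v) := by
    have := ((P.contDiff.differentiable (by simp) (‖y - z‖ ^ 2 / t ^ 2)).hasDerivAt.comp_hasFDerivAt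
      y (hasFDerivAt_norm_sq_div t z y)).const_mul (t / t ^ N)
    rw [show fderiv ℝ (fun y => P.potential t (y - z)) y = _ from this.fderiv, meanKernel, κ]
    simp only [_root_.smul_apply, innerSL_apply_apply, smul_eq_mul]
    field_simp
  have h2 (y v) : fderiv ℝ (fun y => -(1 / t) * (P.meanKernel t (y - z) * inner ℝ (y - z) v)) y v =
      -(1 / t) * (deriv P.κ (‖y - z‖ ^ 2 / t ^ 2) * (2 / t ^ 2) / t ^ N *
        (inner ℝ (y - z) v * inner ℝ (y - z) v) + P.meanKernel t (y - z) * inner ℝ v v) := by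
    have hK := ((P.contDiff_κ.differentiable (by simp)
      (‖y - z‖ ^ 2 / t ^ 2)).hasDerivAt.comp_hasFDerivAt y
      (hasFDerivAt_norm_sq_div t z y)).mul_const (1 / t ^ N)
    have hi : HasFDerivAt (fun y => inner ℝ (y - z) v) (innerSL ℝ v) y := by
      have := (innerSL ℝ v).hasFDerivAt.comp y ((hasFDerivAt_id y).sub_const z)
      exact this.congr_of_eventuallyEq (.of_forall fun y => real_inner_comm _ _)
    have := (hK.mul hi).const_mul (-(1 / t))
    simp only [Function.comp_def, ← div_eq_mul_one_div] at this
    rw [show fderiv ℝ (fun y => -(1 / t) * (P.meanKernel t (y - z) * inner ℝ (y - z) v)) y = _ from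
      this.fderiv, meanKernel]
    simp only [_root_.smul_apply, _root_.add_apply, innerSL_apply_apply,
      smul_eq_mul]
    ring
  simp_rw [h1, h2]
  rw [← Finset.mul_sum, Finset.sum_add_distrib, ← Finset.mul_sum, ← Finset.mul_sum]
  have s1 : ∑ i, inner ℝ (y - z) (b i) * inner ℝ (y - z) (b i) = ‖y - z‖ ^ 2 := by
    rw [← real_inner_self_eq_norm_sq, ← b.sum_inner_mul_inner]
    simp_rw [real_inner_comm]
  have s2 : ∑ i, inner ℝ (b i) (b i) = (N : ℝ) := by simp
  rw [s1, s2, meanKernelDeriv, meanKernel, pow_succ]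
  field_simp
  ring

end RadialProfile

namespace RadialProfile

variable {N : ℕ} (P : RadialProfile N)

/-! ### Size and regularity of the averages -/

lemma norm_inv_smul_sq {t : ℝ} (w : EuclideanSpace ℝ (Fin N)) :
    ‖t⁻¹ • w‖ ^ 2 = ‖w‖ ^ 2 / t ^ 2 := by
  rw [norm_smul, mul_pow, Real.norm_eq_abs, sq_abs, inv_pow, div_eq_inv_mul]

/-- All kernels are rescalings of fixed smooth functions with compact support, so that a single
constant serves at all scales. -/
lemma exists_bound : ∃ C : ℝ, 0 < C ∧ ∀ t : ℝ, 0 < t → ∀ w w' : EuclideanSpace ℝ (Fin N),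
    P.meanKernel t w ≤ C / t ^ N ∧ P.potential t w ≤ C * t / t ^ N ∧
    |P.meanKernelDeriv t w| ≤ C / t ^ (N + 1) ∧
    |P.meanKernel t w - P.meanKernel t w'| ≤ C * ‖w - w'‖ / t ^ (N + 1) ∧
    |P.potential t w - P.potential t w'| ≤ C * ‖w - w'‖ / t ^ N := by
  set k : EuclideanSpace ℝ (Fin N) → ℝ := fun x => P.κ (‖x‖ ^ 2) with hk
  set j : EuclideanSpace ℝ (Fin N) → ℝ := fun x => P.χ (‖x‖ ^ 2) with hj
  set l : EuclideanSpace ℝ (Fin N) → ℝ :=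
    fun x => -(N * P.κ (‖x‖ ^ 2) + 2 * ‖x‖ ^ 2 * deriv P.κ (‖x‖ ^ 2)) with hl
  have kc : ContDiff ℝ ∞ k := P.contDiff_κ.comp (contDiff_norm_sq ℝ)
  have jc : ContDiff ℝ ∞ j := P.contDiff.comp (contDiff_norm_sq ℝ)
  have lc : Continuous l := by
    have h1 := P.contDiff_κ.continuous
    have h2 : Continuous (deriv P.κ) := P.contDiff_κ.continuous_deriv (by simp)
    fun_prop
  have ks : HasCompactSupport k := hasCompactSupport_comp_norm_sq fun s h => P.κ_eq_zero h
  have js : HasCompactSupport j := hasCompactSupport_comp_norm_sq fun s h => P.eq_zero s h.le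
  have ls : HasCompactSupport l := hasCompactSupport_comp_norm_sq
    (g := fun s => -(N * P.κ s + 2 * s * deriv P.κ s)) fun s h => by
      rw [P.κ_eq_zero h, deriv_eq_zero_of_eq_zero (fun _ => P.κ_eq_zero) h]; simp
  obtain ⟨c1, h1⟩ := ks.exists_bound_of_continuous kc.continuous
  obtain ⟨c2, h2⟩ := js.exists_bound_of_continuous jc.continuous
  obtain ⟨c3, h3⟩ := ls.exists_bound_of_continuous lc
  obtain ⟨c4, h4⟩ := kc.lipschitzWith_of_hasCompactSupport ks (by simp)
  obtain ⟨c5, h5⟩ := jc.lipschitzWith_of_hasCompactSupport js (by simp)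
  have p1 : 0 ≤ c1 := (norm_nonneg _).trans (h1 0)
  have p2 : 0 ≤ c2 := (norm_nonneg _).trans (h2 0)
  have p3 : 0 ≤ c3 := (norm_nonneg _).trans (h3 0)
  have p4 : (0 : ℝ) ≤ c4 := c4.2
  have p5 : (0 : ℝ) ≤ c5 := c5.2
  refine ⟨c1 + c2 + c3 + c4 + c5 + 1, by positivity, fun t ht w w' => ?_⟩
  set C := c1 + c2 + c3 + c4 + c5 + 1
  have ek (w) : P.meanKernel t w = k (t⁻¹ • w) / t ^ N := by
    rw [hk, meanKernel]; simp only [norm_inv_smul_sq]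
  have ej (w) : P.potential t w = t / t ^ N * j (t⁻¹ • w) := by
    rw [hj, potential]; simp only [norm_inv_smul_sq]
  have el (w) : P.meanKernelDeriv t w = l (t⁻¹ • w) / t ^ (N + 1) := by
    rw [hl, meanKernelDeriv]; simp only [norm_inv_smul_sq]
  have hd : ‖t⁻¹ • w - t⁻¹ • w'‖ = ‖w - w'‖ / t := by
    rw [← smul_sub, norm_smul, Real.norm_of_nonneg (by positivity), div_eq_inv_mul]
  refine ⟨?_, ?_, ?_, ?_, ?_⟩
  · rw [ek]
    have := (le_abs_self _).trans (h1 (t⁻¹ • w))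
    gcongr
    linarith
  · rw [ej, mul_comm, ← mul_div_assoc]
    have := (le_abs_self _).trans (h2 (t⁻¹ • w))
    gcongr
    linarith
  · rw [el, abs_div, abs_of_pos (by positivity : 0 < t ^ (N + 1))]
    have := h3 (t⁻¹ • w)
    rw [Real.norm_eq_abs] at this
    gcongr
    linarith
  · rw [ek, ek, ← sub_div, abs_div, abs_of_pos (by positivity : 0 < t ^ N), pow_succ', ← div_div]
    have := h4.norm_sub_le (t⁻¹ • w) (t⁻¹ • w')
    rw [hd, Real.norm_eq_abs] at this
    gcongr
    refine this.trans ?_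
    rw [← mul_div_assoc]
    gcongr
    linarith
  · rw [ej, ej, ← mul_sub, abs_mul, abs_of_pos (by positivity : 0 < t / t ^ N)]
    have := h5.norm_sub_le (t⁻¹ • w) (t⁻¹ • w')
    rw [hd, Real.norm_eq_abs] at this
    calc t / t ^ N * |j (t⁻¹ • w) - j (t⁻¹ • w')| ≤ t / t ^ N * (c5 * (‖w - w'‖ / t)) := by gcongr
      _ = c5 * ‖w - w'‖ / t ^ N := by field_simp
      _ ≤ _ := by gcongr; linarith

/-- A constant that controls the size and the Lipschitz constants of the kernels. -/
noncomputable def bound : ℝ := P.exists_bound.choose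

lemma bound_pos : 0 < P.bound := P.exists_bound.choose_spec.1

lemma meanKernel_le {t : ℝ} (ht : 0 < t) (w : EuclideanSpace ℝ (Fin N)) :
    P.meanKernel t w ≤ P.bound / t ^ N :=
  (P.exists_bound.choose_spec.2 t ht w w).1

lemma potential_le {t : ℝ} (ht : 0 < t) (w : EuclideanSpace ℝ (Fin N)) :
    P.potential t w ≤ P.bound * t / t ^ N :=
  (P.exists_bound.choose_spec.2 t ht w w).2.1

lemma abs_meanKernelDeriv_le {t : ℝ} (ht : 0 < t) (w : EuclideanSpace ℝ (Fin N)) :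
    |P.meanKernelDeriv t w| ≤ P.bound / t ^ (N + 1) :=
  (P.exists_bound.choose_spec.2 t ht w w).2.2.1

lemma abs_meanKernel_sub_le {t : ℝ} (ht : 0 < t) (w w' : EuclideanSpace ℝ (Fin N)) :
    |P.meanKernel t w - P.meanKernel t w'| ≤ P.bound * ‖w - w'‖ / t ^ (N + 1) :=
  (P.exists_bound.choose_spec.2 t ht w w').2.2.2.1

lemma abs_potential_sub_le {t : ℝ} (ht : 0 < t) (w w' : EuclideanSpace ℝ (Fin N)) :
    |P.potential t w - P.potential t w'| ≤ P.bound * ‖w - w'‖ / t ^ N :=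
  (P.exists_bound.choose_spec.2 t ht w w').2.2.2.2

lemma continuous_meanKernel_sub (t : ℝ) (z : EuclideanSpace ℝ (Fin N)) :
    Continuous (fun y => P.meanKernel t (y - z)) :=
  (P.contDiff_meanKernel t).continuous.comp (continuous_id.sub continuous_const)

lemma continuous_potential_sub (t : ℝ) (z : EuclideanSpace ℝ (Fin N)) :
    Continuous (fun y => P.potential t (y - z)) :=
  (P.contDiff_potential_sub t z).continuous

lemma continuous_meanKernelDeriv_sub {t : ℝ} (ht : 0 < t) (z : EuclideanSpace ℝ (Fin N)) :
    Continuous (fun y => P.meanKernelDeriv t (y - z)) := by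
  have := (contDiff_laplacian (P.contDiff_potential_sub t z)).continuous
  rwa [show Laplacian.laplacian (fun y => P.potential t (y - z)) = _ from
    funext (P.laplacian_potential_sub ht z)] at this

lemma integral_meanKernel_sub {t : ℝ} (ht : 0 < t) (z : EuclideanSpace ℝ (Fin N)) :
    ∫ y, P.meanKernel t (y - z) = 1 := by
  rw [integral_sub_right_eq_self (P.meanKernel t) z]
  have : ∀ w : EuclideanSpace ℝ (Fin N), P.meanKernel t w =
      (fun x => -2 * deriv P.χ (‖x‖ ^ 2)) (t⁻¹ • w) / t ^ N := fun w => by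
    simp only [norm_inv_smul_sq]; rfl
  simp_rw [this]
  rw [integral_div, Measure.integral_comp_inv_smul volume
    (fun x : EuclideanSpace ℝ (Fin N) => -2 * deriv P.χ (‖x‖ ^ 2)), P.integral_eq_one,
    finrank_euclideanSpace_fin,
    abs_of_pos (by positivity), smul_eq_mul, mul_one, div_self (by positivity)]

variable {u : EuclideanSpace ℝ (Fin N) → ℝ}

lemma integrable_meanKernel_mul {t : ℝ} (ht : 0 < t) (z : EuclideanSpace ℝ (Fin N))
    (hu : Integrable u) : Integrable (fun y => P.meanKernel t (y - z) * u y) :=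
  hu.bdd_mul (P.continuous_meanKernel_sub t z).aestronglyMeasurable
    (c := P.bound / t ^ N) (ae_of_all _ fun y => by
      rw [Real.norm_of_nonneg (P.meanKernel_nonneg ht _)]; exact P.meanKernel_le ht _)

lemma integrable_potential_mul {t : ℝ} (ht : 0 < t) (z : EuclideanSpace ℝ (Fin N))
    (hu : Integrable u) : Integrable (fun y => P.potential t (y - z) * u y) :=
  hu.bdd_mul (P.continuous_potential_sub t z).aestronglyMeasurable
    (c := P.bound * t / t ^ N) (ae_of_all _ fun y => by
      rw [Real.norm_of_nonneg (P.potential_nonneg ht _)]; exact P.potential_le ht _)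

lemma hasDerivAt_mean {t : ℝ} (ht : 0 < t) (z : EuclideanSpace ℝ (Fin N)) (hu : Integrable u) :
    HasDerivAt (fun t => P.mean u t z) (∫ y, P.meanKernelDeriv t (y - z) * u y) t := by
  refine (hasDerivAt_integral_of_dominated_loc_of_deriv_le (s := Set.Ioi (t / 2))
    (bound := fun y => P.bound / (t / 2) ^ (N + 1) * |u y|)
    (F' := fun t y => P.meanKernelDeriv t (y - z) * u y) (Ioi_mem_nhds (by linarith)) ?_
    (P.integrable_meanKernel_mul ht z hu) ?_ ?_ (hu.abs.const_mul _) ?_).2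
  · exact .of_forall fun s => (P.continuous_meanKernel_sub s z).aestronglyMeasurable.mul hu.1
  · exact (P.continuous_meanKernelDeriv_sub ht z).aestronglyMeasurable.mul hu.1
  · refine ae_of_all _ fun y s hs => ?_
    have hs' : t / 2 < s := hs
    have hs0 : 0 < s := by linarith
    rw [norm_mul, Real.norm_eq_abs, Real.norm_eq_abs]
    refine mul_le_mul_of_nonneg_right ((P.abs_meanKernelDeriv_le hs0 _).trans ?_) (abs_nonneg _)
    have := P.bound_pos
    gcongr
  · refine ae_of_all _ fun y s hs => ?_
    have hs' : t / 2 < s := hs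
    exact (P.hasDerivAt_meanKernel (by linarith) _).mul_const _

lemma abs_mean_le {t : ℝ} (ht : 0 < t) (z : EuclideanSpace ℝ (Fin N)) :
    |P.mean u t z| ≤ P.mean (fun y => |u y|) t z := by
  refine (abs_integral_le_integral_abs).trans_eq (integral_congr_ae (ae_of_all _ fun y => ?_))
  simp only [abs_mul, abs_of_nonneg (P.meanKernel_nonneg ht (y - z))]

lemma mean_eq_zero {t : ℝ} (ht : 0 < t) {z : EuclideanSpace ℝ (Fin N)}
    (h : ∀ y ∈ Metric.closedBall z t, u y = 0) : P.mean u t z = 0 := by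
  refine integral_eq_zero_of_ae (ae_of_all _ fun y => ?_)
  by_cases hy : y ∈ Metric.closedBall z t
  · simp [h y hy]
  · rw [Metric.mem_closedBall, dist_eq_norm, not_le] at hy
    simp [P.meanKernel_eq_zero ht hy]

lemma mean_le {t : ℝ} (ht : 0 < t) (z : EuclideanSpace ℝ (Fin N)) (hu : Integrable u)
    (h0 : ∀ y, 0 ≤ u y) : P.mean u t z ≤ P.bound / t ^ N * ∫ y in Metric.closedBall z t, u y := by
  rw [← integral_const_mul, ← integral_indicator Metric.isClosed_closedBall.measurableSet]
  refine integral_mono (P.integrable_meanKernel_mul ht z hu)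
    ((hu.const_mul _).indicator Metric.isClosed_closedBall.measurableSet)
    fun y => ?_
  by_cases hy : y ∈ Metric.closedBall z t
  · rw [Set.indicator_of_mem hy]
    exact mul_le_mul_of_nonneg_right (P.meanKernel_le ht _) (h0 y)
  · rw [Set.indicator_of_notMem hy]
    rw [Metric.mem_closedBall, dist_eq_norm, not_le] at hy
    simp [P.meanKernel_eq_zero ht hy]

lemma integral_potential_mul_le {t : ℝ} (ht : 0 < t) (z : EuclideanSpace ℝ (Fin N))
    (hu : Integrable u) (h0 : ∀ y, 0 ≤ u y) : ∫ y, P.potential t (y - z) * u y ≤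
      P.bound * t / t ^ N * ∫ y in Metric.closedBall z t, u y := by
  rw [← integral_const_mul, ← integral_indicator Metric.isClosed_closedBall.measurableSet]
  refine integral_mono (P.integrable_potential_mul ht z hu)
    ((hu.const_mul _).indicator Metric.isClosed_closedBall.measurableSet)
    fun y => ?_
  by_cases hy : y ∈ Metric.closedBall z t
  · rw [Set.indicator_of_mem hy]
    exact mul_le_mul_of_nonneg_right (P.potential_le ht _) (h0 y)
  · rw [Set.indicator_of_notMem hy]
    rw [Metric.mem_closedBall, dist_eq_norm, not_le] at hy
    simp [P.potential_eq_zero ht hy]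

lemma abs_mean_sub_mean_le {t : ℝ} (ht : 0 < t) (z z' : EuclideanSpace ℝ (Fin N))
    (hu : Integrable u) {S : Set (EuclideanSpace ℝ (Fin N))} (hS : MeasurableSet S)
    (h : Metric.closedBall z t ⊆ S) (h' : Metric.closedBall z' t ⊆ S) :
    |P.mean u t z - P.mean u t z'| ≤ P.bound * ‖z - z'‖ / t ^ (N + 1) * ∫ y in S, |u y| := by
  rw [mean, mean, ← integral_sub (P.integrable_meanKernel_mul ht z hu)
    (P.integrable_meanKernel_mul ht z' hu), ← integral_const_mul, ← integral_indicator hS]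
  refine abs_integral_le_integral_abs.trans (integral_mono ((P.integrable_meanKernel_mul ht z
    hu).sub (P.integrable_meanKernel_mul ht z' hu)).abs
    ((hu.abs.const_mul _).indicator hS) fun y => ?_)
  simp only [← sub_mul, abs_mul]
  by_cases hy : y ∈ S
  · rw [Set.indicator_of_mem hy]
    refine mul_le_mul_of_nonneg_right ((P.abs_meanKernel_sub_le ht _ _).trans_eq ?_) (abs_nonneg _)
    rw [sub_sub_sub_cancel_left, norm_sub_rev]
  · rw [Set.indicator_of_notMem hy]
    have hy1 : y ∉ Metric.closedBall z t := fun hh => hy (h hh)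
    have hy2 : y ∉ Metric.closedBall z' t := fun hh => hy (h' hh)
    rw [Metric.mem_closedBall, dist_eq_norm, not_le] at hy1 hy2
    simp [P.meanKernel_eq_zero ht hy1, P.meanKernel_eq_zero ht hy2]

lemma abs_integral_potential_sub_mul_le {t : ℝ} (ht : 0 < t) (z z' : EuclideanSpace ℝ (Fin N))
    (hu : Integrable u) :
    |∫ y, (P.potential t (y - z) - P.potential t (y - z')) * u y| ≤
      P.bound * ‖z - z'‖ / t ^ N * ((∫ y in Metric.closedBall z t, |u y|) +
        ∫ y in Metric.closedBall z' t, |u y|) := by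
  have hm (z : EuclideanSpace ℝ (Fin N)) : MeasurableSet (Metric.closedBall z t) :=
    Metric.isClosed_closedBall.measurableSet
  rw [← integral_indicator (hm z), ← integral_indicator (hm z'), ← integral_add
    (hu.abs.indicator (hm z)) (hu.abs.indicator (hm z')), ← integral_const_mul]
  have i1 : Integrable (fun y => (P.potential t (y - z) - P.potential t (y - z')) * u y) := by
    simp_rw [sub_mul]
    exact (P.integrable_potential_mul ht z hu).sub (P.integrable_potential_mul ht z' hu)
  refine abs_integral_le_integral_abs.trans (integral_mono i1.abs
    (((hu.abs.indicator (hm z)).add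
    (hu.abs.indicator (hm z'))).const_mul _) fun y => ?_)
  simp only [abs_mul]
  have h0 : 0 ≤ P.bound * ‖z - z'‖ / t ^ N := by have := P.bound_pos; positivity
  have hp (z : EuclideanSpace ℝ (Fin N)) :
      0 ≤ (Metric.closedBall z t).indicator (fun y => |u y|) y :=
    Set.indicator_nonneg (fun _ _ => abs_nonneg _) _
  by_cases hy : y ∈ Metric.closedBall z t ∪ Metric.closedBall z' t
  · have h1 : |u y| ≤ (Metric.closedBall z t).indicator (fun y => |u y|) y +
        (Metric.closedBall z' t).indicator (fun y => |u y|) y := by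
      rcases hy with hy | hy
      · rw [Set.indicator_of_mem hy]; linarith [hp z']
      · rw [Set.indicator_of_mem hy]; linarith [hp z]
    refine mul_le_mul ((P.abs_potential_sub_le ht _ _).trans_eq ?_) h1 (abs_nonneg _) h0
    rw [sub_sub_sub_cancel_left, norm_sub_rev]
  · rw [Set.mem_union, not_or, Metric.mem_closedBall, Metric.mem_closedBall, dist_eq_norm,
      dist_eq_norm, not_le, not_le] at hy
    rw [P.potential_eq_zero ht hy.1, P.potential_eq_zero ht hy.2]
    simp only [sub_self, abs_zero, zero_mul]
    exact mul_nonneg h0 (add_nonneg (hp z) (hp z'))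

/-- Lebesgue's differentiation theorem for the averages. -/
lemma ae_tendsto_mean (hu : Integrable u) :
    ∀ᵐ z, Tendsto (fun t => P.mean u t z) (𝓝[>] 0) (𝓝 (u z)) := by
  filter_upwards [IsUnifLocDoublingMeasure.ae_tendsto_average_norm_sub volume
    hu.locallyIntegrable 1] with z hz
  have h := hz (fun _ : ℝ => z) (fun t : ℝ => t) tendsto_id (l := 𝓝[>] 0) (by
    filter_upwards [self_mem_nhdsWithin] with t ht
    exact Metric.mem_closedBall_self (by simpa using (le_of_lt ht)))
  rw [tendsto_iff_norm_sub_tendsto_zero]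
  set b₁ := volume.real (Metric.ball (0 : EuclideanSpace ℝ (Fin N)) 1)
  refine squeeze_zero' (.of_forall fun _ => norm_nonneg _) ?_
    (by simpa using h.const_mul (P.bound * b₁))
  filter_upwards [self_mem_nhdsWithin] with t (ht : 0 < t)
  have hm : MeasurableSet (Metric.closedBall z t) := Metric.isClosed_closedBall.measurableSet
  have hfin : volume (Metric.closedBall z t) ≠ ⊤ := measure_closedBall_lt_top.ne
  have hk : Integrable (fun y => P.meanKernel t (y - z) * u z) := by
    refine Integrable.mul_const ((P.continuous_meanKernel_sub t z).integrable_of_hasCompactSupport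
      (HasCompactSupport.intro (isCompact_closedBall z t) fun y hy => ?_)) _
    rw [Metric.mem_closedBall, dist_eq_norm, not_le] at hy
    exact P.meanKernel_eq_zero ht hy
  have i1 := P.integrable_meanKernel_mul ht z hu
  have i2 : IntegrableOn (fun y => ‖u y - u z‖) (Metric.closedBall z t) :=
    (hu.integrableOn.sub (integrableOn_const hfin)).norm
  have e : P.mean u t z - u z = ∫ y, P.meanKernel t (y - z) * (u y - u z) := by
    simp_rw [mul_sub]
    rw [integral_sub i1 hk, integral_mul_const, P.integral_meanKernel_sub ht, one_mul, mean]
  rw [e, setAverage_eq, Measure.addHaar_real_closedBall _ _ ht.le, finrank_euclideanSpace_fin,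
    smul_eq_mul]
  have hb : 0 < b₁ := ENNReal.toReal_pos (Metric.measure_ball_pos _ _ one_pos).ne'
    measure_ball_lt_top.ne
  have e2 (I : ℝ) : P.bound * b₁ * ((t ^ N * b₁)⁻¹ * I) = P.bound / t ^ N * I := by field_simp
  rw [e2, ← integral_const_mul, ← integral_indicator hm]
  refine (norm_integral_le_integral_norm _).trans (integral_mono ?_ ?_ fun y => ?_)
  · have := (i1.sub hk).norm
    simpa [mul_sub] using this
  · exact IntegrableOn.integrable_indicator (i2.const_mul _) hm
  by_cases hy : y ∈ Metric.closedBall z t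
  · rw [Set.indicator_of_mem hy]
    simp only [norm_mul, Real.norm_of_nonneg (P.meanKernel_nonneg ht (y - z))]
    exact mul_le_mul_of_nonneg_right (P.meanKernel_le ht _) (norm_nonneg _)
  · rw [Set.indicator_of_notMem hy]
    rw [Metric.mem_closedBall, dist_eq_norm, not_le] at hy
    simp [P.meanKernel_eq_zero ht hy]

end RadialProfile

/-- Hölder's inequality on balls. -/
lemma setIntegral_closedBall_abs_le {N : ℕ} {F : EuclideanSpace ℝ (Fin N) → ℝ} {q : ℝ}
    (hq : 1 ≤ q) (hF : MemLp F (ENNReal.ofReal q) volume) (z : EuclideanSpace ℝ (Fin N)) {t : ℝ}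
    (ht : 0 < t) : ∫ y in Metric.closedBall z t, |F y| ≤
      volume.real (Metric.ball (0 : EuclideanSpace ℝ (Fin N)) 1) ^ (1 - 1 / q) *
        t ^ (N * (1 - 1 / q) : ℝ) * (eLpNorm F (ENNReal.ofReal q) volume).toReal := by
  have hq0 : 0 < q := by linarith
  set S := Metric.closedBall z t
  have hfin : volume S ≠ ⊤ := measure_closedBall_lt_top.ne
  have h1 := eLpNorm_le_eLpNorm_mul_rpow_measure_univ (μ := volume.restrict S) (f := F)
    (p := 1) (q := ENNReal.ofReal q) (by simpa using hq) hF.1.restrict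
  rw [Measure.restrict_apply_univ, ENNReal.toReal_one, ENNReal.toReal_ofReal hq0.le, div_one] at h1
  have hle : 0 ≤ 1 - 1 / q := by rw [sub_nonneg, div_le_one hq0]; exact hq
  have h2 : eLpNorm F 1 (volume.restrict S) ≤
      eLpNorm F (ENNReal.ofReal q) volume * volume S ^ (1 - 1 / q) :=
    h1.trans (mul_le_mul_left (eLpNorm_mono_measure _ Measure.restrict_le_self) _)
  have h3 := ENNReal.toReal_mono (ENNReal.mul_ne_top hF.2.ne
    (ENNReal.rpow_ne_top_of_nonneg hle hfin)) h2
  rw [ENNReal.toReal_mul, ← ENNReal.toReal_rpow, ← Measure.real,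
    Measure.addHaar_real_closedBall _ _ ht.le, finrank_euclideanSpace_fin,
    Real.mul_rpow (by positivity) (by positivity), ← Real.rpow_natCast t N,
    ← Real.rpow_mul ht.le] at h3
  have e : ∫ y in S, |F y| = (eLpNorm F 1 (volume.restrict S)).toReal := by
    rw [eLpNorm_one_eq_lintegral_enorm, ← integral_norm_eq_lintegral_enorm hF.1.restrict]
    simp
  rw [e]
  refine h3.trans_eq ?_
  ring

/-! ### Monotonicity of the averages in the scale -/

/-- A one-sided bound of the derivative by a power, integrated from `s` to `r`; if `B ≥ 0`,
the last summand is nonnegative for `p < 0` too. -/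
lemma le_add_of_neg_rpow_le_deriv {φ φ' : ℝ → ℝ} {s r B p : ℝ} (hs : 0 < s) (hsr : s ≤ r)
    (hp : p ≠ 0) (hd : ∀ t ∈ Set.Icc s r, HasDerivAt φ (φ' t) t)
    (hb : ∀ t ∈ Set.Icc s r, -(B * t ^ (p - 1)) ≤ φ' t) :
    φ s ≤ φ r + B * (r ^ p - s ^ p) / p := by
  have hd' : ∀ t ∈ Set.Icc s r, HasDerivAt (fun t => φ t + B * t ^ p / p)
      (φ' t + B * t ^ (p - 1)) t := fun t ht => by
    have h0 : t ≠ 0 := (hs.trans_le ht.1).ne'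
    refine ((hd t ht).add (((Real.hasDerivAt_rpow_const (Or.inl h0)).const_mul B).div_const
      p)).congr_deriv ?_
    field_simp
  have hm : MonotoneOn (fun t => φ t + B * t ^ p / p) (Set.Icc s r) := by
    refine monotoneOn_of_deriv_nonneg (convex_Icc s r)
      (fun t ht => (hd' t ht).continuousAt.continuousWithinAt)
      (fun t ht => (hd' t (interior_subset ht)).differentiableAt.differentiableWithinAt)
      fun t ht => ?_
    rw [(hd' t (interior_subset ht)).deriv]
    linarith [hb t (interior_subset ht)]
  have := hm (Set.left_mem_Icc.2 hsr) (Set.right_mem_Icc.2 hsr) hsr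
  simp only at this
  rw [mul_sub, sub_div]
  linarith

/-- `U` is an integrable function on `ℝ^N`, zero off the open set `Ω`, such that `-Δ U = F` in `Ω`
and `-Δ |U| ≤ |F|` in `ℝ^N` in the sense of distributions; and `F` obeys a Morrey condition with
exponent `N - 2 + β` and constant `A`. -/
structure IsExtendedSolution {N : ℕ} (Ω : Set (EuclideanSpace ℝ (Fin N)))
    (U F : EuclideanSpace ℝ (Fin N) → ℝ) (A β : ℝ) : Prop where
  isOpen : IsOpen Ω
  integrable_left : Integrable U
  integrable_right : Integrable F
  eq_zero : ∀ x, x ∉ Ω → U x = 0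
  abs_subsolution : ∀ η : EuclideanSpace ℝ (Fin N) → ℝ, ContDiff ℝ ∞ η → HasCompactSupport η →
    (∀ x, 0 ≤ η x) → -(∫ x, η x * |F x|) ≤ ∫ x, Laplacian.laplacian η x * |U x|
  equation : ∀ η : EuclideanSpace ℝ (Fin N) → ℝ, IsTestFunction Ω η →
    ∫ x, Laplacian.laplacian η x * U x = -∫ x, η x * F x
  β_pos : 0 < β
  growth : ∀ z t, 0 < t → ∫ y in Metric.closedBall z t, |F y| ≤ A * t ^ ((N : ℝ) - 2 + β)

namespace IsExtendedSolution

variable {N : ℕ} {Ω : Set (EuclideanSpace ℝ (Fin N))} {U F : EuclideanSpace ℝ (Fin N) → ℝ}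
  {A β : ℝ} (h : IsExtendedSolution Ω U F A β) (P : RadialProfile N)
include h

lemma A_nonneg : 0 ≤ A := by
  have := h.growth 0 1 one_pos
  rw [Real.one_rpow, mul_one] at this
  exact (integral_nonneg fun _ => abs_nonneg _).trans this

omit h in
lemma rpow_scale {t : ℝ} (ht : 0 < t) : t ^ ((N : ℝ) - 2 + β) / t ^ N = t ^ (β - 2) := by
  rw [← Real.rpow_natCast t N, ← Real.rpow_sub ht]
  congr 1; ring

lemma integral_potential_mul_le {t : ℝ} (ht : 0 < t) (z : EuclideanSpace ℝ (Fin N)) :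
    ∫ y, P.potential t (y - z) * |F y| ≤ P.bound * A * t ^ (β - 1) := by
  refine (P.integral_potential_mul_le ht z h.integrable_right.abs fun y => abs_nonneg _).trans ?_
  have hb := P.bound_pos
  calc P.bound * t / t ^ N * ∫ y in Metric.closedBall z t, |F y|
      ≤ P.bound * t / t ^ N * (A * t ^ ((N : ℝ) - 2 + β)) :=
        mul_le_mul_of_nonneg_left (h.growth z t ht) (by positivity)
    _ = P.bound * A * (t * (t ^ ((N : ℝ) - 2 + β) / t ^ N)) := by ring
    _ = P.bound * A * t ^ (β - 1) := by
        rw [rpow_scale ht, show β - 1 = 1 + (β - 2) by ring, Real.rpow_add ht, Real.rpow_one]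

/-- By the identity `∂_t K_t = Δ J_t` between the kernels, the inequality `-Δ |U| ≤ |F|` bounds the
derivative of the averages of `|U|` in the scale from below. -/
lemma mean_abs_le {s r : ℝ} (hs : 0 < s) (hsr : s ≤ r) (z : EuclideanSpace ℝ (Fin N)) :
    P.mean (fun y => |U y|) s z ≤
      P.mean (fun y => |U y|) r z + P.bound * A * r ^ β / β := by
  have hβ := h.β_pos
  have hA := h.A_nonneg
  have hb := P.bound_pos
  have key := le_add_of_neg_rpow_le_deriv (B := P.bound * A) hs hsr hβ.ne'
    (fun t ht => P.hasDerivAt_mean (hs.trans_le ht.1) z h.integrable_left.abs) fun t ht => ?_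
  · refine key.trans ?_
    gcongr
    linarith [Real.rpow_pos_of_pos hs β]
  · have ht0 := hs.trans_le ht.1
    have h1 := h.abs_subsolution _ (P.contDiff_potential_sub t z)
      (P.hasCompactSupport_potential_sub ht0 z) fun y => P.potential_nonneg ht0 _
    simp_rw [P.laplacian_potential_sub ht0] at h1
    linarith [h.integral_potential_mul_le P ht0 z]

/-- For balls in `Ω`, the equation `-Δ U = F` controls the derivative of the averages of `U` in the
scale from both sides. -/
lemma abs_mean_sub_mean_le {s r : ℝ} (hs : 0 < s) (hsr : s ≤ r) {z : EuclideanSpace ℝ (Fin N)}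
    (hz : Metric.closedBall z r ⊆ Ω) :
    |P.mean U s z - P.mean U r z| ≤ P.bound * A * r ^ β / β := by
  have hβ := h.β_pos
  have hA := h.A_nonneg
  have hb := P.bound_pos
  have hD : ∀ t ∈ Set.Icc s r, |∫ y, P.meanKernelDeriv t (y - z) * U y| ≤
      P.bound * A * t ^ (β - 1) := fun t ht => by
    have ht0 := hs.trans_le ht.1
    have h1 := h.equation _ ⟨P.contDiff_potential_sub t z, P.hasCompactSupport_potential_sub ht0 z,
      (P.tsupport_potential_sub_subset ht0 z).trans
        ((Metric.closedBall_subset_closedBall ht.2).trans hz)⟩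
    simp_rw [P.laplacian_potential_sub ht0] at h1
    rw [h1, abs_neg]
    refine (abs_integral_le_integral_abs.trans_eq ?_).trans (h.integral_potential_mul_le P ht0 z)
    simp_rw [abs_mul, abs_of_nonneg (P.potential_nonneg ht0 _)]
  have hd := fun t (ht : t ∈ Set.Icc s r) =>
    P.hasDerivAt_mean (hs.trans_le ht.1) z h.integrable_left
  have k1 := le_add_of_neg_rpow_le_deriv (B := P.bound * A) hs hsr hβ.ne' hd
    fun t ht => (abs_le.1 (hD t ht)).1
  have k2 := le_add_of_neg_rpow_le_deriv (B := P.bound * A) hs hsr hβ.ne'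
    (fun t ht => (hd t ht).neg) fun t ht => neg_le_neg (abs_le.1 (hD t ht)).2
  have k3 : P.bound * A * (r ^ β - s ^ β) / β ≤ P.bound * A * r ^ β / β := by
    gcongr
    linarith [Real.rpow_pos_of_pos hs β]
  simp only [Pi.neg_apply] at k2
  rw [abs_le]
  constructor <;> linarith

/-- The averages at two nearby points: for exponents `α < 1` the difference of the potentials, of
order `|z - z'| t ^ (β - 2)`, can be integrated in `t` from `s` on. -/
lemma abs_mean_sub_sub_le {s r α : ℝ} (hs : 0 < s) (hsr : s ≤ r) (hα : α < 1) (hαβ : α ≤ β)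
    {z z' : EuclideanSpace ℝ (Fin N)} (hz : Metric.closedBall z r ⊆ Ω)
    (hz' : Metric.closedBall z' r ⊆ Ω) :
    |(P.mean U s z - P.mean U s z') - (P.mean U r z - P.mean U r z')| ≤
      2 * P.bound * A * ‖z - z'‖ * r ^ (β - α) * s ^ (α - 1) / (1 - α) := by
  have hA := h.A_nonneg
  have hb := P.bound_pos
  have hr : 0 < r := hs.trans_le hsr
  set B := 2 * P.bound * A * ‖z - z'‖ * r ^ (β - α) with hB
  have hB0 : 0 ≤ B := by positivity
  have hD : ∀ t ∈ Set.Icc s r, |(∫ y, P.meanKernelDeriv t (y - z) * U y) -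
      ∫ y, P.meanKernelDeriv t (y - z') * U y| ≤ B * t ^ (α - 1 - 1) := fun t ht => by
    have ht0 := hs.trans_le ht.1
    have h1 {z : EuclideanSpace ℝ (Fin N)} (hz : Metric.closedBall z r ⊆ Ω) :=
      h.equation _ ⟨P.contDiff_potential_sub t z, P.hasCompactSupport_potential_sub ht0 z,
      (P.tsupport_potential_sub_subset ht0 z).trans
        ((Metric.closedBall_subset_closedBall ht.2).trans hz)⟩
    simp_rw [P.laplacian_potential_sub ht0] at h1
    rw [h1 hz, h1 hz', ← neg_sub_neg, neg_neg, neg_neg, abs_sub_comm, ← integral_sub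
      (P.integrable_potential_mul ht0 z h.integrable_right)
      (P.integrable_potential_mul ht0 z' h.integrable_right)]
    simp_rw [← sub_mul]
    refine (P.abs_integral_potential_sub_mul_le ht0 z z' h.integrable_right).trans ?_
    have hpow : t ^ (β - 2) ≤ r ^ (β - α) * t ^ (α - 1 - 1) := by
      rw [show β - 2 = (β - α) + (α - 1 - 1) by ring, Real.rpow_add ht0]
      gcongr
      exact ht.2
    calc P.bound * ‖z - z'‖ / t ^ N * ((∫ y in Metric.closedBall z t, |F y|) +
          ∫ y in Metric.closedBall z' t, |F y|)
        ≤ P.bound * ‖z - z'‖ / t ^ N * (A * t ^ ((N : ℝ) - 2 + β) + A * t ^ ((N : ℝ) - 2 + β)) :=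
          mul_le_mul_of_nonneg_left (add_le_add (h.growth z t ht0) (h.growth z' t ht0))
            (by positivity)
      _ = 2 * P.bound * A * ‖z - z'‖ * (t ^ ((N : ℝ) - 2 + β) / t ^ N) := by ring
      _ ≤ 2 * P.bound * A * ‖z - z'‖ * (r ^ (β - α) * t ^ (α - 1 - 1)) := by
          rw [rpow_scale ht0]; gcongr
      _ = B * t ^ (α - 1 - 1) := by rw [hB]; ring
  have hd := fun t (ht : t ∈ Set.Icc s r) =>
    (P.hasDerivAt_mean (hs.trans_le ht.1) z h.integrable_left).sub
      (P.hasDerivAt_mean (hs.trans_le ht.1) z' h.integrable_left)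
  have hp : α - 1 ≠ 0 := by linarith
  have k1 := le_add_of_neg_rpow_le_deriv (B := B) hs hsr hp hd fun t ht => (abs_le.1 (hD t ht)).1
  have k2 := le_add_of_neg_rpow_le_deriv (B := B) hs hsr hp
    (fun t ht => (hd t ht).neg) fun t ht => neg_le_neg (abs_le.1 (hD t ht)).2
  have k3 : B * (r ^ (α - 1) - s ^ (α - 1)) / (α - 1) ≤ B * s ^ (α - 1) / (1 - α) := by
    rw [← neg_div_neg_eq, neg_sub, ← mul_neg, neg_sub]
    have : 0 < 1 - α := by linarith
    gcongr
    linarith [Real.rpow_pos_of_pos hr (α - 1)]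
  simp only [Pi.neg_apply, Pi.sub_apply] at k1 k2
  rw [abs_le]
  constructor <;> linarith

/-- Comparison of the averages at a point `z` and at its mirror image `z'` in the hyperplane
through `p` with unit normal `m`, when `U` vanishes beyond the hyperplane. The test function is
`potential t (· - z) - potential t (· - z')`, which is nonnegative on the side of `z`, cut off on
the other side. -/
lemma mean_abs_sub_reflection_le {s r τ : ℝ} (hs : 0 < s) (hsr : s ≤ r) (hτ : 0 < τ)
    {p m z z' : EuclideanSpace ℝ (Fin N)} (hm : ‖m‖ = 1) (hz : 0 ≤ inner ℝ m (z - p))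
    (hz' : z' = z - (2 * inner ℝ m (z - p)) • m)
    (h0 : ∀ y, inner ℝ m (y - p) ≤ τ → y ∈ Metric.closedBall z r ∪ Metric.closedBall z' r →
      U y = 0) :
    P.mean (fun y => |U y|) s z - P.mean (fun y => |U y|) s z' ≤
      P.mean (fun y => |U y|) r z - P.mean (fun y => |U y|) r z' + P.bound * A * r ^ β / β := by
  have hβ := h.β_pos
  have hA := h.A_nonneg
  have hb := P.bound_pos
  have key := le_add_of_neg_rpow_le_deriv (B := P.bound * A) hs hsr hβ.ne'
    (fun t ht => (P.hasDerivAt_mean (hs.trans_le ht.1) z h.integrable_left.abs).sub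
      (P.hasDerivAt_mean (hs.trans_le ht.1) z' h.integrable_left.abs)) fun t ht => ?_
  · simp only [Pi.sub_apply] at key
    refine key.trans ?_
    gcongr
    linarith [Real.rpow_pos_of_pos hs β]
  have ht0 := hs.trans_le ht.1
  set H : EuclideanSpace ℝ (Fin N) → ℝ := fun y => inner ℝ m (y - p) with hH
  have Hs : ContDiff ℝ ∞ H := contDiff_const.inner ℝ (contDiff_id.sub contDiff_const)
  set ξ : EuclideanSpace ℝ (Fin N) → ℝ := fun y => Real.smoothTransition (H y / τ) with hξ
  have ξs : ContDiff ℝ ∞ ξ := Real.smoothTransition.contDiff.comp (Hs.div_const _)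
  set J := fun y => P.potential t (y - z) with hJ
  set J' := fun y => P.potential t (y - z') with hJ'
  set η := fun y => (J y - J' y) * ξ y with hη
  have Js := P.contDiff_potential_sub t z
  have Js' := P.contDiff_potential_sub t z'
  have ηs : ContDiff ℝ ∞ η := (Js.sub Js').mul ξs
  have hts : tsupport η ⊆ Metric.closedBall z t ∪ Metric.closedBall z' t := by
    refine closure_minimal (fun y hy => ?_)
      (Metric.isClosed_closedBall.union Metric.isClosed_closedBall)
    by_contra hn
    rw [Set.mem_union, not_or, Metric.mem_closedBall, Metric.mem_closedBall, dist_eq_norm,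
      dist_eq_norm, not_le, not_le] at hn
    exact hy (by simp [hη, hJ, hJ', P.potential_eq_zero ht0 hn.1, P.potential_eq_zero ht0 hn.2])
  have ηc : HasCompactSupport η :=
    ((isCompact_closedBall z t).union (isCompact_closedBall z' t)).of_isClosed_subset
      (isClosed_tsupport _) hts
  -- points on the side of `z` are closer to `z` than to `z'`
  have hnorm : ∀ y, 0 ≤ H y → ‖y - z‖ ≤ ‖y - z'‖ := fun y hy => by
    have e1 : y - z' = (y - z) + (2 * H z) • m := by rw [hz']; abel
    have e2 : inner ℝ (y - z) m = H y - H z := by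
      rw [real_inner_comm, hH]
      simp only [← inner_sub_right, sub_sub_sub_cancel_right]
    refine (sq_le_sq₀ (norm_nonneg _) (norm_nonneg _)).1 ?_
    rw [e1, norm_add_sq_real, inner_smul_right, norm_smul, hm, e2, mul_one, Real.norm_eq_abs,
      sq_abs]
    nlinarith [mul_nonneg hz hy]
  have η0 : ∀ y, 0 ≤ η y := fun y => by
    rcases le_or_gt 0 (H y) with hy | hy
    · exact mul_nonneg (sub_nonneg.2 (P.potential_anti ht0 (hnorm y hy)))
        (Real.smoothTransition.nonneg _)
    · simp [hη, hξ,
        Real.smoothTransition.zero_of_nonpos (div_nonpos_of_nonpos_of_nonneg hy.le hτ.le)]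
  have ηle : ∀ y, η y ≤ J y := fun y => by
    have hJ0 : 0 ≤ J y := P.potential_nonneg ht0 _
    have hJ0' : 0 ≤ J' y := P.potential_nonneg ht0 _
    calc η y ≤ J y * ξ y :=
          mul_le_mul_of_nonneg_right (by linarith) (Real.smoothTransition.nonneg _)
      _ ≤ J y := mul_le_of_le_one_right hJ0 (Real.smoothTransition.le_one _)
  have hsub := h.abs_subsolution η ηs ηc η0
  have hΔ : ∀ y, Laplacian.laplacian η y * |U y| =
      P.meanKernelDeriv t (y - z) * |U y| - P.meanKernelDeriv t (y - z') * |U y| := fun y => by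
    rw [← sub_mul, ← P.laplacian_potential_sub ht0, ← P.laplacian_potential_sub ht0]
    rcases lt_or_ge τ (H y) with hy | hy
    · have h2 : (2 : WithTop ℕ∞) ≤ ((⊤ : ℕ∞) : WithTop ℕ∞) := WithTop.coe_le_coe.2 le_top
      have hloc : η =ᶠ[𝓝 y] J - J' := by
        filter_upwards [Hs.continuous.continuousAt.eventually (lt_mem_nhds hy)] with x hx
        have : ξ x = 1 := Real.smoothTransition.one_of_one_le ((one_le_div hτ).2 hx.le)
        simp [hη, this]
      rw [(InnerProductSpace.laplacian_congr_nhds hloc).self_of_nhds,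
        (Js.contDiffAt.of_le h2).laplacian_sub (Js'.contDiffAt.of_le h2)]
    · by_cases hyb : y ∈ Metric.closedBall z r ∪ Metric.closedBall z' r
      · simp [h0 y hy hyb]
      · have hyb' : y ∉ Metric.closedBall z t ∪ Metric.closedBall z' t := fun hn =>
          hyb (Set.union_subset_union (Metric.closedBall_subset_closedBall ht.2)
            (Metric.closedBall_subset_closedBall ht.2) hn)
        rw [laplacian_eq_zero_of_notMem_tsupport fun hn => hyb' (hts hn),
          laplacian_eq_zero_of_notMem_tsupport fun hn =>
            hyb' (Or.inl (P.tsupport_potential_sub_subset ht0 z hn)),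
          laplacian_eq_zero_of_notMem_tsupport fun hn =>
            hyb' (Or.inr (P.tsupport_potential_sub_subset ht0 z' hn)), sub_zero]
  simp_rw [hΔ] at hsub
  have hint (z : EuclideanSpace ℝ (Fin N)) :
      Integrable (fun y => P.meanKernelDeriv t (y - z) * |U y|) :=
    h.integrable_left.abs.bdd_mul (P.continuous_meanKernelDeriv_sub ht0 z).aestronglyMeasurable
      (ae_of_all _ fun y => P.abs_meanKernelDeriv_le ht0 _)
  rw [integral_sub (hint z) (hint z')] at hsub
  have hF : ∫ y, η y * |F y| ≤ ∫ y, J y * |F y| := by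
    refine integral_mono_of_nonneg (ae_of_all _ fun y => mul_nonneg (η0 y) (abs_nonneg _))
      (P.integrable_potential_mul ht0 z h.integrable_right.abs)
      (ae_of_all _ fun y => mul_le_mul_of_nonneg_right (ηle y) (abs_nonneg _))
  linarith [h.integral_potential_mul_le P ht0 z]

end IsExtendedSolution

/-! ### The continuous representative and its decay at the boundary -/

/-- `v` is the limit of the averages of `U` at every point of `Ω`, and zero off `Ω`. -/
structure IsPreciseRepresentative {N : ℕ} (P : RadialProfile N)
    (Ω : Set (EuclideanSpace ℝ (Fin N))) (U v : EuclideanSpace ℝ (Fin N) → ℝ) : Prop where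
  tendsto : ∀ z ∈ Ω, Tendsto (fun t => P.mean U t z) (𝓝[>] 0) (𝓝 (v z))
  eq_zero : ∀ z, z ∉ Ω → v z = 0

namespace IsExtendedSolution

variable {N : ℕ} {Ω : Set (EuclideanSpace ℝ (Fin N))} {U F v : EuclideanSpace ℝ (Fin N) → ℝ}
  {A β : ℝ}

/-- The averages form a Cauchy net, by `abs_mean_sub_mean_le`. -/
lemma exists_tendsto_mean (h : IsExtendedSolution Ω U F A β) (P : RadialProfile N)
    {z : EuclideanSpace ℝ (Fin N)} (hz : z ∈ Ω) :
    ∃ l, Tendsto (fun t => P.mean U t z) (𝓝[>] 0) (𝓝 l) := by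
  have hβ := h.β_pos
  obtain ⟨d, hd, hdΩ⟩ := Metric.nhds_basis_closedBall.mem_iff.1 (h.isOpen.mem_nhds hz)
  rw [← cauchy_map_iff_exists_tendsto, cauchy_map_iff]
  refine ⟨inferInstance, ?_⟩
  rw [Metric.uniformity_basis_dist.tendsto_right_iff]
  intro ε hε
  have hlim : Tendsto (fun r : ℝ => P.bound * A * r ^ β / β) (𝓝 0) (𝓝 0) := by
    have := (((Real.continuousAt_rpow_const 0 β (Or.inr hβ.le)).tendsto).const_mul
      (P.bound * A)).div_const β
    simpa [Real.zero_rpow hβ.ne'] using this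
  obtain ⟨r, hr0, hr⟩ : ∃ r, 0 < r ∧ ∀ s, 0 < s → s ≤ r → s ≤ d ∧ P.bound * A * s ^ β / β < ε := by
    obtain ⟨r, hr, hrs⟩ := Metric.eventually_nhds_iff.1 ((hlim.eventually (gt_mem_nhds hε)).and
      (gt_mem_nhds hd))
    refine ⟨r / 2, by positivity, fun s hs hsr => ?_⟩
    have := @hrs s (by rw [Real.dist_0_eq_abs, abs_of_pos hs]; linarith)
    exact ⟨this.2.le, this.1⟩
  have hmem : ∀ᶠ s in 𝓝[>] (0 : ℝ), 0 < s ∧ s ≤ r := by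
    filter_upwards [self_mem_nhdsWithin, mem_nhdsWithin_of_mem_nhds (gt_mem_nhds hr0)] with s h1 h2
    exact ⟨h1, le_of_lt h2⟩
  filter_upwards [hmem.prod_mk hmem] with ⟨s, t⟩ ⟨⟨hs, hsr⟩, ⟨ht, htr⟩⟩
  simp only at hs hsr ht htr ⊢
  rw [Real.dist_eq]
  rcases le_total s t with hst | hst
  · exact (h.abs_mean_sub_mean_le P hs hst ((Metric.closedBall_subset_closedBall
      (hr t ht htr).1).trans hdΩ)).trans_lt (hr t ht htr).2
  · rw [abs_sub_comm]
    exact (h.abs_mean_sub_mean_le P ht hst ((Metric.closedBall_subset_closedBall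
      (hr s hs hsr).1).trans hdΩ)).trans_lt (hr s hs hsr).2

lemma exists_isPreciseRepresentative (h : IsExtendedSolution Ω U F A β) (P : RadialProfile N) :
    ∃ v, IsPreciseRepresentative P Ω U v := by
  classical
  choose l hl using fun (z : Ω) => h.exists_tendsto_mean P z.2
  refine ⟨fun z => if hz : z ∈ Ω then l ⟨z, hz⟩ else 0, fun z hz => ?_, fun z hz => dif_neg hz⟩
  simp only [hz, dif_pos]
  exact hl ⟨z, hz⟩

lemma ae_eq (h : IsExtendedSolution Ω U F A β) {P : RadialProfile N}
    (hv : IsPreciseRepresentative P Ω U v) : v =ᵐ[volume] U := by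
  filter_upwards [P.ae_tendsto_mean h.integrable_left] with z hz
  by_cases hzΩ : z ∈ Ω
  · exact tendsto_nhds_unique (hv.tendsto z hzΩ) hz
  · rw [hv.eq_zero z hzΩ, h.eq_zero z hzΩ]

/-- It suffices to bound the averages of `|U|` at small scales. -/
lemma abs_le_of_mean_le (hv : IsPreciseRepresentative P Ω U v) {z : EuclideanSpace ℝ (Fin N)}
    (hz : z ∈ Ω) {M r : ℝ} (hr : 0 < r)
    (hM : ∀ s, 0 < s → s ≤ r → P.mean (fun y => |U y|) s z ≤ M) : |v z| ≤ M := by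
  refine le_of_tendsto (hv.tendsto z hz).abs ?_
  filter_upwards [self_mem_nhdsWithin, mem_nhdsWithin_of_mem_nhds (gt_mem_nhds hr)] with s h1 h2
  exact (P.abs_mean_le h1 z).trans (hM s h1 (le_of_lt h2))

lemma abs_le_mean (h : IsExtendedSolution Ω U F A β) {P : RadialProfile N}
    (hv : IsPreciseRepresentative P Ω U v) {z : EuclideanSpace ℝ (Fin N)} (hz : z ∈ Ω) {r : ℝ}
    (hr : 0 < r) : |v z| ≤ P.mean (fun y => |U y|) r z + P.bound * A * r ^ β / β :=
  abs_le_of_mean_le hv hz hr fun _ hs hsr => h.mean_abs_le P hs hsr z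

lemma abs_sub_mean_le (h : IsExtendedSolution Ω U F A β) {P : RadialProfile N}
    (hv : IsPreciseRepresentative P Ω U v) {z : EuclideanSpace ℝ (Fin N)} {r : ℝ}
    (hr : 0 < r) (hz : Metric.closedBall z r ⊆ Ω) :
    |v z - P.mean U r z| ≤ P.bound * A * r ^ β / β := by
  refine le_of_tendsto ((hv.tendsto z (hz (Metric.mem_closedBall_self hr.le))).sub_const _).abs ?_
  filter_upwards [self_mem_nhdsWithin, mem_nhdsWithin_of_mem_nhds (gt_mem_nhds hr)] with s h1 h2
  exact h.abs_mean_sub_mean_le P h1 (le_of_lt h2) hz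

lemma setIntegral_abs_le (h : IsExtendedSolution Ω U F A β) {P : RadialProfile N}
    (hv : IsPreciseRepresentative P Ω U v) {S : Set (EuclideanSpace ℝ (Fin N))}
    (hS : MeasurableSet S) (hfin : volume S ≠ ⊤) {M : ℝ} (hM : ∀ y ∈ S, |v y| ≤ M) :
    ∫ y in S, |U y| ≤ M * volume.real S := by
  rw [mul_comm, ← smul_eq_mul, ← setIntegral_const]
  refine setIntegral_mono_on_ae h.integrable_left.abs.integrableOn (integrableOn_const hfin) hS ?_
  filter_upwards [h.ae_eq hv] with y hy hyS
  rw [← hy]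
  exact hM y hyS

/-- If `Ω` lies, within `B(x₀, r)`, above a hyperplane that is `2 ε r`-close to `x₀`, then `v` is
smaller by a factor of order `θ` on `B(x₀, θ r)`, up to the contribution of `F`. -/
lemma decay_step (h : IsExtendedSolution Ω U F A β) {P : RadialProfile N}
    (hv : IsPreciseRepresentative P Ω U v) {x₀ m z : EuclideanSpace ℝ (Fin N)} {r ε θ M : ℝ}
    (hr : 0 < r) (hε : 0 < ε) (hεθ : ε ≤ θ) (hθ : θ ≤ 1 / 20) (hm : ‖m‖ = 1)
    (hext : ∀ y ∈ Metric.ball x₀ r, inner ℝ m (y - x₀) ≤ -(2 * ε * r) → y ∉ Ω)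
    (hM : ∀ y ∈ Metric.ball x₀ r, |v y| ≤ M) (hz : z ∈ Metric.ball x₀ (θ * r)) :
    |v z| ≤ 8 * 4 ^ (N + 1) * P.bound *
      volume.real (Metric.ball (0 : EuclideanSpace ℝ (Fin N)) 1) * θ * M +
      P.bound * A * r ^ β / β := by
  have hβ := h.β_pos
  have hA := h.A_nonneg
  have hb := P.bound_pos
  have hθ0 : 0 < θ := hε.trans_le hεθ
  have hM0 : 0 ≤ M := (abs_nonneg _).trans (hM x₀ (Metric.mem_ball_self hr))
  by_cases hzΩ : z ∈ Ω
  swap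
  · rw [hv.eq_zero z hzΩ, abs_zero]
    positivity
  have hzr : ‖z - x₀‖ < θ * r := by rwa [Metric.mem_ball, dist_eq_norm] at hz
  have hεr : 0 < ε * r := by positivity
  have hεθr : ε * r ≤ θ * r := by gcongr
  have hθr : θ * r ≤ 1 / 20 * r := by gcongr
  have hmm : inner ℝ m m = (1 : ℝ) := by rw [real_inner_self_eq_norm_sq, hm, one_pow]
  -- The mirror passes through `p`. It lies below the points of `Ω` by at least `ε r`, so that the
  -- cut-off in `mean_abs_sub_reflection_le` takes place where `U` vanishes.
  set p := x₀ - (3 * ε * r) • m with hp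
  have hH (y) : inner ℝ m (y - p) = inner ℝ m (y - x₀) + 3 * ε * r := by
    rw [hp, ← sub_add, inner_add_right, inner_smul_right, hmm, mul_one]
  set z' := z - (2 * inner ℝ m (z - p)) • m with hz'
  have hzH : ε * r < inner ℝ m (z - p) := by
    rw [hH]
    by_contra hn
    exact hext z (by rw [Metric.mem_ball, dist_eq_norm]; linarith) (by linarith) hzΩ
  have hzH2 : inner ℝ m (z - p) ≤ 4 * (θ * r) := by
    have := (le_abs_self _).trans (abs_real_inner_le_norm m (z - x₀))
    rw [hm, one_mul] at this
    rw [hH]; linarith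
  have hzz' : ‖z - z'‖ ≤ 8 * (θ * r) := by
    rw [hz', sub_sub_cancel, norm_smul, hm, mul_one, Real.norm_of_nonneg (by linarith)]
    linarith
  have hb1 : Metric.closedBall z (r / 4) ⊆ Metric.ball x₀ r := fun y hy => by
    rw [Metric.mem_closedBall, dist_eq_norm] at hy
    rw [Metric.mem_ball, dist_eq_norm]
    have := norm_add_le (y - z) (z - x₀)
    rw [sub_add_sub_cancel] at this
    linarith
  have hb2 : Metric.closedBall z' (r / 4) ⊆ Metric.ball x₀ r := fun y hy => by
    rw [Metric.mem_closedBall, dist_eq_norm] at hy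
    rw [Metric.mem_ball, dist_eq_norm]
    have h1 := norm_add_le (y - z') (z' - x₀)
    have h2 := norm_add_le (z' - z) (z - x₀)
    rw [sub_add_sub_cancel] at h1 h2
    rw [norm_sub_rev z' z] at h2
    linarith
  have h0 : ∀ y, inner ℝ m (y - p) ≤ ε * r →
      y ∈ Metric.closedBall z (r / 4) ∪ Metric.closedBall z' (r / 4) → U y = 0 := by
    intro y hy hyb
    rw [hH] at hy
    exact h.eq_zero y (hext y (Set.union_subset hb1 hb2 hyb) (by linarith))
  have hz'H : inner ℝ m (z' - p) = -inner ℝ m (z - p) := by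
    rw [hz', sub_right_comm, inner_sub_right, inner_smul_right, hmm]
    ring
  refine (abs_le_of_mean_le hv hzΩ (r := min (r / 4) (ε * r)) (by positivity)
    (M := P.mean (fun y => |U y|) (r / 4) z - P.mean (fun y => |U y|) (r / 4) z' +
      P.bound * A * (r / 4) ^ β / β) fun s hs hsr => ?_).trans ?_
  · have h1 := h.mean_abs_sub_reflection_le P hs (hsr.trans (min_le_left _ _)) hεr hm
      (by linarith) hz' h0
    -- the mirror image `z'` is farther than `s` from `Ω`
    have h2 : P.mean (fun y => |U y|) s z' = 0 := P.mean_eq_zero hs fun y hy => by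
      rw [h0 y ?_ (Or.inr (Metric.closedBall_subset_closedBall (hsr.trans (min_le_left _ _)) hy)),
        abs_zero]
      rw [Metric.mem_closedBall, dist_eq_norm] at hy
      have h3 := (le_abs_self _).trans (abs_real_inner_le_norm m (y - z'))
      rw [hm, one_mul] at h3
      rw [← sub_add_sub_cancel y z' p, inner_add_right, hz'H]
      linarith [hsr.trans (min_le_right _ _)]
    linarith
  · set b₁ := volume.real (Metric.ball (0 : EuclideanSpace ℝ (Fin N)) 1)
    have hb₁ : 0 ≤ b₁ := measureReal_nonneg
    have h1 := (le_abs_self _).trans (P.abs_mean_sub_mean_le (u := fun y => |U y|)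
      (by positivity : 0 < r / 4) z z' h.integrable_left.abs Metric.isOpen_ball.measurableSet
      hb1 hb2)
    simp only [abs_abs] at h1
    have h2 := h.setIntegral_abs_le hv Metric.isOpen_ball.measurableSet
      measure_ball_lt_top.ne hM
    rw [Measure.real, Measure.addHaar_ball_of_pos _ _ hr, finrank_euclideanSpace_fin,
      ENNReal.toReal_mul,
      ENNReal.toReal_ofReal (by positivity), ← Measure.real] at h2
    have h3 : P.bound * ‖z - z'‖ / (r / 4) ^ (N + 1) * ∫ y in Metric.ball x₀ r, |U y| ≤
        8 * 4 ^ (N + 1) * P.bound * b₁ * θ * M := by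
      calc P.bound * ‖z - z'‖ / (r / 4) ^ (N + 1) * ∫ y in Metric.ball x₀ r, |U y|
          ≤ P.bound * (8 * (θ * r)) / (r / 4) ^ (N + 1) * (M * (r ^ N * b₁)) := by gcongr
        _ = 8 * 4 ^ (N + 1) * P.bound * b₁ * θ * M := by
          rw [div_pow, pow_succ r]; field_simp
    have h4 : P.bound * A * (r / 4) ^ β / β ≤ P.bound * A * r ^ β / β := by
      gcongr
      linarith
    linarith

/-- Iteration of `decay_step` along the scales `θ ^ k * r₀`. -/
lemma abs_le_rpow_of_flat (h : IsExtendedSolution Ω U F A β) {P : RadialProfile N}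
    (hv : IsPreciseRepresentative P Ω U v) {x₀ : EuclideanSpace ℝ (Fin N)} {r₀ ε θ M α : ℝ}
    (hr₀ : 0 < r₀) (hε : 0 < ε) (hεθ : ε ≤ θ) (hθ : θ ≤ 1 / 20) (hα : 0 < α) (hαβ : α ≤ β)
    (hθα : 8 * 4 ^ (N + 1) * P.bound *
      volume.real (Metric.ball (0 : EuclideanSpace ℝ (Fin N)) 1) * θ ≤ θ ^ α / 2)
    (hext : ∀ k : ℕ, ∃ m : EuclideanSpace ℝ (Fin N), ‖m‖ = 1 ∧ ∀ y ∈ Metric.ball x₀ (θ ^ k * r₀),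
      inner ℝ m (y - x₀) ≤ -(2 * ε * (θ ^ k * r₀)) → y ∉ Ω)
    (hM : ∀ y, |v y| ≤ M) (y : EuclideanSpace ℝ (Fin N)) (hy : y ≠ x₀) :
    |v y| ≤ (M + 2 * (P.bound * A * r₀ ^ β / β) / θ ^ α) / θ ^ α / r₀ ^ α * ‖y - x₀‖ ^ α := by
  have hβ := h.β_pos
  have hA := h.A_nonneg
  have hb := P.bound_pos
  have hθ0 : 0 < θ := hε.trans_le hεθ
  have hM0 : 0 ≤ M := (abs_nonneg _).trans (hM x₀)
  set Q := P.bound * A * r₀ ^ β / β with hQ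
  have hQ0 : 0 ≤ Q := by positivity
  set B := M + 2 * Q / θ ^ α with hB
  have hθα0 : 0 < θ ^ α := Real.rpow_pos_of_pos hθ0 α
  have hBM : M ≤ B := le_add_of_nonneg_right (by positivity)
  have hB0 : 0 ≤ B := hM0.trans hBM
  have hBQ : Q ≤ θ ^ α / 2 * B := by
    rw [hB, mul_add]
    have : θ ^ α / 2 * (2 * Q / θ ^ α) = Q := by field_simp
    rw [this]
    exact le_add_of_nonneg_left (by positivity)
  -- one half of the factor `θ ^ α` absorbs `θ M`, the other one the contribution of `F`
  have key : ∀ k : ℕ, ∀ y ∈ Metric.ball x₀ (θ ^ k * r₀), |v y| ≤ B * (θ ^ α) ^ k := by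
    intro k
    induction k with
    | zero => intro y _; simpa using (hM y).trans hBM
    | succ k ih =>
      intro y hy
      obtain ⟨m, hm, hme⟩ := hext k
      have hθk : 0 < θ ^ k := by positivity
      have hrk : (θ ^ k * r₀) ^ β ≤ (θ ^ α) ^ k * r₀ ^ β := by
        rw [Real.mul_rpow hθk.le hr₀.le]
        gcongr
        rw [← Real.rpow_natCast, ← Real.rpow_natCast, ← Real.rpow_mul hθ0.le,
          ← Real.rpow_mul hθ0.le, mul_comm α]
        exact Real.rpow_le_rpow_of_exponent_ge hθ0 (by linarith) (by gcongr)
      have h1 := h.decay_step hv (by positivity : 0 < θ ^ k * r₀) hε hεθ hθ hm hme ih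
        (z := y) (by rwa [← mul_assoc, ← pow_succ'])
      have h2 : P.bound * A * (θ ^ k * r₀) ^ β / β ≤ (θ ^ α) ^ k * Q := by
        rw [hQ]
        calc P.bound * A * (θ ^ k * r₀) ^ β / β ≤ P.bound * A * ((θ ^ α) ^ k * r₀ ^ β) / β := by
              gcongr
          _ = _ := by ring
      have h3 := mul_le_mul_of_nonneg_right hθα (by positivity : 0 ≤ B * (θ ^ α) ^ k)
      have h4 := mul_le_mul_of_nonneg_left hBQ (by positivity : 0 ≤ (θ ^ α) ^ k)
      refine h1.trans ((add_le_add h3 (h2.trans h4)).trans_eq ?_)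
      rw [pow_succ]; ring
  have hd : 0 < ‖y - x₀‖ := norm_pos_iff.2 (sub_ne_zero.2 hy)
  have hθ1 : θ ^ α ≤ 1 := Real.rpow_le_one hθ0.le (by linarith) hα.le
  have e (D : ℝ) : D / θ ^ α / r₀ ^ α * ‖y - x₀‖ ^ α = D / θ ^ α * (‖y - x₀‖ / r₀) ^ α := by
    rw [Real.div_rpow hd.le hr₀.le]; ring
  rw [e]
  rcases lt_or_ge ‖y - x₀‖ r₀ with hlt | hge
  · obtain ⟨k, hk1, hk2⟩ := exists_nat_pow_near_of_lt_one (div_pos hd hr₀)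
      ((div_le_one hr₀).2 hlt.le) hθ0 (by linarith)
    rcases hk2.lt_or_eq with hk2 | hk2
    · have h1 := key k y (by rw [Metric.mem_ball, dist_eq_norm]; rwa [div_lt_iff₀ hr₀] at hk2)
      refine h1.trans ?_
      have h2 : (θ ^ α) ^ (k + 1) ≤ (‖y - x₀‖ / r₀) ^ α := by
        rw [← Real.rpow_natCast, ← Real.rpow_mul hθ0.le, mul_comm, Real.rpow_mul hθ0.le,
          Real.rpow_natCast]
        gcongr
      calc B * (θ ^ α) ^ k = B / θ ^ α * (θ ^ α) ^ (k + 1) := by rw [pow_succ]; field_simp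
        _ ≤ _ := by gcongr
    · rcases k with _ | k
      · rw [pow_zero, div_eq_one_iff_eq hr₀.ne'] at hk2
        linarith
      · have h1 := key k y (by
          rw [Metric.mem_ball, dist_eq_norm, ← div_lt_iff₀ hr₀, hk2, pow_succ]
          exact mul_lt_of_lt_one_right (by positivity) (by linarith))
        refine h1.trans ?_
        rw [hk2, ← Real.rpow_natCast θ, ← Real.rpow_mul hθ0.le, mul_comm _ α, Real.rpow_mul hθ0.le,
          Real.rpow_natCast, pow_succ]
        apply le_of_eq
        field_simp
  · refine (hM y).trans (hBM.trans ?_)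
    have h1 : 1 ≤ (‖y - x₀‖ / r₀) ^ α := Real.one_le_rpow ((one_le_div hr₀).2 hge) hα.le
    have h2 : B ≤ B / θ ^ α := le_div_self hB0 hθα0 hθ1
    calc B ≤ B / θ ^ α := h2
      _ ≤ _ := le_mul_of_one_le_right (by positivity) h1

end IsExtendedSolution

/-! ### Global Hölder continuity -/

lemma exists_mem_frontier_dist_eq_infDist {N : ℕ} {Ω : Set (EuclideanSpace ℝ (Fin N))}
    (hΩ : IsOpen Ω) (hne : Ωᶜ.Nonempty) {y : EuclideanSpace ℝ (Fin N)} (hy : y ∈ Ω) :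
    ∃ x ∈ frontier Ω, ‖y - x‖ = Metric.infDist y Ωᶜ ∧ 0 < ‖y - x‖ ∧ Metric.ball y ‖y - x‖ ⊆ Ω := by
  obtain ⟨x, hx, hxd⟩ := hΩ.isClosed_compl.exists_infDist_eq_dist hne y
  have hxy : y ≠ x := fun h => hx (h ▸ hy)
  have hpos : 0 < dist y x := dist_pos.2 hxy
  have hball : Metric.ball y (dist y x) ⊆ Ω := fun w hw => by
    by_contra hn
    have := Metric.infDist_le_dist_of_mem (x := y) (s := Ωᶜ) hn
    rw [hxd, dist_comm y w] at this
    exact absurd (Metric.mem_ball.1 hw) (not_lt.2 this)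
  refine ⟨x, ?_, by rw [hxd, dist_eq_norm], by rwa [← dist_eq_norm], by rwa [← dist_eq_norm]⟩
  rw [hΩ.frontier_eq]
  refine ⟨closure_mono hball ?_, hx⟩
  rw [closure_ball _ hpos.ne']
  exact Metric.mem_closedBall.2 (dist_comm _ _).le

lemma mul_rpow_le_mul {c ρ α : ℝ} (hc : 1 ≤ c) (hρ : 0 ≤ ρ) (hα1 : α ≤ 1) :
    (c * ρ) ^ α ≤ c * ρ ^ α := by
  rw [Real.mul_rpow (by linarith) hρ]
  have : c ^ α ≤ c := by
    conv_rhs => rw [← Real.rpow_one c]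
    exact Real.rpow_le_rpow_of_exponent_le hc hα1
  gcongr

namespace IsExtendedSolution

variable {N : ℕ} {Ω : Set (EuclideanSpace ℝ (Fin N))} {U F v : EuclideanSpace ℝ (Fin N) → ℝ}
  {A β : ℝ}

/-- The interior estimate, for two points whose distance is at most a scale `R` on which `v` is
bounded by `M`. -/
lemma abs_sub_le_interior (h : IsExtendedSolution Ω U F A β) {P : RadialProfile N}
    (hv : IsPreciseRepresentative P Ω U v) {R α M : ℝ} (hα1 : α < 1) (hαβ : α ≤ β)
    {y z : EuclideanSpace ℝ (Fin N)} (hyz : 0 < ‖y - z‖) (hR : ‖y - z‖ ≤ R)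
    (hy : Metric.closedBall y R ⊆ Ω) (hz : Metric.closedBall z R ⊆ Ω)
    (hM : ∀ w ∈ Metric.closedBall y (2 * R), |v w| ≤ M * R ^ α) :
    |v y - v z| ≤ (P.bound * volume.real (Metric.ball (0 : EuclideanSpace ℝ (Fin N)) 1) * 2 ^ N * M
      + (2 * P.bound / (1 - α) + 2 * P.bound / β) * A * R ^ (β - α)) * ‖y - z‖ ^ α := by
  have hβ := h.β_pos
  have hA := h.A_nonneg
  have hb := P.bound_pos
  set ρ := ‖y - z‖
  have hR0 : 0 < R := hyz.trans_le hR
  have hα1' : 0 < 1 - α := by linarith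
  set b₁ := volume.real (Metric.ball (0 : EuclideanSpace ℝ (Fin N)) 1)
  have hMR : 0 ≤ M * R ^ α :=
    (abs_nonneg _).trans (hM y (Metric.mem_closedBall_self (by positivity)))
  have hM0 : 0 ≤ M := nonneg_of_mul_nonneg_left hMR (Real.rpow_pos_of_pos hR0 α)
  have t1 := h.abs_sub_mean_le hv hyz ((Metric.closedBall_subset_closedBall hR).trans hy)
  have t2 := h.abs_sub_mean_le hv hyz ((Metric.closedBall_subset_closedBall hR).trans hz)
  have t3 := h.abs_mean_sub_sub_le P hyz hR hα1 hαβ hy hz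
  have hzS : Metric.closedBall z R ⊆ Metric.closedBall y (2 * R) := fun w hw => by
    rw [Metric.mem_closedBall, dist_eq_norm] at hw ⊢
    have := norm_add_le (w - z) (z - y)
    rw [sub_add_sub_cancel, norm_sub_rev z y] at this
    linarith
  have t4 := P.abs_mean_sub_mean_le hR0 y z h.integrable_left
    Metric.isClosed_closedBall.measurableSet
    (Metric.closedBall_subset_closedBall (by linarith : R ≤ 2 * R)) hzS
  have t5 := h.setIntegral_abs_le hv Metric.isClosed_closedBall.measurableSet
    measure_closedBall_lt_top.ne hM
  rw [Measure.addHaar_real_closedBall _ _ (by positivity), finrank_euclideanSpace_fin] at t5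
  have e1 : ρ * R ^ (α - 1) ≤ ρ ^ α := by
    calc ρ * R ^ (α - 1) ≤ ρ * ρ ^ (α - 1) :=
          mul_le_mul_of_nonneg_left (Real.rpow_le_rpow_of_nonpos hyz hR (by linarith)) hyz.le
      _ = ρ ^ α := by
          rw [mul_comm, ← Real.rpow_add_one hyz.ne']; congr 1; ring
  have e2 : P.bound * ρ ^ β / β ≤ P.bound / β * (R ^ (β - α) * ρ ^ α) := by
    have : ρ ^ β ≤ R ^ (β - α) * ρ ^ α := by
      calc ρ ^ β = ρ ^ (β - α) * ρ ^ α := by rw [← Real.rpow_add hyz]; congr 1; ring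
        _ ≤ _ := by gcongr
    calc P.bound * ρ ^ β / β = P.bound / β * ρ ^ β := by ring
      _ ≤ _ := by gcongr
  have e2' : P.bound * A * ρ ^ β / β ≤ P.bound / β * A * R ^ (β - α) * ρ ^ α := by
    have := mul_le_mul_of_nonneg_left e2 hA
    calc P.bound * A * ρ ^ β / β = A * (P.bound * ρ ^ β / β) := by ring
      _ ≤ _ := this
      _ = _ := by ring
  have e3 : 2 * P.bound * A * ρ * R ^ (β - α) * ρ ^ (α - 1) / (1 - α) =
      2 * P.bound / (1 - α) * A * R ^ (β - α) * ρ ^ α := by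
    have : ρ ^ α = ρ * ρ ^ (α - 1) := by
      rw [mul_comm, ← Real.rpow_add_one hyz.ne']; congr 1; ring
    rw [this]; ring
  have e4 : P.bound * ρ / R ^ (N + 1) * ∫ w in Metric.closedBall y (2 * R), |U w| ≤
      P.bound * b₁ * 2 ^ N * M * ρ ^ α := by
    calc P.bound * ρ / R ^ (N + 1) * ∫ w in Metric.closedBall y (2 * R), |U w|
        ≤ P.bound * ρ / R ^ (N + 1) * (M * R ^ α * ((2 * R) ^ N * b₁)) := by gcongr
      _ = P.bound * b₁ * 2 ^ N * M * (ρ * (R ^ α / R)) := by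
          rw [mul_pow, pow_succ]; field_simp
      _ = P.bound * b₁ * 2 ^ N * M * (ρ * R ^ (α - 1)) := by rw [Real.rpow_sub_one hR0.ne']
      _ ≤ _ := by gcongr
  rw [e3] at t3
  have e5 : v y - v z = (v y - P.mean U ρ y) - (v z - P.mean U ρ z) +
      (((P.mean U ρ y - P.mean U ρ z) - (P.mean U R y - P.mean U R z)) +
        (P.mean U R y - P.mean U R z)) := by ring
  rw [e5]
  refine (abs_add_le _ _).trans ((add_le_add (abs_sub _ _) (abs_add_le _ _)).trans ?_)
  have := t4.trans e4
  have e6 : (P.bound * b₁ * 2 ^ N * M + (2 * P.bound / (1 - α) + 2 * P.bound / β) * A *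
      R ^ (β - α)) * ρ ^ α = P.bound * b₁ * 2 ^ N * M * ρ ^ α +
      2 * P.bound / (1 - α) * A * R ^ (β - α) * ρ ^ α +
      2 * (P.bound / β * A * R ^ (β - α) * ρ ^ α) := by ring
  rw [e6]
  linarith

/-- The decay at the boundary and the interior estimate combine to a Hölder estimate. -/
lemma abs_sub_le_of_decay (h : IsExtendedSolution Ω U F A β) {P : RadialProfile N}
    (hv : IsPreciseRepresentative P Ω U v) (hne : Ωᶜ.Nonempty) {r₀ α M D : ℝ} (hr₀ : 0 < r₀)
    (hα : 0 < α) (hα1 : α < 1) (hαβ : α ≤ β) (hM : ∀ y, |v y| ≤ M)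
    (hD : ∀ x ∈ frontier Ω, ∀ y, |v y| ≤ D * ‖y - x‖ ^ α) (hDM : M ≤ D * r₀ ^ α)
    (y z : EuclideanSpace ℝ (Fin N)) :
    |v y - v z| ≤ (5 * D + P.bound * volume.real (Metric.ball (0 : EuclideanSpace ℝ (Fin N)) 1) *
      2 ^ N * (4 * D) + (2 * P.bound / (1 - α) + 2 * P.bound / β) * A * r₀ ^ (β - α)) *
      ‖y - z‖ ^ α := by
  have hβ := h.β_pos
  have hA := h.A_nonneg
  have hb := P.bound_pos
  have hα1' : 0 < 1 - α := by linarith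
  have hM0 : 0 ≤ M := (abs_nonneg _).trans (hM 0)
  have hD0 : 0 ≤ D := nonneg_of_mul_nonneg_left (hM0.trans hDM) (Real.rpow_pos_of_pos hr₀ α)
  set b₁ := volume.real (Metric.ball (0 : EuclideanSpace ℝ (Fin N)) 1) with hb1
  have hb₁ : 0 ≤ b₁ := measureReal_nonneg
  set c₁ := P.bound * b₁ * 2 ^ N * (4 * D) with hc₁
  set c₂ := 2 * P.bound / (1 - α) + 2 * P.bound / β with hc₂
  have hc₁0 : 0 ≤ c₁ := by positivity
  have hc₂0 : 0 ≤ c₂ := by positivity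
  wlog hy : y ∈ Ω generalizing y z
  · by_cases hz : z ∈ Ω
    · rw [abs_sub_comm, norm_sub_rev]
      exact this z y hz
    · rw [hv.eq_zero y hy, hv.eq_zero z hz, sub_zero, abs_zero]
      positivity
  rcases eq_or_ne y z with rfl | hyz
  · rw [sub_self, abs_zero]
    positivity
  obtain ⟨x, hx, -, hd0, hball⟩ := exists_mem_frontier_dist_eq_infDist h.isOpen hne hy
  set ρ := ‖y - z‖ with hρd
  have hρ : 0 < ρ := norm_pos_iff.2 (sub_ne_zero.2 hyz)
  have hρα : 0 < ρ ^ α := Real.rpow_pos_of_pos hρ α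
  set d := ‖y - x‖ with hd
  have hzx : ‖z - x‖ ≤ ρ + d := by
    have := norm_add_le (z - y) (y - x)
    rwa [sub_add_sub_cancel, norm_sub_rev z y] at this
  have hmono {H : ℝ} (hH : |v y - v z| ≤ H * ρ ^ α)
      (hle : H ≤ 5 * D + c₁ + c₂ * A * r₀ ^ (β - α)) :
      |v y - v z| ≤ (5 * D + c₁ + c₂ * A * r₀ ^ (β - α)) * ρ ^ α :=
    hH.trans (mul_le_mul_of_nonneg_right hle hρα.le)
  have hc3 : 0 ≤ c₂ * A * r₀ ^ (β - α) := by positivity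
  -- points close to the boundary in comparison with their distance: decay alone suffices
  rcases le_or_gt d (2 * ρ) with hd2 | hd2
  · refine hmono (H := 5 * D) ?_ (by linarith)
    have h1 : |v y| ≤ D * (2 * ρ ^ α) := by
      refine (hD x hx y).trans (mul_le_mul_of_nonneg_left ?_ hD0)
      exact (Real.rpow_le_rpow (norm_nonneg _) hd2 hα.le).trans
        (mul_rpow_le_mul (by norm_num) hρ.le hα1.le)
    have h2 : |v z| ≤ D * (3 * ρ ^ α) := by
      refine (hD x hx z).trans (mul_le_mul_of_nonneg_left ?_ hD0)
      exact (Real.rpow_le_rpow (norm_nonneg _) (by linarith) hα.le).trans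
        (mul_rpow_le_mul (by norm_num) hρ.le hα1.le)
    refine (abs_sub _ _).trans ((add_le_add h1 h2).trans_eq (by ring))
  -- distant points: the bound `M` suffices
  rcases lt_or_ge r₀ ρ with hr | hr
  · refine hmono (H := 2 * D) ?_ (by linarith)
    have h1 : M ≤ D * ρ ^ α := hDM.trans (by gcongr)
    refine (abs_sub _ _).trans ((add_le_add ((hM y).trans h1) ((hM z).trans h1)).trans_eq (by ring))
  -- the scale of the interior estimate
  set R := min (d / 2) r₀ with hRdef
  have hRd : R ≤ d / 2 := min_le_left _ _
  have hRr : R ≤ r₀ := min_le_right _ _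
  have hRρ : ρ ≤ R := le_min (by linarith) hr
  have hR0 : 0 < R := hρ.trans_le hRρ
  have hyR : Metric.closedBall y R ⊆ Ω :=
    (Metric.closedBall_subset_ball (by linarith)).trans hball
  have hzR : Metric.closedBall z R ⊆ Ω := fun w hw => hball (by
    rw [Metric.mem_closedBall, dist_eq_norm] at hw
    rw [Metric.mem_ball, dist_eq_norm]
    have := norm_add_le (w - z) (z - y)
    rw [sub_add_sub_cancel, norm_sub_rev z y] at this
    linarith)
  have hMR : ∀ w ∈ Metric.closedBall y (2 * R), |v w| ≤ 4 * D * R ^ α := fun w hw => by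
    have hRα : 0 < R ^ α := Real.rpow_pos_of_pos hR0 α
    rcases min_choice (d / 2) r₀ with hmin | hmin
    · rw [Metric.mem_closedBall, dist_eq_norm] at hw
      have := norm_add_le (w - y) (y - x)
      rw [sub_add_sub_cancel] at this
      have hwx : ‖w - x‖ ≤ 4 * R := by rw [← hRdef] at hmin; linarith
      calc |v w| ≤ D * ‖w - x‖ ^ α := hD x hx w
        _ ≤ D * (4 * R ^ α) := mul_le_mul_of_nonneg_left
            ((Real.rpow_le_rpow (norm_nonneg _) hwx hα.le).trans
              (mul_rpow_le_mul (by norm_num) hR0.le hα1.le)) hD0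
        _ = _ := by ring
    · rw [← hRdef] at hmin
      have := (hM w).trans hDM
      rw [← hmin] at this
      have h4 : 0 ≤ D * R ^ α := by positivity
      linarith
  refine hmono (h.abs_sub_le_interior hv hα1 hαβ hρ hRρ hyR hzR hMR) ?_
  have : c₂ * A * R ^ (β - α) ≤ c₂ * A * r₀ ^ (β - α) := by
    gcongr
  linarith

end IsExtendedSolution

/-! ### Reifenberg-flat domains lie on one side of a hyperplane at every scale -/

/-- A connected set without boundary points of `Ω` lies outside `Ω` as soon as one of its points
does. -/
lemma forall_notMem_of_isPreconnected_of_frontier {X : Type*} [TopologicalSpace X] {C Ω : Set X}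
    (hC : IsPreconnected C) (hΩ : IsOpen Ω) (hf : ∀ x ∈ C, x ∉ frontier Ω) {w : X} (hw : w ∈ C)
    (hwΩ : w ∉ Ω) : ∀ x ∈ C, x ∉ Ω := by
  intro x hx hxΩ
  have hcov : C ⊆ Ω ∪ (closure Ω)ᶜ := fun y hy => by
    by_contra hn
    rw [Set.mem_union, not_or, Set.notMem_compl_iff] at hn
    exact hf y hy (by rw [hΩ.frontier_eq]; exact ⟨hn.2, hn.1⟩)
  have hw' : w ∈ (closure Ω)ᶜ := (hcov hw).resolve_left hwΩ
  obtain ⟨y, -, hy1, hy2⟩ := hC Ω (closure Ω)ᶜ hΩ isClosed_closure.isOpen_compl hcov ⟨x, hx, hxΩ⟩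
    ⟨w, hw, hw'⟩
  exact hy2 (subset_closure hy1)

/-- In Reifenberg's condition, the Hausdorff distance enters only through the distance of the points
of the boundary to the hyperplane. -/
lemma abs_inner_le_of_hausdorffDist_le {N : ℕ} {S : Set (EuclideanSpace ℝ (Fin N))}
    {x m y : EuclideanSpace ℝ (Fin N)} {r ε : ℝ} (hr : 0 < r) (hm : ‖m‖ = 1) (hx : x ∈ S)
    (h : Metric.hausdorffDist (S ∩ Metric.ball x r)
      (hyperplaneThrough x m ∩ Metric.ball x r) / r ≤ ε) (hy : y ∈ S ∩ Metric.ball x r) :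
    |inner ℝ m (y - x)| ≤ ε * r := by
  have hxb := Metric.mem_ball_self (x := x) hr
  have hne : (hyperplaneThrough x m ∩ Metric.ball x r).Nonempty :=
    ⟨x, by simp [hyperplaneThrough], hxb⟩
  have hfin := Metric.hausdorffEDist_ne_top_of_nonempty_of_bounded (s := S ∩ Metric.ball x r)
    ⟨x, hx, hxb⟩ hne (Metric.isBounded_ball.subset Set.inter_subset_right)
    (Metric.isBounded_ball.subset Set.inter_subset_right)
  have h1 := Metric.infDist_le_hausdorffDist_of_mem hy hfin
  rw [div_le_iff₀ hr] at h
  refine le_trans ?_ (h1.trans h)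
  rw [Metric.le_infDist hne]
  rintro p ⟨hp, -⟩
  have hp' : inner ℝ m (p - x) = (0 : ℝ) := hp
  have e : inner ℝ m (y - x) = (inner ℝ m (y - p) : ℝ) := by
    rw [← sub_add_sub_cancel y p x, inner_add_right, hp', add_zero]
  rw [e, dist_eq_norm]
  refine (abs_real_inner_le_norm _ _).trans_eq ?_
  rw [hm, one_mul]

/-- The separation property propagates from the scale `r₀` to the scales `θ ^ k * r₀`: one of the
two caps at the next scale meets the exterior cap at the present scale, and a cap contains no point
of the boundary. -/
lemma IsReifenbergFlat.exists_exterior_cap {N : ℕ} {ε r₀ θ : ℝ}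
    {Ω : Set (EuclideanSpace ℝ (Fin N))} (h : IsReifenbergFlat ε r₀ Ω) (hθ : 5 * ε ≤ θ)
    (hθ1 : θ ≤ 1) {x : EuclideanSpace ℝ (Fin N)} (hx : x ∈ frontier Ω) (k : ℕ) :
    ∃ m : EuclideanSpace ℝ (Fin N), ‖m‖ = 1 ∧ ∀ y ∈ Metric.ball x (θ ^ k * r₀),
      inner ℝ m (y - x) ≤ -(2 * ε * (θ ^ k * r₀)) → y ∉ Ω := by
  obtain ⟨n, hn1, hn2⟩ := h.flat
  have hε := h.eps_pos
  have hr₀ := h.r_pos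
  have hθ0 : 0 < θ := by linarith
  induction k with
  | zero =>
    refine ⟨n x r₀, (hn1 x hx r₀ hr₀ le_rfl).1, fun y hy hy' => ?_⟩
    rw [pow_zero, one_mul] at hy hy'
    exact (hn2 x hx).2 ⟨hy, hy'⟩
  | succ k ih =>
    obtain ⟨m, hm, hme⟩ := ih
    set r := θ ^ k * r₀ with hr
    have hr0 : 0 < r := by positivity
    have hs : θ ^ (k + 1) * r₀ = θ * r := by rw [hr, pow_succ]; ring
    rw [hs]
    have hs0 : 0 < θ * r := by positivity
    have hsr : θ * r ≤ r := mul_le_of_le_one_left hr0.le hθ1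
    have hsr₀ : θ * r ≤ r₀ := by
      rw [← hs]
      exact mul_le_of_le_one_left hr₀.le (pow_le_one₀ hθ0.le hθ1)
    obtain ⟨hn, hd⟩ := hn1 x hx (θ * r) hs0 hsr₀
    have hfr := fun y hy => abs_inner_le_of_hausdorffDist_le (y := y) hs0 hn hx hd hy
    -- choice of the sign of the normal vector
    obtain ⟨m', hm', hmm', hfr'⟩ : ∃ m' : EuclideanSpace ℝ (Fin N), ‖m'‖ = 1 ∧
        0 ≤ (inner ℝ m m' : ℝ) ∧ ∀ y ∈ frontier Ω ∩ Metric.ball x (θ * r),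
          -(ε * (θ * r)) ≤ inner ℝ m' (y - x) := by
      rcases le_total 0 (inner ℝ m (n x (θ * r)) : ℝ) with hc | hc
      · exact ⟨n x (θ * r), hn, hc, fun y hy => (abs_le.1 (hfr y hy)).1⟩
      · refine ⟨-n x (θ * r), by rwa [norm_neg], by rw [inner_neg_right]; linarith,
          fun y hy => ?_⟩
        rw [inner_neg_left]
        exact neg_le_neg (abs_le.1 (hfr y hy)).2
    set C := Metric.ball x (θ * r) ∩ {y | inner ℝ m' (y - x) < -(ε * (θ * r))} with hC
    have hCc : IsPreconnected C := by
      refine ((convex_ball x _).inter ?_).isPreconnected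
      have : {y | inner ℝ m' (y - x) < -(ε * (θ * r))} =
          {y | innerSL ℝ m' y < -(ε * (θ * r)) + inner ℝ m' x} := by
        ext y
        simp only [Set.mem_ofPred_eq, inner_sub_right, innerSL_apply_apply, sub_lt_iff_lt_add]
      rw [this]
      exact convex_halfSpace_lt (innerSL ℝ m').toLinearMap.isLinear _
    have hself : ∀ {m : EuclideanSpace ℝ (Fin N)}, ‖m‖ = 1 → inner ℝ m m = (1 : ℝ) := fun hm => by
      rw [real_inner_self_eq_norm_sq, hm, one_pow]
    -- As `inner ℝ m m' ≥ 0`, the point `w` lies below both hyperplanes, at distance at least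
    -- `2 / 5 * (θ * r)`; this is at least `2 * ε * r`, because `5 * ε ≤ θ`.
    set w := x + (2 / 5 * (θ * r)) • (-m - m') with hw
    have hwx : w - x = (2 / 5 * (θ * r)) • (-m - m') := by rw [hw, add_sub_cancel_left]
    have hwb : w ∈ Metric.ball x (θ * r) := by
      rw [Metric.mem_ball, dist_eq_norm, hwx, norm_smul, Real.norm_of_nonneg (by positivity)]
      have : ‖-m - m'‖ ≤ 2 := by
        refine (norm_sub_le _ _).trans ?_
        rw [norm_neg, hm, hm']; norm_num
      nlinarith
    have hw1 : inner ℝ m (w - x) ≤ -(2 * ε * r) := by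
      rw [hwx, inner_smul_right, inner_sub_right, inner_neg_right, hself hm]
      nlinarith [mul_nonneg hs0.le hmm', mul_le_mul_of_nonneg_right hθ hr0.le]
    have hw2 : inner ℝ m' (w - x) < -(ε * (θ * r)) := by
      rw [hwx, inner_smul_right, inner_sub_right, inner_neg_right, hself hm', real_inner_comm]
      nlinarith [mul_nonneg hs0.le hmm', mul_le_mul_of_nonneg_right (hθ.trans hθ1) hs0.le]
    have hwΩ : w ∉ Ω := hme w (Metric.ball_subset_ball hsr hwb) hw1
    have key := forall_notMem_of_isPreconnected_of_frontier hCc h.isOpen (fun y hy hyf => by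
      have h1 := hfr' y ⟨hyf, hy.1⟩
      have h2 : inner ℝ m' (y - x) < -(ε * (θ * r)) := hy.2
      linarith) ⟨hwb, hw2⟩ hwΩ
    refine ⟨m', hm', fun y hy hy' => key y ⟨hy, ?_⟩⟩
    have : 0 < ε * (θ * r) := by positivity
    show inner ℝ m' (y - x) < -(ε * (θ * r))
    linarith

/-! ### Sobolev inequalities -/

lemma IsTestFunction.eLpNorm_gradient_restrict {N : ℕ} {Ω : Set (EuclideanSpace ℝ (Fin N))}
    {φ : EuclideanSpace ℝ (Fin N) → ℝ} (h : IsTestFunction Ω φ) (p : ℝ≥0∞) :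
    eLpNorm (gradient φ) p (volume.restrict Ω) = eLpNorm (fderiv ℝ φ) p volume := by
  rw [eLpNorm_restrict_eq_of_support_subset, eLpNorm_congr_norm_ae (ae_of_all _ (norm_gradient φ))]
  intro x hx
  by_contra hn
  exact hx (h.gradient_eq_zero hn)

/-- The Gagliardo–Nirenberg–Sobolev inequality, from `L²` for `N ≥ 3` and from `L¹` for `N = 2`,
where Hölder's inequality brings in the measure of `Ω`. -/
lemma exists_sobolev {N : ℕ} (hN : 2 ≤ N) : ∃ p K : ℝ, 2 ≤ p ∧ 0 ≤ K ∧
    ∀ Ω : Set (EuclideanSpace ℝ (Fin N)), volume Ω ≠ ⊤ → ∀ φ, IsTestFunction Ω φ →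
      (eLpNorm φ (ENNReal.ofReal p) volume).toReal ≤ K * (if N = 2 then √(volume Ω).toReal else 1) *
        (eLpNorm (gradient φ) 2 (volume.restrict Ω)).toReal := by
  have hN0 : (0 : ℝ) < N := by positivity
  rcases hN.eq_or_lt with rfl | hN3
  · refine ⟨2, eLpNormLESNormFDerivOfEqInnerConst
      (volume : Measure (EuclideanSpace ℝ (Fin 2))) (1 : NNReal), le_rfl, by positivity,
      fun Ω hΩ φ hφ => ?_⟩
    have h1 := eLpNorm_le_eLpNorm_fderiv_of_eq_inner volume
      (hφ.contDiff.of_le (by exact_mod_cast le_top)) hφ.hasCompactSupport (p := 1) (p' := 2) le_rfl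
      (by simp) (by simp; norm_num)
    have h2 := eLpNorm_le_eLpNorm_mul_rpow_measure_univ (p := 1) (q := 2) one_le_two
      (hφ.memLp_gradient 2 (volume.restrict Ω)).1
    rw [Measure.restrict_apply_univ, hφ.eLpNorm_gradient_restrict 1] at h2
    have h3 := h1.trans (mul_le_mul_right h2 _)
    have htop := (hφ.memLp_gradient 2 (volume.restrict Ω)).2.ne
    have h4 := ENNReal.toReal_mono (ENNReal.mul_ne_top (by simp) (ENNReal.mul_ne_top htop
      (ENNReal.rpow_ne_top_of_nonneg (by norm_num) hΩ))) h3
    rw [ENNReal.toReal_mul, ENNReal.toReal_mul, ← ENNReal.toReal_rpow] at h4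
    simp only [if_true]
    rw [show ENNReal.ofReal 2 = ((2 : NNReal) : ℝ≥0∞) by simp, Real.sqrt_eq_rpow]
    refine h4.trans_eq ?_
    norm_num
    ring
  · have hN3' : (3 : ℝ) ≤ N := by exact_mod_cast hN3
    have hN2 : N ≠ 2 := by omega
    set p : NNReal := ((2 : NNReal)⁻¹ - (N : NNReal)⁻¹)⁻¹ with hp
    have hle : (N : NNReal)⁻¹ ≤ (2 : NNReal)⁻¹ := by
      rw [inv_le_inv₀ (by positivity) (by positivity)]
      exact_mod_cast hN
    have hp' : (p : ℝ)⁻¹ = (2 : ℝ)⁻¹ - (N : ℝ)⁻¹ := by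
      rw [hp, NNReal.coe_inv, inv_inv, NNReal.coe_sub hle]
      simp
    have hpp : (0 : ℝ) < (p : ℝ)⁻¹ := by
      rw [hp', sub_pos, inv_lt_inv₀ (by positivity) (by positivity)]
      linarith
    refine ⟨p, eLpNormLESNormFDerivOfEqInnerConst
      (volume : Measure (EuclideanSpace ℝ (Fin N))) (2 : NNReal), ?_, by positivity,
      fun Ω hΩ φ hφ => ?_⟩
    · rw [← inv_le_inv₀ (inv_pos.1 hpp) (by positivity), hp']
      linarith [inv_pos.2 hN0]
    have h1 := eLpNorm_le_eLpNorm_fderiv_of_eq_inner volume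
      (hφ.contDiff.of_le (by exact_mod_cast le_top)) hφ.hasCompactSupport (p := 2) (p' := p)
      one_le_two (by simp; omega) (by simpa using hp')
    rw [ENNReal.coe_ofNat, ← hφ.eLpNorm_gradient_restrict 2] at h1
    have htop := (hφ.memLp_gradient 2 (volume.restrict Ω)).2.ne
    have h4 := ENNReal.toReal_mono (ENNReal.mul_ne_top (by simp) htop) h1
    rw [ENNReal.toReal_mul] at h4
    rw [if_neg hN2, mul_one, ENNReal.ofReal_coe_nnreal]
    exact h4

/-- The Poincaré inequality. -/
lemma exists_poincare {N : ℕ} (hN : 2 ≤ N) {Ω : Set (EuclideanSpace ℝ (Fin N))}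
    (hΩ : volume Ω ≠ ⊤) : ∃ C : ℝ, 0 ≤ C ∧ ∀ φ, IsTestFunction Ω φ →
      (eLpNorm φ 2 (volume.restrict Ω)).toReal ≤
        C * (eLpNorm (gradient φ) 2 (volume.restrict Ω)).toReal := by
  obtain ⟨p, K, hp, hK, h⟩ := exists_sobolev hN
  have hp0 : 0 < p := by linarith
  set c := (volume Ω).toReal ^ (1 / 2 - 1 / p)
  refine ⟨K * (if N = 2 then √(volume Ω).toReal else 1) * c,
    mul_nonneg (mul_nonneg hK (by split_ifs <;> positivity)) (by positivity), fun φ hφ => ?_⟩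
  have h2 := eLpNorm_le_eLpNorm_mul_rpow_measure_univ (p := 2) (q := ENNReal.ofReal p)
    (by rw [← ENNReal.ofReal_ofNat]; exact ENNReal.ofReal_le_ofReal hp)
    (hφ.memLp 2 (volume.restrict Ω)).1
  rw [Measure.restrict_apply_univ, ENNReal.toReal_ofReal hp0.le, ENNReal.toReal_ofNat] at h2
  have hexp : 0 ≤ 1 / 2 - 1 / p := by
    rw [sub_nonneg]; exact one_div_le_one_div_of_le two_pos hp
  have h3 : eLpNorm φ 2 (volume.restrict Ω) ≤
      eLpNorm φ (ENNReal.ofReal p) volume * volume Ω ^ (1 / 2 - 1 / p) :=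
    h2.trans (mul_le_mul_left (eLpNorm_mono_measure _ Measure.restrict_le_self) _)
  have h4 := ENNReal.toReal_mono (ENNReal.mul_ne_top (hφ.memLp _ volume).2.ne
    (ENNReal.rpow_ne_top_of_nonneg hexp hΩ)) h3
  rw [ENNReal.toReal_mul, ← ENNReal.toReal_rpow] at h4
  have h5 := mul_le_mul_of_nonneg_right (h Ω hΩ φ hφ) (by positivity : 0 ≤ c)
  refine h4.trans (h5.trans_eq ?_)
  ring

/-- A local bound for `u` in terms of its gradient, uniform in the domain if `N ≥ 3` and depending
on its measure only if `N = 2`. -/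
lemma exists_setIntegral_abs_le {N : ℕ} (hN : 2 ≤ N) {r : ℝ} (hr : 0 < r) : ∃ K : ℝ, 0 ≤ K ∧
    ∀ (Ω : Set (EuclideanSpace ℝ (Fin N))), MeasurableSet Ω → volume Ω ≠ ⊤ → ∀ u G,
      MemW120 Ω u G → ∀ z, ∫ y in Metric.closedBall z r, |Ω.indicator u y| ≤
        K * (if N = 2 then √(volume Ω).toReal else 1) *
          (eLpNorm G 2 (volume.restrict Ω)).toReal := by
  obtain ⟨p, K, hp, hK, h⟩ := exists_sobolev hN
  set c := volume.real (Metric.ball (0 : EuclideanSpace ℝ (Fin N)) 1) ^ (1 - 1 / p) *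
    r ^ (N * (1 - 1 / p) : ℝ) with hc
  have hc0 : 0 ≤ c := by positivity
  refine ⟨c * K, by positivity, fun Ω hΩm hΩ u G hu z => ?_⟩
  obtain ⟨φ, h1, h2, -, h4⟩ := hu.exists_approx
  set c' := volume.real (Metric.ball (0 : EuclideanSpace ℝ (Fin N)) 1) ^ (1 - 1 / (2 : ℝ)) *
    r ^ (N * (1 - 1 / (2 : ℝ)) : ℝ) with hc'
  set κ := if N = 2 then √(volume Ω).toReal else 1
  have hlim : Tendsto (fun k => c' * (eLpNorm (fun x => u x - φ k x) 2 (volume.restrict Ω)).toReal +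
      c * K * κ * (eLpNorm (gradient (φ k)) 2 (volume.restrict Ω)).toReal) atTop
      (𝓝 (c' * 0 + c * K * κ * (eLpNorm G 2 (volume.restrict Ω)).toReal)) :=
    (h2.const_mul _).add (h4.const_mul _)
  rw [mul_zero, zero_add] at hlim
  refine ge_of_tendsto hlim (.of_forall fun k => ?_)
  have hφ := h1 k
  set w := Ω.indicator (fun x => u x - φ k x) with hw
  have hw2 : MemLp w (ENNReal.ofReal 2) volume := by
    rw [hw, ENNReal.ofReal_ofNat, memLp_indicator_iff_restrict hΩm]
    exact hu.memW12.memLp.sub (hφ.memLp 2 _)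
  have e1 := setIntegral_closedBall_abs_le (by norm_num) hw2 z hr
  have e2 := setIntegral_closedBall_abs_le (by linarith) (hφ.memLp (ENNReal.ofReal p) volume) z hr
  rw [hw, ENNReal.ofReal_ofNat, eLpNorm_indicator_eq_eLpNorm_restrict hΩm, ← hw] at e1
  have e3 := mul_le_mul_of_nonneg_left (h Ω hΩ (φ k) hφ) hc0
  have hfin : volume (Metric.closedBall z r) ≠ ⊤ := measure_closedBall_lt_top.ne
  have i1 : IntegrableOn (fun y => |w y|) (Metric.closedBall z r) := by
    have : IsFiniteMeasure (volume.restrict (Metric.closedBall z r)) :=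
      isFiniteMeasure_restrict.2 hfin
    exact ((hw2.restrict _).integrable (by rw [ENNReal.one_le_ofReal]; norm_num)).abs
  have i2 : IntegrableOn (fun y => |φ k y|) (Metric.closedBall z r) :=
    (hφ.contDiff.continuous.integrable_of_hasCompactSupport hφ.hasCompactSupport).abs.integrableOn
  have e4 : ∫ y in Metric.closedBall z r, |Ω.indicator u y| ≤
      (∫ y in Metric.closedBall z r, |w y|) + ∫ y in Metric.closedBall z r, |φ k y| := by
    rw [← integral_add i1 i2]
    refine integral_mono_of_nonneg (ae_of_all _ fun y => abs_nonneg _) (i1.add i2)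
      (ae_of_all _ fun y => ?_)
    by_cases hy : y ∈ Ω
    · simp only [hw, Set.indicator_of_mem hy]
      have := abs_add_le (u y - φ k y) (φ k y)
      rwa [sub_add_cancel] at this
    · simp only [hw, Set.indicator_of_notMem hy, abs_zero, zero_add]
      exact abs_nonneg _
  rw [← hc'] at e1
  rw [← hc] at e2
  have e5 : c * (K * κ * (eLpNorm (gradient (φ k)) 2 (volume.restrict Ω)).toReal) =
    c * K * κ * (eLpNorm (gradient (φ k)) 2 (volume.restrict Ω)).toReal := by ring
  linarith

/-! ### Existence and uniqueness of the weak solution -/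

section Hilbert

open scoped InnerProductSpace

variable {H₁ H₂ : Type*} [NormedAddCommGroup H₁] [InnerProductSpace ℝ H₁] [CompleteSpace H₁]
  [NormedAddCommGroup H₂] [InnerProductSpace ℝ H₂] [CompleteSpace H₂]

/-- The theorem of Lax and Milgram, for the bilinear form of the second components on a closed
subspace of a product on which a Poincaré inequality holds. -/
lemma exists_inner_snd_eq_inner_fst {X : Submodule ℝ (WithLp 2 (H₁ × H₂))}
    (hX : IsClosed (X : Set (WithLp 2 (H₁ × H₂)))) {C : ℝ}
    (hC : ∀ x ∈ X, ‖x.fst‖ ≤ C * ‖x.snd‖) (g : H₁) :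
    ∃ x ∈ X, ∀ y ∈ X, ⟪x.snd, y.snd⟫_ℝ = ⟪g, y.fst⟫_ℝ := by
  have : CompleteSpace X := hX.completeSpace_coe
  let S : X →L[ℝ] H₂ := (WithLp.sndL 2 ℝ H₁ H₂).comp X.subtypeL
  let T : X →L[ℝ] H₁ := (WithLp.fstL 2 ℝ H₁ H₂).comp X.subtypeL
  let B : X →L[ℝ] X →L[ℝ] ℝ := (innerSL ℝ).bilinearComp S S
  have hB : IsCoercive B := by
    refine ⟨(C ^ 2 + 1)⁻¹, by positivity, fun x => ?_⟩
    have h1 : B x x = ‖(x : WithLp 2 (H₁ × H₂)).snd‖ ^ 2 := real_inner_self_eq_norm_sq _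
    have h2 : ‖x‖ ^ 2 = _ := WithLp.prod_norm_sq_eq_of_L2 (x : WithLp 2 (H₁ × H₂))
    have h3 := pow_le_pow_left₀ (norm_nonneg _) (hC x x.2) 2
    rw [mul_assoc, ← sq, h1, h2, inv_mul_le_iff₀ (by positivity)]
    linarith [h3, mul_pow C ‖(x : WithLp 2 (H₁ × H₂)).snd‖ 2]
  let ℓ : X →L[ℝ] ℝ := (innerSL ℝ g).comp T
  let x := hB.continuousLinearEquivOfBilin.symm ((InnerProductSpace.toDual ℝ X).symm ℓ)
  refine ⟨x, x.2, fun y hy => ?_⟩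
  have h := hB.continuousLinearEquivOfBilin_apply x ⟨y, hy⟩
  rw [ContinuousLinearEquiv.apply_symm_apply, InnerProductSpace.toDual_symm_apply] at h
  exact h.symm

end Hilbert

section

variable {N : ℕ} {Ω : Set (EuclideanSpace ℝ (Fin N))}
  {u u' : EuclideanSpace ℝ (Fin N) → ℝ}
  {G G' : EuclideanSpace ℝ (Fin N) → EuclideanSpace ℝ (Fin N)}

/-- The limit of test functions in the norm of `W^{1,2}` is weakly differentiable. -/
lemma MemW120.of_approx (hu : MemLp u 2 (volume.restrict Ω)) (hG : MemLp G 2 (volume.restrict Ω))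
    {φ : ℕ → EuclideanSpace ℝ (Fin N) → ℝ} (hφ : ∀ k, IsTestFunction Ω (φ k))
    (h1 : Tendsto (fun k => eLpNorm (fun x => u x - φ k x) 2 (volume.restrict Ω)) atTop (𝓝 0))
    (h2 : Tendsto (fun k => eLpNorm (fun x => G x - gradient (φ k) x) 2 (volume.restrict Ω))
      atTop (𝓝 0)) : MemW120 Ω u G := by
  refine ⟨⟨hu, hG, fun ξ hξ => ?_⟩, φ, hφ, h1, h2⟩
  set μ := volume.restrict Ω
  have h1' := (ENNReal.tendsto_toReal ENNReal.zero_ne_top).comp h1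
  have h2' := (ENNReal.tendsto_toReal ENNReal.zero_ne_top).comp h2
  rw [ENNReal.toReal_zero] at h1' h2'
  have i1 {a : EuclideanSpace ℝ (Fin N) → ℝ} (ha : MemLp a 2 μ) :
      Integrable (fun x => a x • gradient ξ x) μ :=
    memLp_one_iff_integrable.1 ((hξ.memLp_gradient 2 μ).smul ha)
  have i2 {a : EuclideanSpace ℝ (Fin N) → EuclideanSpace ℝ (Fin N)} (ha : MemLp a 2 μ) :
      Integrable (fun x => ξ x • a x) μ :=
    memLp_one_iff_integrable.1 (ha.smul (hξ.memLp 2 μ))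
  refine ext_inner_right ℝ fun v => ?_
  have ev : MemLp (fun x => inner ℝ (gradient ξ x) v) 2 μ := by
    simp_rw [inner_gradient]
    exact (contDiff_fderiv_apply hξ.contDiff v).continuous.memLp_of_hasCompactSupport
      (hξ.hasCompactSupport.fderiv_apply (𝕜 := ℝ) v)
  have ev' : MemLp (fun x => ξ x • v) 2 μ :=
    (hξ.contDiff.continuous.smul continuous_const).memLp_of_hasCompactSupport
      hξ.hasCompactSupport.smul_right
  have e1 {a : EuclideanSpace ℝ (Fin N) → ℝ} (ha : MemLp a 2 μ) :
      inner ℝ (∫ x, a x • gradient ξ x ∂μ) v = ∫ x, a x * inner ℝ (gradient ξ x) v ∂μ := by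
    rw [real_inner_comm, ← integral_inner (i1 ha)]
    simp_rw [inner_smul_right, real_inner_comm v]
  have e2 {a : EuclideanSpace ℝ (Fin N) → EuclideanSpace ℝ (Fin N)} (ha : MemLp a 2 μ) :
      inner ℝ (-∫ x, ξ x • a x ∂μ) v = -∫ x, inner ℝ (a x) (ξ x • v) ∂μ := by
    rw [inner_neg_left, real_inner_comm, ← integral_inner (i2 ha)]
    simp_rw [inner_smul_right, real_inner_comm v]
  rw [e1 hu, e2 hG]
  have l1 : Tendsto (fun k => ∫ x, φ k x * inner ℝ (gradient ξ x) v ∂μ) atTop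
      (𝓝 (∫ x, u x * inner ℝ (gradient ξ x) v ∂μ)) := by
    rw [tendsto_iff_norm_sub_tendsto_zero]
    refine squeeze_zero (fun _ => norm_nonneg _) (fun k => ?_)
      (by simpa only [zero_mul] using
        h1'.mul_const (eLpNorm (fun x => inner ℝ (gradient ξ x) v) 2 μ).toReal)
    rw [norm_sub_rev, ← integral_sub (integrable_mul_of_memLp hu ev)
      (integrable_mul_of_memLp ((hφ k).memLp 2 μ) ev)]
    simp_rw [← sub_mul]
    exact abs_integral_mul_le (hu.sub ((hφ k).memLp 2 μ)) ev
  have l2 : Tendsto (fun k => ∫ x, inner ℝ (gradient (φ k) x) (ξ x • v) ∂μ) atTop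
      (𝓝 (∫ x, inner ℝ (G x) (ξ x • v) ∂μ)) := by
    rw [tendsto_iff_norm_sub_tendsto_zero]
    refine squeeze_zero (fun _ => norm_nonneg _) (fun k => ?_)
      (by simpa only [zero_mul] using h2'.mul_const (eLpNorm (fun x => ξ x • v) 2 μ).toReal)
    rw [norm_sub_rev, ← integral_sub (integrable_inner_of_memLp hG ev')
      (integrable_inner_of_memLp ((hφ k).memLp_gradient 2 μ) ev')]
    simp_rw [← inner_sub_left]
    exact abs_integral_inner_le (hG.sub ((hφ k).memLp_gradient 2 μ)) ev'
  refine tendsto_nhds_unique l1 (l2.neg.congr fun k => ?_)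
  rw [← e2 ((hφ k).memLp_gradient 2 μ), ← e1 ((hφ k).memLp 2 μ), (hφ k).isWeakGradient hξ]

lemma MemW120.congr (h : MemW120 Ω u G) (hu : u =ᵐ[volume.restrict Ω] u')
    (hG : G =ᵐ[volume.restrict Ω] G') : MemW120 Ω u' G' := by
  obtain ⟨φ, h1, h2, h3⟩ := h.approx
  refine MemW120.of_approx (h.memW12.memLp.ae_eq hu) (h.memW12.memLp_grad.ae_eq hG) h1
    (h2.congr fun k => eLpNorm_congr_ae ?_) (h3.congr fun k => eLpNorm_congr_ae ?_)
  · filter_upwards [hu] with x hx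
    rw [hx]
  · filter_upwards [hG] with x hx
    rw [hx]

variable (Ω) in
/-- The pairs `(φ, ∇φ)`, for `φ` a test function, in the Hilbert space `L² × L²`. -/
def testPairs : Submodule ℝ (WithLp 2 (Lp ℝ 2 (volume.restrict Ω) ×
    Lp (EuclideanSpace ℝ (Fin N)) 2 (volume.restrict Ω))) where
  carrier := {x | ∃ φ, IsTestFunction Ω φ ∧ x.fst =ᵐ[volume.restrict Ω] φ ∧
    x.snd =ᵐ[volume.restrict Ω] gradient φ}
  zero_mem' := ⟨0, ⟨contDiff_const, .zero, by simp [tsupport]⟩, Lp.coeFn_zero _ _ _,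
    (Lp.coeFn_zero _ _ _).trans (.of_eq (by ext1 x; simp [gradient]))⟩
  add_mem' := by
    rintro x y ⟨φ, hφ, h1, h2⟩ ⟨ψ, hψ, h3, h4⟩
    refine ⟨φ + ψ, hφ.add hψ, (Lp.coeFn_add _ _).trans (h1.add h3),
      (Lp.coeFn_add _ _).trans ((h2.add h4).trans (.of_eq ?_))⟩
    ext1 x
    simp only [gradient, Pi.add_apply]
    rw [fderiv_add (hφ.contDiff.differentiable (by simp) x)
      (hψ.contDiff.differentiable (by simp) x), map_add]
  smul_mem' := by
    rintro c x ⟨φ, hφ, h1, h2⟩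
    refine ⟨c • φ, hφ.const_smul c, (Lp.coeFn_smul _ _).trans (h1.const_smul c),
      (Lp.coeFn_smul _ _).trans ((h2.const_smul c).trans (.of_eq ?_))⟩
    ext1 x
    simp only [gradient, Pi.smul_apply]
    rw [fderiv_const_smul (hφ.contDiff.differentiable (by simp) x), map_smul]

/-- `W^{1,2}_0(Ω)` is the closure of the pairs `(φ, ∇φ)` in `L² × L²`. -/
lemma mem_topologicalClosure_testPairs_iff {x : WithLp 2 (Lp ℝ 2 (volume.restrict Ω) ×
    Lp (EuclideanSpace ℝ (Fin N)) 2 (volume.restrict Ω))} :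
    x ∈ (testPairs Ω).topologicalClosure ↔ MemW120 Ω x.fst x.snd := by
  have hlim {y : ℕ → WithLp 2 (Lp ℝ 2 (volume.restrict Ω) ×
      Lp (EuclideanSpace ℝ (Fin N)) 2 (volume.restrict Ω))}
      {φ : ℕ → EuclideanSpace ℝ (Fin N) → ℝ}
      (h1 : ∀ k, (y k).fst =ᵐ[volume.restrict Ω] φ k)
      (h2 : ∀ k, (y k).snd =ᵐ[volume.restrict Ω] gradient (φ k)) :
      Tendsto y atTop (𝓝 x) ↔
        Tendsto (fun k => eLpNorm (fun z => x.fst z - φ k z) 2 (volume.restrict Ω)) atTop (𝓝 0) ∧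
        Tendsto (fun k => eLpNorm (fun z => x.snd z - gradient (φ k) z) 2 (volume.restrict Ω))
          atTop (𝓝 0) := by
    have e1 : Tendsto y atTop (𝓝 x) ↔ Tendsto (fun k => (y k).fst) atTop (𝓝 x.fst) ∧
        Tendsto (fun k => (y k).snd) atTop (𝓝 x.snd) := by
      rw [← (WithLp.prodContinuousLinearEquiv 2 ℝ (Lp ℝ 2 (volume.restrict Ω))
        (Lp (EuclideanSpace ℝ (Fin N)) 2
          (volume.restrict Ω))).toHomeomorph.isInducing.tendsto_nhds_iff.symm]
      exact Prod.tendsto_iff _ _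
    rw [e1, Lp.tendsto_Lp_iff_tendsto_eLpNorm', Lp.tendsto_Lp_iff_tendsto_eLpNorm']
    refine and_congr (tendsto_congr fun k => ?_) (tendsto_congr fun k => ?_)
    · rw [eLpNorm_sub_comm]
      exact eLpNorm_congr_ae ((EventuallyEq.refl _ _).sub (h1 k))
    · rw [eLpNorm_sub_comm]
      exact eLpNorm_congr_ae ((EventuallyEq.refl _ _).sub (h2 k))
  rw [← SetLike.mem_coe, Submodule.topologicalClosure_coe, mem_closure_iff_seq_limit]
  constructor
  · rintro ⟨y, hy, hyx⟩
    choose φ h1 h2 h3 using hy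
    obtain ⟨h4, h5⟩ := (hlim h2 h3).1 hyx
    exact MemW120.of_approx (Lp.memLp _) (Lp.memLp _) h1 h4 h5
  · intro h
    obtain ⟨φ, h1, h2, h3⟩ := h.approx
    have h4 (k) := ((h1 k).memLp 2 (volume.restrict Ω)).coeFn_toLp
    have h5 (k) := ((h1 k).memLp_gradient 2 (volume.restrict Ω)).coeFn_toLp
    let y : ℕ → WithLp 2 (Lp ℝ 2 (volume.restrict Ω) ×
        Lp (EuclideanSpace ℝ (Fin N)) 2 (volume.restrict Ω)) := fun k =>
      WithLp.toLp 2 (((h1 k).memLp 2 (volume.restrict Ω)).toLp _,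
        ((h1 k).memLp_gradient 2 (volume.restrict Ω)).toLp _)
    exact ⟨y, fun k => ⟨φ k, h1 k, h4 k, h5 k⟩, (hlim (y := y) h4 h5).2 ⟨h2, h3⟩⟩

/-- Weak solvability of the Dirichlet problem in a set of finite measure. -/
lemma exists_isWeakSolution (hN : 2 ≤ N) (hΩ : volume Ω ≠ ⊤) {f : EuclideanSpace ℝ (Fin N) → ℝ}
    (hf : MemLp f 2 (volume.restrict Ω)) : ∃ u G, IsWeakSolution Ω f u G ∧
      ∀ u' G', IsWeakSolution Ω f u' G' → u' =ᵐ[volume.restrict Ω] u := by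
  obtain ⟨C, hC0, hC⟩ := exists_poincare hN hΩ
  set X := (testPairs Ω).topologicalClosure
  have hX : ∀ x ∈ X, ‖x.fst‖ ≤ C * ‖x.snd‖ := by
    have hcl : IsClosed {x : WithLp 2 (Lp ℝ 2 (volume.restrict Ω) ×
        Lp (EuclideanSpace ℝ (Fin N)) 2 (volume.restrict Ω)) | ‖x.fst‖ ≤ C * ‖x.snd‖} :=
      isClosed_le (WithLp.fstL 2 ℝ _ _).continuous.norm
        (continuous_const.mul (WithLp.sndL 2 ℝ _ _).continuous.norm)
    refine fun x hx => closure_minimal ?_ hcl hx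
    rintro x ⟨φ, hφ, h1, h2⟩
    have := hC φ hφ
    rwa [← eLpNorm_congr_ae h1, ← eLpNorm_congr_ae h2] at this
  have key : ∀ (a b : EuclideanSpace ℝ (Fin N) → EuclideanSpace ℝ (Fin N))
      (a' b' : Lp (EuclideanSpace ℝ (Fin N)) 2 (volume.restrict Ω)),
      a' =ᵐ[volume.restrict Ω] a → b' =ᵐ[volume.restrict Ω] b →
      inner ℝ a' b' = ∫ x in Ω, inner ℝ (a x) (b x) := fun a b a' b' h1 h2 => by
    rw [L2.inner_def]
    refine integral_congr_ae ?_
    filter_upwards [h1, h2] with x h1 h2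
    rw [h1, h2]
  have key' : ∀ (v : EuclideanSpace ℝ (Fin N) → ℝ) (v' : Lp ℝ 2 (volume.restrict Ω)),
      v' =ᵐ[volume.restrict Ω] v → inner ℝ (hf.toLp f) v' = ∫ x in Ω, v x * f x :=
    fun v v' h1 => by
    rw [L2.inner_def]
    refine integral_congr_ae ?_
    filter_upwards [h1, hf.coeFn_toLp] with x h1 h2
    rw [h1, h2]
    simp
  have lift (v H) (h : MemW120 Ω v H) : ∃ y ∈ X, y.fst =ᵐ[volume.restrict Ω] v ∧
      y.snd =ᵐ[volume.restrict Ω] H := by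
    have h1 := h.memW12.memLp.coeFn_toLp
    have h2 := h.memW12.memLp_grad.coeFn_toLp
    exact ⟨WithLp.toLp 2 (h.memW12.memLp.toLp v, h.memW12.memLp_grad.toLp H),
      mem_topologicalClosure_testPairs_iff.2 (h.congr h1.symm h2.symm), h1, h2⟩
  obtain ⟨x, hx, hxy⟩ := exists_inner_snd_eq_inner_fst
    (Submodule.isClosed_topologicalClosure (testPairs Ω)) hX (hf.toLp f)
  refine ⟨x.fst, x.snd, ⟨mem_topologicalClosure_testPairs_iff.1 hx, fun v H hv => ?_⟩,
    fun u' G' h' => ?_⟩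
  · obtain ⟨y, hy, h1, h2⟩ := lift v H hv
    rw [← key _ _ _ _ (EventuallyEq.refl _ _) h2, ← key' _ _ h1, hxy y hy]
  · obtain ⟨x', hx', h1, h2⟩ := lift u' G' h'.memW120
    have hd : x' - x ∈ X := X.sub_mem hx' hx
    have e1 := hxy _ hd
    have e2 : inner ℝ x'.snd (x' - x).snd = inner ℝ (hf.toLp f) (x' - x).fst := by
      rw [key _ _ _ _ h2 (EventuallyEq.refl _ _), key' _ _ (EventuallyEq.refl _ _)]
      exact h'.weak_eq _ _ (mem_topologicalClosure_testPairs_iff.1 hd)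
    have e3 : (x' - x).snd = 0 := by
      rw [← inner_self_eq_zero (𝕜 := ℝ)]
      nth_rewrite 1 [WithLp.sub_snd]
      rw [inner_sub_left, e1, e2, sub_self]
    have e4 := hX _ hd
    rw [e3, norm_zero, mul_zero, norm_le_zero_iff, WithLp.sub_fst, sub_eq_zero] at e4
    rw [← e4]
    exact h1.symm

end

/-! ### Hölder regularity of the weak solution -/

/-- For `q ≥ 2`, the zero extension of a weak solution satisfies the Morrey condition with
`β = 2 - N / q`, by Hölder's inequality. -/
lemma IsWeakSolution.isExtendedSolution {N : ℕ} {Ω : Set (EuclideanSpace ℝ (Fin N))}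
    {f u : EuclideanSpace ℝ (Fin N) → ℝ} {G : EuclideanSpace ℝ (Fin N) → EuclideanSpace ℝ (Fin N)}
    (h : IsWeakSolution Ω f u G) (hΩ : IsOpen Ω) (hvol : volume Ω ≠ ⊤) {q : ℝ} (hq : 2 ≤ q)
    (hqN : 0 < 2 - N / q) (hf : MemLp f (ENNReal.ofReal q) (volume.restrict Ω)) :
    IsExtendedSolution Ω (Ω.indicator u) (Ω.indicator f)
      (volume.real (Metric.ball (0 : EuclideanSpace ℝ (Fin N)) 1) ^ (1 - 1 / q) *
        (eLpNorm f (ENNReal.ofReal q) (volume.restrict Ω)).toReal) (2 - N / q) := by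
  have hm := hΩ.measurableSet
  have : IsFiniteMeasure (volume.restrict Ω) := isFiniteMeasure_restrict.2 hvol
  have hf2 : MemLp f 2 (volume.restrict Ω) := hf.mono_exponent (by
    rw [← ENNReal.ofReal_ofNat]; exact ENNReal.ofReal_le_ofReal hq)
  have hF : MemLp (Ω.indicator f) (ENNReal.ofReal q) volume :=
    (memLp_indicator_iff_restrict hm).2 hf
  have ind (a b : EuclideanSpace ℝ (Fin N) → ℝ) :
      ∫ x, b x * Ω.indicator a x = ∫ x in Ω, a x * b x := by
    rw [← integral_indicator hm]
    refine integral_congr_ae (ae_of_all _ fun x => ?_)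
    by_cases hx : x ∈ Ω <;> simp [hx, mul_comm]
  have abs_ind (a : EuclideanSpace ℝ (Fin N) → ℝ) (x) :
      |Ω.indicator a x| = Ω.indicator (fun y => |a y|) x := by
    by_cases hx : x ∈ Ω <;> simp [hx]
  refine ⟨hΩ, ?_, ?_, fun x hx => Set.indicator_of_notMem hx _, fun η h1 h2 h3 => ?_,
    fun η hη => ?_, hqN, fun z t ht => ?_⟩
  · exact (integrable_indicator_iff hm).2 (h.memW120.memW12.memLp.integrable one_le_two)
  · exact (integrable_indicator_iff hm).2 (hf2.integrable one_le_two)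
  · simp_rw [abs_ind, ind]
    exact h.integral_abs_mul_laplacian_ge hf2 h1 h2 h3
  · simp_rw [ind]
    exact h.integral_mul_laplacian hη
  · have := setIntegral_closedBall_abs_le (by linarith) hF z ht
    rw [eLpNorm_indicator_eq_eLpNorm_restrict hm] at this
    refine this.trans_eq ?_
    rw [show (N : ℝ) - 2 + (2 - N / q) = N * (1 - 1 / q) by ring]
    ring

/-- A pointwise bound and a Hölder bound give a bound in `C^{0,α}`. -/
lemma holderSpaceNorm_le {N : ℕ} {α M H : ℝ} (hα : 0 < α) (hM : 0 ≤ M) (hH : 0 ≤ H)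
    {v : EuclideanSpace ℝ (Fin N) → ℝ} (h1 : ∀ y, |v y| ≤ M)
    (h2 : ∀ y z, |v y - v z| ≤ H * ‖y - z‖ ^ α) (S : Set (EuclideanSpace ℝ (Fin N))) :
    holderSpaceNorm α S v ≤ ENNReal.ofReal (M + H) := by
  rw [ENNReal.ofReal_add hM hH]
  refine add_le_add (iSup₂_le fun y _ => ?_) (HolderWith.eHolderNorm_le fun y z => ?_)
  · rw [← ofReal_norm]
    exact ENNReal.ofReal_le_ofReal (h1 y)
  · rw [Real.coe_toNNReal α hα.le, edist_dist, Subtype.edist_eq, edist_dist,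
      ENNReal.ofReal_rpow_of_nonneg dist_nonneg hα.le, Real.dist_eq, dist_eq_norm]
    change _ ≤ ENNReal.ofReal H * _
    rw [← ENNReal.ofReal_mul hH]
    exact ENNReal.ofReal_le_ofReal (h2 y z)

/-- The choice of the ratio of consecutive scales: as `α < 1`, a factor of order `θ` is less than
`θ ^ α / 2` for small `θ`. -/
lemma exists_mul_le_rpow_div_two {α : ℝ} (hα1 : α < 1) (c : ℝ) :
    ∃ θ : ℝ, 0 < θ ∧ θ ≤ 1 / 20 ∧ c * θ ≤ θ ^ α / 2 := by
  have h1 : Tendsto (fun θ : ℝ => c * θ ^ (1 - α)) (𝓝[>] 0) (𝓝 0) := by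
    have := ((Real.continuousAt_rpow_const 0 (1 - α) (Or.inr (by linarith))).const_mul c).tendsto
    rw [Real.zero_rpow (by linarith), mul_zero] at this
    exact this.mono_left nhdsWithin_le_nhds
  obtain ⟨θ, h2, h3, h4⟩ := ((h1.eventually_le_const (by norm_num : (0 : ℝ) < 1 / 2)).and
    (Ioc_mem_nhdsGT (by norm_num : (0 : ℝ) < 1 / 20))).exists
  refine ⟨θ, h3, h4, ?_⟩
  have h5 := mul_le_mul_of_nonneg_right h2 (Real.rpow_nonneg h3.le α)
  rw [mul_assoc, ← Real.rpow_add h3, sub_add_cancel, Real.rpow_one] at h5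
  linarith

lemma two_le_of_mem_exponentRange {N : ℕ} (hN : 2 ≤ N) (hN' : N ≤ 5) {q : ℝ}
    (hq : q ∈ exponentRange N) : 2 ≤ q := by
  unfold exponentRange at hq
  interval_cases N <;> norm_num at hq <;> linarith

/-- The bound in `C^{0,α}` that comes with a Morrey constant `A` and a bound `I` for the integrals
of `|U|` over the balls of radius `r₀`. Its first summand bounds the modulus, the second one is the
constant of `IsExtendedSolution.abs_sub_le_of_decay`. -/
noncomputable def holderBound {N : ℕ} (P : RadialProfile N) (θ r₀ α β A I : ℝ) : ℝ :=
  let Q := P.bound * A * r₀ ^ β / β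
  let M := P.bound / r₀ ^ N * I + Q
  let D := (M + 2 * Q / θ ^ α) / θ ^ α / r₀ ^ α
  M + (5 * D + P.bound * volume.real (Metric.ball (0 : EuclideanSpace ℝ (Fin N)) 1) *
    2 ^ N * (4 * D) + (2 * P.bound / (1 - α) + 2 * P.bound / β) * A * r₀ ^ (β - α))

/-- In a Reifenberg-flat domain, the precise representative is Hölder continuous. -/
lemma IsExtendedSolution.exists_holder_representative {N : ℕ} (hN : 0 < N)
    {Ω : Set (EuclideanSpace ℝ (Fin N))} {U F : EuclideanSpace ℝ (Fin N) → ℝ} {A β : ℝ}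
    (h : IsExtendedSolution Ω U F A β) (P : RadialProfile N) {θ r₀ α I : ℝ}
    (hflat : IsReifenbergFlat (θ / 5) r₀ Ω) (hθ0 : 0 < θ) (hθ : θ ≤ 1 / 20) (hα : 0 < α)
    (hα1 : α < 1) (hαβ : α ≤ β)
    (hθα : 8 * 4 ^ (N + 1) * P.bound *
      volume.real (Metric.ball (0 : EuclideanSpace ℝ (Fin N)) 1) * θ ≤ θ ^ α / 2)
    (hI : ∀ z, ∫ y in Metric.closedBall z r₀, |U y| ≤ I) :
    ∃ v, v =ᵐ[volume] U ∧
      ∀ S, holderSpaceNorm α S v ≤ ENNReal.ofReal (holderBound P θ r₀ α β A I) := by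
  obtain ⟨v, hv⟩ := h.exists_isPreciseRepresentative P
  refine ⟨v, h.ae_eq hv, ?_⟩
  have hr₀ := hflat.r_pos
  have hβ := h.β_pos
  have hA := h.A_nonneg
  have hb := P.bound_pos
  have hI0 : 0 ≤ I := (integral_nonneg fun _ => abs_nonneg _).trans (hI 0)
  have hα1' : 0 < 1 - α := by linarith
  set Q := P.bound * A * r₀ ^ β / β with hQ
  have hQ0 : 0 ≤ Q := by positivity
  set M := P.bound / r₀ ^ N * I + Q with hM
  have hM0 : 0 ≤ M := by positivity
  have hMv : ∀ y, |v y| ≤ M := fun y => by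
    by_cases hy : y ∈ Ω
    · refine (h.abs_le_mean hv hy hr₀).trans (add_le_add_left ?_ _)
      refine (P.mean_le hr₀ y h.integrable_left.abs fun _ => abs_nonneg _).trans ?_
      exact mul_le_mul_of_nonneg_left (hI y) (by positivity)
    · rwa [hv.eq_zero y hy, abs_zero]
  set D := (M + 2 * Q / θ ^ α) / θ ^ α / r₀ ^ α with hD
  have hθα0 : 0 < θ ^ α := Real.rpow_pos_of_pos hθ0 α
  have hrα0 : 0 < r₀ ^ α := Real.rpow_pos_of_pos hr₀ α
  have hD0 : 0 ≤ D := by positivity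
  have hDM : M ≤ D * r₀ ^ α := by
    rw [hD, div_mul_cancel₀ _ hrα0.ne', le_div_iff₀ hθα0]
    have h1 : θ ^ α ≤ 1 := Real.rpow_le_one hθ0.le (by linarith) hα.le
    have h2 : 0 ≤ 2 * Q / θ ^ α := by positivity
    linarith [mul_le_of_le_one_right hM0 h1]
  have hDv : ∀ x ∈ frontier Ω, ∀ y, |v y| ≤ D * ‖y - x‖ ^ α := fun x hx y => by
    rcases eq_or_ne y x with rfl | hyx
    · have hyΩ : y ∉ Ω := by
        rw [hflat.isOpen.frontier_eq] at hx
        exact hx.2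
      rw [hv.eq_zero y hyΩ, abs_zero]
      positivity
    · exact h.abs_le_rpow_of_flat hv hr₀ hflat.eps_pos (by linarith) hθ hα hαβ hθα
        (hflat.exists_exterior_cap (by linarith) (by linarith) hx) hMv y hyx
  have hne : Ωᶜ.Nonempty := by
    have : Nontrivial (EuclideanSpace ℝ (Fin N)) :=
      have : Nonempty (Fin N) := ⟨⟨0, hN⟩⟩
      inferInstance
    rw [Set.nonempty_compl]
    rintro rfl
    exact NormedSpace.unbounded_univ ℝ (EuclideanSpace ℝ (Fin N)) hflat.isBounded
  intro S
  exact holderSpaceNorm_le hα hM0 (by positivity) hMv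
    (h.abs_sub_le_of_decay hv hne hr₀ hα hα1 hαβ hMv hDv hDM) S

theorem mainTheorem2 (N : ℕ) (hN : 2 ≤ N) (hN' : N ≤ 5) (α : ℝ) (hα : 0 < α) :
    ∃ ε : ℝ, 0 < ε ∧ ε < 1 / 2 ∧
      ∀ q : ℝ, q ∈ exponentRange N →
        α < 1 - ((N : ℝ) / 2) * (((N : ℝ) - 2) / (2 * (N : ℝ)) + 1 / q) →
        ∀ r₀ : ℝ, 0 < r₀ →
          ∃ C : ℝ → ℝ → ℝ → ℝ,
            ∀ Ω : Set (EuclideanSpace ℝ (Fin N)), IsReifenbergFlat ε r₀ Ω →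
              ∀ f : EuclideanSpace ℝ (Fin N) → ℝ,
                MemLp f (ENNReal.ofReal q) (volume.restrict Ω) →
                (∃ (u : EuclideanSpace ℝ (Fin N) → ℝ)
                    (G : EuclideanSpace ℝ (Fin N) → EuclideanSpace ℝ (Fin N)),
                  IsWeakSolution Ω f u G ∧
                  ∀ (u' : EuclideanSpace ℝ (Fin N) → ℝ)
                    (G' : EuclideanSpace ℝ (Fin N) → EuclideanSpace ℝ (Fin N)),
                    IsWeakSolution Ω f u' G' → u' =ᵐ[volume.restrict Ω] u) ∧
                ∀ (u : EuclideanSpace ℝ (Fin N) → ℝ)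
                  (G : EuclideanSpace ℝ (Fin N) → EuclideanSpace ℝ (Fin N)),
                  IsWeakSolution Ω f u G →
                  ∃ v : EuclideanSpace ℝ (Fin N) → ℝ,
                    v =ᵐ[volume.restrict Ω] u ∧
                    ∀ x ∈ closure Ω,
                      MemHolderSpace α (Metric.ball x (r₀ / 12) ∩ closure Ω) v ∧
                      holderSpaceNorm α (Metric.ball x (r₀ / 12) ∩ closure Ω) v ≤
                        ENNReal.ofReal
                          (C (eLpNorm G 2 (volume.restrict Ω)).toReal
                            (eLpNorm f (ENNReal.ofReal q) (volume.restrict Ω)).toReal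
                            (if N = 2 then (volume Ω).toReal else 0)) := by
  have hN0 : (0 : ℝ) < N := by positivity
  have hN2 : (2 : ℝ) ≤ N := by exact_mod_cast hN
  -- the condition on `q` is `α < β / 2 - (N - 2) / 4`, where `β = 2 - N / q`
  have hexp (q : ℝ) : 1 - ((N : ℝ) / 2) * (((N : ℝ) - 2) / (2 * (N : ℝ)) + 1 / q) =
      (2 - N / q) / 2 - ((N : ℝ) - 2) / 4 := by
    field_simp
    ring
  rcases le_or_gt 1 α with hα1 | hα1
  · -- the condition on `q` is never met, as `β < 2`
    refine ⟨1 / 4, by norm_num, by norm_num, fun q hq hαq => ?_⟩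
    have hq2 := two_le_of_mem_exponentRange hN hN' hq
    have : 0 < N / q := by positivity
    rw [hexp] at hαq
    linarith
  obtain ⟨P⟩ := nonempty_radialProfile (N := N) (by omega)
  obtain ⟨θ, hθ0, hθ, hθα⟩ := exists_mul_le_rpow_div_two hα1 (8 * 4 ^ (N + 1) * P.bound *
    volume.real (Metric.ball (0 : EuclideanSpace ℝ (Fin N)) 1))
  refine ⟨θ / 5, by positivity, by linarith, fun q hq hαq r₀ hr₀ => ?_⟩
  have hq2 := two_le_of_mem_exponentRange hN hN' hq
  have hαβ : α ≤ 2 - N / q := by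
    rw [hexp] at hαq
    linarith
  obtain ⟨K, -, hK⟩ := exists_setIntegral_abs_le hN hr₀
  refine ⟨fun g a w => holderBound P θ r₀ α (2 - N / q)
    (volume.real (Metric.ball (0 : EuclideanSpace ℝ (Fin N)) 1) ^ (1 - 1 / q) * a)
    (K * (if N = 2 then √w else 1) * g), fun Ω hΩ f hf => ?_⟩
  have hvol : volume Ω ≠ ⊤ := hΩ.isBounded.measure_lt_top.ne
  have : IsFiniteMeasure (volume.restrict Ω) := isFiniteMeasure_restrict.2 hvol
  refine ⟨exists_isWeakSolution hN hvol (hf.mono_exponent ?_), fun u G hu => ?_⟩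
  · rw [← ENNReal.ofReal_ofNat]
    exact ENNReal.ofReal_le_ofReal hq2
  obtain ⟨v, hvu, hv⟩ := (hu.isExtendedSolution hΩ.isOpen hvol hq2 (hα.trans_le hαβ)
    hf).exists_holder_representative (by omega) P hΩ hθ0 hθ hα hα1 hαβ hθα
    (hK Ω hΩ.isOpen.measurableSet hvol u G hu.memW120)
  refine ⟨v, ?_, fun x _ => ⟨(hv _).trans_lt ENNReal.ofReal_lt_top, (hv _).trans_eq ?_⟩⟩
  · filter_upwards [ae_restrict_of_ae hvu, ae_restrict_mem hΩ.isOpen.measurableSet] with y h1 h2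
    rw [h1, Set.indicator_of_mem h2]
  · by_cases h2 : N = 2 <;> simp [h2]
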